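/- A $3$-uniform hypergraph is a finite vertex set $V$ with a set $E$ of $3$-element subsets of $V$ (the hyperedges); it is $k$-regular if every vertex lies in exactly $k$ hyperedges. For a real number $c$, say that a finite $3$-uniform hypergraph $H=(V,E)$ has planar overlap at least $c$ if for every injective map $f:V\to\mathbb{R}^2$ there is a point $p\in\mathbb{R}^2$ such that $p\in\operatorname{conv}(f(e))$ for at least $c\,|E|$ hyperedges $e\in E$. (1) For every $\varepsilon>0$ there are a positive integer $k=k(\varepsilon)$ and an infinite sequence of $k$-regular $3$-uniform hypergraphs, with strictly increasing (hence unbounded) numbers of vertices, each having planar overlap at least $\frac29-\varepsilon$. (2) The constant $\frac29$ cannot be improved: for every real $c>\frac29$ and every positive integer $k$ there is an $N$ such that no $k$-regular $3$-uniform hypergraph on $n\ge N$ vertices has planar overlap at least $c$. -/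

import Mathlib

open scoped Hypergraph

namespace Hypergraph

/-- Every hyperedge of `H` contains exactly `r` vertices. -/
def IsUniform {α : Type*} (H : Hypergraph α) (r : ℕ) : Prop :=
  ∀ e ∈ E(H), e.ncard = r

/-- The degree of `v` in `H`: the number of hyperedges containing `v`. -/
noncomputable def degree {α : Type*} (H : Hypergraph α) (v : α) : ℕ :=
  {e | e ∈ E(H) ∧ v ∈ e}.ncard

/-- Every vertex of `H` has degree `k`. -/
def IsRegular {α : Type*} (H : Hypergraph α) (k : ℕ) : Prop :=
  ∀ v ∈ V(H), H.degree v = k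

/-- The number of hyperedges `e` of `H` for which the closed simplex `conv (f(e))` in the plane
contains the point `p`. -/
noncomputable def coverCount {α : Type*} (H : Hypergraph α)
    (f : α → EuclideanSpace ℝ (Fin 2)) (p : EuclideanSpace ℝ (Fin 2)) : ℕ :=
  {e | e ∈ E(H) ∧ p ∈ convexHull ℝ (f '' e)}.ncard

/-- Planar overlap at least `c` (for a finite hypergraph): for every embedding `f` of the vertex
set in the plane, some point of the plane lies in at least `c * |E(H)|` of the simplices
`conv (f(e))`, `e ∈ E(H)`. -/
def HasPlanarOverlap {α : Type*} (H : Hypergraph α) (c : ℝ) : Prop :=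
  ∀ f : α → EuclideanSpace ℝ (Fin 2), Set.InjOn f V(H) →
    ∃ p : EuclideanSpace ℝ (Fin 2), c * (E(H).ncard : ℝ) ≤ (H.coverCount f p : ℝ)

end Hypergraph

/-! ### Halving lines of a measure and the wedges between them -/

section SixPartition

open MeasureTheory Filter Topology Real

/-! Lower bound. Three concurrent lines through a point p cut n points in general position into six
sectors of about n/6 points each. Order the points by the slope of the line joining them to p, and
give each a sign according to its side of one of the three lines. If the signs of three points
alternate along this order, p lies in their triangle (`mem_convexHull_of_alternating`). Opposite
sectors occupy the same segment of the order, so each of three segments holds about n/6 points of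
either sign. This forces about 8 (n/6)^3 = (2/9) (n^3/6) alternating triples (`le_card_altTriples`),
a proportion 2/9 of all triples.

To reach bounded degree, take about κn random triples. There are too many linear orders for a union
bound with κ fixed, so the order is cut into R blocks. This loses only O(n^3/R) triples and leaves
at most (3R)^n colourings `χ`, so a Chernoff bound with κ depending only on ε controls every family
`altEdges χ` at once (`exists_pseudorandom_triples`). The same bound controls the degrees. Few edges
are deleted to cap the degrees, and few vertices and edges are added to make them equal. Placements
not in general position are limits of those that are, and triangles are compact.

Upper bound. Colour the vertices at random with m colours and put colour i near (i, (2m)^i), on a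
stretched diagonal. If a triangle of colours i < j < k contains a point with horizontal index s and
vertical index t, then, apart from a proportion O(1/m) of the colour triples, i < s ≤ j ≤ t+1 < k.
The three ranges have lengths summing to m, so at most (m/3)^3 triples qualify. The six orders of
the vertices of an edge give 6/27 = 2/9. Only (m+1)^2 index pairs matter, and bounded degree makes
most pairs of edges disjoint, so a second moment bound gives one colouring that is good for all
points (`exists_coloring_close`). -/

/-- The linear functional on the plane given by the unit vector of angle `θ`. -/
noncomputable def dirForm (θ : ℝ) (x : ℝ × ℝ) : ℝ := x.1 * cos θ + x.2 * sin θ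

theorem dirForm_add_pi (θ : ℝ) (x : ℝ × ℝ) : dirForm (θ + π) x = -dirForm θ x := by
  simp only [dirForm, cos_add_pi, sin_add_pi]; ring

theorem dirForm_sub (θ : ℝ) (x y : ℝ × ℝ) : dirForm θ (x - y) = dirForm θ x - dirForm θ y := by
  simp only [dirForm, Prod.fst_sub, Prod.snd_sub]; ring

/-- The linear dependence of three unit vectors in the plane. Comparisons of sides of three lines
below are reduced to it. -/
theorem dirForm_relation (θ φ ψ : ℝ) (x : ℝ × ℝ) :
    sin (ψ - φ) * dirForm θ x + sin (φ - θ) * dirForm ψ x = sin (ψ - θ) * dirForm φ x := by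
  simp only [dirForm, sin_sub]; ring

theorem exists_dirForm_eq {θ φ : ℝ} (h : sin (φ - θ) ≠ 0) (a b : ℝ) :
    ∃ x, dirForm θ x = a ∧ dirForm φ x = b := by
  refine ⟨((a * sin φ - b * sin θ) / sin (φ - θ), (b * cos θ - a * cos φ) / sin (φ - θ)), ?_, ?_⟩
  all_goals
    simp only [dirForm]
    rw [div_mul_eq_mul_div, div_mul_eq_mul_div, ← add_div, div_eq_iff h, sin_sub]
    ring

@[fun_prop]
theorem continuous_dirForm (θ : ℝ) : Continuous (dirForm θ) := by unfold dirForm; fun_prop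

@[fun_prop]
theorem continuous_dirForm_angle (x : ℝ × ℝ) : Continuous fun θ => dirForm θ x := by
  unfold dirForm; fun_prop

theorem measurableSet_dirForm_lt (θ t : ℝ) : MeasurableSet {x | dirForm θ x < t} :=
  (isOpen_lt (continuous_dirForm θ) continuous_const).measurableSet

/-- A measure for which every line is a null set. -/
def NullLines (μ : Measure (ℝ × ℝ)) : Prop := ∀ θ t, μ {x | dirForm θ x = t} = 0

/-- Dominated convergence for indicators. A point off the limiting boundary lines eventually stays
on its side, so half-planes and wedges vary continuously in measure when lines are null. -/
theorem tendsto_measureReal_of_ae {α ι : Type*} [MeasurableSpace α] {μ : Measure α}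
    [IsFiniteMeasure μ] {l : Filter ι} [l.IsCountablyGenerated] {A : Set α} {As : ι → Set α}
    (hA : MeasurableSet A) (hAs : ∀ i, MeasurableSet (As i))
    (h : ∀ᵐ x ∂μ, ∀ᶠ i in l, x ∈ As i ↔ x ∈ A) :
    Tendsto (fun i => μ.real (As i)) l (𝓝 (μ.real A)) :=
  (ENNReal.tendsto_toReal (by finiteness)).comp
    (tendsto_measure_of_ae_tendsto_indicator_of_isFiniteMeasure l hA hAs h)

variable {μ : Measure (ℝ × ℝ)}

theorem NullLines.ae_ne (hμ : NullLines μ) (θ t : ℝ) : ∀ᵐ x ∂μ, dirForm θ x ≠ t := by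
  rw [ae_iff]; simpa using hμ θ t

theorem NullLines.split [IsFiniteMeasure μ] (hμ : NullLines μ) (S : Set (ℝ × ℝ)) (θ t : ℝ) :
    μ.real S = μ.real (S ∩ {x | dirForm θ x < t}) + μ.real (S ∩ {x | t < dirForm θ x}) := by
  rw [← measureReal_inter_add_sdiff (s := S) (measurableSet_dirForm_lt θ t)]
  congr 1
  apply measureReal_congr
  filter_upwards [hμ.ae_ne θ t] with x hx
  apply propext
  change (x ∈ S ∧ ¬ dirForm θ x < t) ↔ (x ∈ S ∧ t < dirForm θ x)
  rw [not_lt, le_iff_lt_or_eq]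
  exact ⟨fun h => ⟨h.1, h.2.resolve_right (Ne.symm hx)⟩, fun h => ⟨h.1, Or.inl h.2⟩⟩

theorem eventually_lt_iff_of_ne {ι : Type*} {l : Filter ι} {f g : ι → ℝ} {a b : ℝ}
    (hf : Tendsto f l (𝓝 a)) (hg : Tendsto g l (𝓝 b)) (h : a ≠ b) :
    ∀ᶠ i in l, f i < g i ↔ a < b := by
  rcases lt_or_gt_of_ne h with h | h
  · filter_upwards [hf.eventually_lt hg h] with i hi
    simp [hi, h]
  · filter_upwards [hg.eventually_lt hf h] with i hi
    exact iff_of_false hi.not_gt h.not_gt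

theorem continuous_halfPlane_angle [IsFiniteMeasure μ] (hμ : NullLines μ) (t : ℝ) :
    Continuous fun θ => μ.real {x | dirForm θ x < t} := by
  rw [continuous_iff_continuousAt]
  intro θ
  refine tendsto_measureReal_of_ae (measurableSet_dirForm_lt _ _)
    (fun _ => measurableSet_dirForm_lt _ _) ?_
  filter_upwards [hμ.ae_ne θ t] with x hx
  exact eventually_lt_iff_of_ne (continuous_dirForm_angle x).continuousAt tendsto_const_nhds hx

theorem continuous_halfPlane_level [IsFiniteMeasure μ] (hμ : NullLines μ) (θ : ℝ) :
    Continuous fun t => μ.real {x | dirForm θ x < t} := by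
  rw [continuous_iff_continuousAt]
  intro t
  refine tendsto_measureReal_of_ae (measurableSet_dirForm_lt _ _)
    (fun _ => measurableSet_dirForm_lt _ _) ?_
  filter_upwards [hμ.ae_ne θ t] with x hx
  exact eventually_lt_iff_of_ne tendsto_const_nhds continuousAt_id hx

theorem isOpen_wedge (θ s φ t : ℝ) : IsOpen {x | s < dirForm θ x ∧ dirForm φ x < t} :=
  (isOpen_lt continuous_const (continuous_dirForm θ)).inter
    (isOpen_lt (continuous_dirForm φ) continuous_const)

theorem measureReal_pos_of_isOpen [IsFiniteMeasure μ] [μ.IsOpenPosMeasure] {U : Set (ℝ × ℝ)}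
    (hU : IsOpen U) (hne : U.Nonempty) : 0 < μ.real U :=
  ENNReal.toReal_pos (hU.measure_ne_zero μ hne) (by finiteness)

/-- Full support gives every open strip positive mass. This makes the halving level unique, hence
odd under a half turn and continuous in the angle. -/
theorem halfPlane_strictMono [IsFiniteMeasure μ] [μ.IsOpenPosMeasure] (hμ : NullLines μ) (θ : ℝ) :
    StrictMono fun t => μ.real {x | dirForm θ x < t} := by
  intro s t hst
  change μ.real {x | dirForm θ x < s} < μ.real {x | dirForm θ x < t}
  rw [hμ.split {x | dirForm θ x < t} θ s]
  have h1 : {x | dirForm θ x < t} ∩ {x | dirForm θ x < s} = {x | dirForm θ x < s} := by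
    ext x; simp only [Set.mem_inter_iff, Set.mem_ofPred_eq]; constructor
    · exact fun h => h.2
    · exact fun h => ⟨h.trans hst, h⟩
  have h2 : 0 < μ.real ({x | dirForm θ x < t} ∩ {x | s < dirForm θ x}) := by
    rw [Set.inter_comm]
    refine measureReal_pos_of_isOpen (isOpen_wedge θ s θ t) ?_
    obtain ⟨x, hx, -⟩ := exists_dirForm_eq (θ := θ) (φ := θ + π / 2) (by simp) ((s + t) / 2) 0
    exact ⟨x, lt_of_lt_of_eq (by linarith) hx.symm, lt_of_eq_of_lt hx (by linarith)⟩
  rw [h1]; linarith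

theorem exists_median [IsFiniteMeasure μ] [μ.IsOpenPosMeasure] (hμ : NullLines μ) (θ : ℝ) :
    ∃ t, μ.real {x | dirForm θ x < t} = μ.real Set.univ / 2 := by
  have hM : 0 < μ.real Set.univ := measureReal_pos_of_isOpen isOpen_univ Set.univ_nonempty
  have hbot : Tendsto (fun t => μ.real {x | dirForm θ x < t}) atBot (𝓝 (μ.real ∅)) := by
    refine tendsto_measureReal_of_ae .empty (fun _ => measurableSet_dirForm_lt _ _) ?_
    refine Eventually.of_forall fun x => ?_
    filter_upwards [eventually_le_atBot (dirForm θ x)] with t ht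
    simpa using ht
  have htop : Tendsto (fun t => μ.real {x | dirForm θ x < t}) atTop (𝓝 (μ.real Set.univ)) := by
    refine tendsto_measureReal_of_ae .univ (fun _ => measurableSet_dirForm_lt _ _) ?_
    refine Eventually.of_forall fun x => ?_
    filter_upwards [eventually_gt_atTop (dirForm θ x)] with t ht
    simpa using ht
  rw [measureReal_empty] at hbot
  exact mem_range_of_exists_le_of_exists_ge (continuous_halfPlane_level hμ θ)
    ((hbot.eventually_le_const (half_pos hM)).exists)
    ((htop.eventually_const_le (half_lt_self hM)).exists)

/-- `m θ` is the level of the line of normal direction `θ` that halves `μ`. -/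
def IsMedian (μ : Measure (ℝ × ℝ)) (m : ℝ → ℝ) : Prop :=
  ∀ θ, μ.real {x | dirForm θ x < m θ} = μ.real Set.univ / 2

variable {m : ℝ → ℝ}

theorem IsMedian.upper [IsFiniteMeasure μ] (hμ : NullLines μ) (hm : IsMedian μ m) (θ : ℝ) :
    μ.real {x | m θ < dirForm θ x} = μ.real Set.univ / 2 := by
  have h := hμ.split Set.univ θ (m θ)
  simp only [Set.univ_inter] at h
  have := hm θ
  linarith

theorem IsMedian.add_pi [IsFiniteMeasure μ] [μ.IsOpenPosMeasure] (hμ : NullLines μ)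
    (hm : IsMedian μ m) (θ : ℝ) : m (θ + π) = -m θ := by
  apply (halfPlane_strictMono hμ (θ + π)).injective
  change μ.real {x | dirForm (θ + π) x < m (θ + π)} = μ.real {x | dirForm (θ + π) x < -m θ}
  rw [hm (θ + π), ← hm.upper hμ θ]
  simp only [dirForm_add_pi, neg_lt_neg_iff]

theorem IsMedian.continuous [IsFiniteMeasure μ] [μ.IsOpenPosMeasure] (hμ : NullLines μ)
    (hm : IsMedian μ m) : Continuous m := by
  rw [continuous_iff_continuousAt]
  intro θ
  refine tendsto_order.2 ⟨fun a ha => ?_, fun a ha => ?_⟩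
  · have h := halfPlane_strictMono hμ θ ha
    simp only [hm θ] at h
    filter_upwards [(continuous_halfPlane_angle hμ a).continuousAt.eventually_lt_const h] with η hη
    rw [← hm η] at hη
    exact (halfPlane_strictMono hμ η).lt_iff_lt.1 hη
  · have h := halfPlane_strictMono hμ θ ha
    simp only [hm θ] at h
    filter_upwards [(continuous_halfPlane_angle hμ a).continuousAt.eventually_const_lt h] with η hη
    rw [← hm η] at hη
    exact (halfPlane_strictMono hμ η).lt_iff_lt.1 hη

/-- The measure of the wedge above the halving line of direction `θ` and below that of
direction `φ`. -/
noncomputable def wedge (μ : Measure (ℝ × ℝ)) (m : ℝ → ℝ) (θ φ : ℝ) : ℝ :=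
  μ.real {x | m θ < dirForm θ x ∧ dirForm φ x < m φ}

theorem continuous_wedge [IsFiniteMeasure μ] (hμ : NullLines μ) (hm : Continuous m) :
    Continuous fun p : ℝ × ℝ => wedge μ m p.1 p.2 := by
  rw [continuous_iff_continuousAt]
  rintro ⟨θ, φ⟩
  refine tendsto_measureReal_of_ae (isOpen_wedge _ _ _ _).measurableSet
    (fun _ => (isOpen_wedge _ _ _ _).measurableSet) ?_
  filter_upwards [hμ.ae_ne θ (m θ), hμ.ae_ne φ (m φ)] with x hx hx'
  have h1 : Tendsto (fun p : ℝ × ℝ => dirForm p.1 x) (𝓝 (θ, φ)) (𝓝 (dirForm θ x)) :=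
    ((continuous_dirForm_angle x).comp continuous_fst).continuousAt
  have h2 : Tendsto (fun p : ℝ × ℝ => dirForm p.2 x) (𝓝 (θ, φ)) (𝓝 (dirForm φ x)) :=
    ((continuous_dirForm_angle x).comp continuous_snd).continuousAt
  have h3 : Tendsto (fun p : ℝ × ℝ => m p.1) (𝓝 (θ, φ)) (𝓝 (m θ)) :=
    (hm.comp continuous_fst).continuousAt
  have h4 : Tendsto (fun p : ℝ × ℝ => m p.2) (𝓝 (θ, φ)) (𝓝 (m φ)) :=
    (hm.comp continuous_snd).continuousAt
  filter_upwards [eventually_lt_iff_of_ne h3 h1 hx.symm, eventually_lt_iff_of_ne h2 h4 hx']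
    with p hp hp'
  exact and_congr hp hp'

theorem wedge_self (θ : ℝ) : wedge μ m θ θ = 0 := by
  have : {x | m θ < dirForm θ x ∧ dirForm θ x < m θ} = ∅ := by
    ext x; simp only [Set.mem_ofPred_eq, Set.mem_empty_iff_false, iff_false]
    exact fun h => lt_asymm h.1 h.2
  rw [wedge, this, measureReal_empty]

section Median

variable [IsFiniteMeasure μ] [μ.IsOpenPosMeasure]

theorem wedge_add_pi_right (hμ : NullLines μ) (hm : IsMedian μ m) (θ φ : ℝ) :
    wedge μ m θ (φ + π) = μ.real {x | m θ < dirForm θ x ∧ m φ < dirForm φ x} := by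
  simp only [wedge, dirForm_add_pi, hm.add_pi hμ, neg_lt_neg_iff]

theorem wedge_add_wedge_add_pi (hμ : NullLines μ) (hm : IsMedian μ m) (θ φ : ℝ) :
    wedge μ m θ φ + wedge μ m θ (φ + π) = μ.real Set.univ / 2 := by
  rw [wedge_add_pi_right hμ hm, ← hm.upper hμ θ, hμ.split {x | m θ < dirForm θ x} φ (m φ)]
  rfl

/-- Opposite wedges between two halving lines have equal mass: each completes the sector above both
lines to a half-plane of mass one half. -/
theorem wedge_swap (hμ : NullLines μ) (hm : IsMedian μ m) (θ φ : ℝ) :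
    μ.real {x | dirForm θ x < m θ ∧ m φ < dirForm φ x} = wedge μ m θ φ := by
  have h1 := hμ.split {x | m φ < dirForm φ x} θ (m θ)
  have h2 := wedge_add_wedge_add_pi hμ hm θ φ
  rw [wedge_add_pi_right hμ hm] at h2
  rw [hm.upper hμ φ] at h1
  have h3 : {x | m φ < dirForm φ x} ∩ {x | dirForm θ x < m θ}
      = {x | dirForm θ x < m θ ∧ m φ < dirForm φ x} := Set.inter_comm _ _
  have h4 : {x | m φ < dirForm φ x} ∩ {x | m θ < dirForm θ x}
      = {x | m θ < dirForm θ x ∧ m φ < dirForm φ x} := Set.inter_comm _ _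
  rw [h3, h4] at h1
  linarith

theorem wedge_add_pi_add_pi (hμ : NullLines μ) (hm : IsMedian μ m) (θ φ : ℝ) :
    wedge μ m (θ + π) (φ + π) = wedge μ m θ φ := by
  rw [wedge_add_pi_right hμ hm, ← wedge_swap hμ hm θ φ]
  simp only [dirForm_add_pi, hm.add_pi hμ, neg_lt_neg_iff]

theorem wedge_add_pi_self (hμ : NullLines μ) (hm : IsMedian μ m) (θ : ℝ) :
    wedge μ m θ (θ + π) = μ.real Set.univ / 2 := by
  have h := wedge_add_wedge_add_pi hμ hm θ θ
  rwa [wedge_self, zero_add] at h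

/-- The two wedges share `C ∩ A ∩ B` and otherwise consist of the parts above the line of `θ` of the
opposite wedges `W1` and `W2`, which have equal mass. It remains to see that `C` keeps more of `W1`
than of `W2`. -/
theorem wedge_lt_wedge (hμ : NullLines μ) (hm : IsMedian μ m) {θ φ φ' : ℝ} (h1 : θ < φ)
    (h2 : φ < φ') (h3 : φ' < θ + π) : wedge μ m θ φ < wedge μ m θ φ' := by
  have s1 : 0 < sin (φ' - φ) := sin_pos_of_pos_of_lt_pi (by linarith) (by linarith)
  have s2 : 0 < sin (φ - θ) := sin_pos_of_pos_of_lt_pi (by linarith) (by linarith)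
  have s3 : 0 < sin (φ' - θ) := sin_pos_of_pos_of_lt_pi (by linarith) (by linarith)
  set C := {x | m θ < dirForm θ x}
  set A := {x | dirForm φ' x < m φ'} with hA
  set B := {x | dirForm φ x < m φ} with hB
  set W1 := {x | m φ < dirForm φ x ∧ dirForm φ' x < m φ'} with hW1
  set W2 := {x | dirForm φ x < m φ ∧ m φ' < dirForm φ' x} with hW2
  have hW : μ.real W2 = μ.real W1 := wedge_swap hμ hm φ φ'
  have e1 : wedge μ m θ φ' = μ.real (C ∩ A ∩ B) + μ.real (C ∩ W1) := by
    have := hμ.split (C ∩ A) φ (m φ)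
    have h' : C ∩ A ∩ {x | m φ < dirForm φ x} = C ∩ W1 := by
      ext x; simp only [hA, hW1, Set.mem_inter_iff, Set.mem_ofPred_eq]; tauto
    rw [h'] at this
    exact this
  have e2 : wedge μ m θ φ = μ.real (C ∩ A ∩ B) + μ.real (C ∩ W2) := by
    have := hμ.split (C ∩ B) φ' (m φ')
    have h' : C ∩ B ∩ {x | m φ' < dirForm φ' x} = C ∩ W2 := by
      ext x; simp only [hB, hW2, Set.mem_inter_iff, Set.mem_ofPred_eq]; tauto
    have h'' : C ∩ B ∩ {x | dirForm φ' x < m φ'} = C ∩ A ∩ B := by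
      rw [Set.inter_right_comm]
    rw [h', h''] at this
    exact this
  rw [e1, e2, add_lt_add_iff_left]
  have rel := fun x => dirForm_relation θ φ φ' x
  -- The cases are whether the crossing point of the lines of `φ` and `φ'` lies above or below the
  -- line of `θ`. Above, `W1` lies inside `C` and `W2` sticks out; below, `W2` misses `C` and `W1`
  -- meets it.
  rcases le_total (sin (φ' - φ) * m θ + sin (φ - θ) * m φ') (sin (φ' - θ) * m φ) with hK | hK
  · have hsub : C ∩ W1 = W1 := by
      rw [Set.inter_eq_right]
      rintro x ⟨hx1, hx2⟩
      change m θ < dirForm θ x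
      nlinarith [rel x, mul_lt_mul_of_pos_left hx1 s3, mul_lt_mul_of_pos_left hx2 s2]
    rw [hsub, ← hW, hμ.split W2 θ (m θ), Set.inter_comm C W2]
    refine lt_add_of_pos_left _ ?_
    have hop : IsOpen (W2 ∩ {x | dirForm θ x < m θ}) :=
      ((isOpen_lt (continuous_dirForm φ) continuous_const).inter
        (isOpen_lt continuous_const (continuous_dirForm φ'))).inter
        (isOpen_lt (continuous_dirForm θ) continuous_const)
    refine measureReal_pos_of_isOpen hop ?_
    -- Moving from the crossing point into `W2` by `T` in both levels lowers `dirForm θ` by a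
    -- positive multiple of `T`, so a large `T` passes below the line of `θ`.
    obtain ⟨T, hT⟩ := exists_gt (max 0
      ((sin (φ' - θ) * m φ - sin (φ' - φ) * m θ - sin (φ - θ) * m φ') / sin (φ' - θ)))
    obtain ⟨hT0, hT1⟩ := max_lt_iff.1 hT
    obtain ⟨x, hx1, hx2⟩ := exists_dirForm_eq s1.ne' (m φ - T) (m φ' + T)
    refine ⟨x, ⟨?_, ?_⟩, ?_⟩
    · linarith
    · linarith
    · change dirForm θ x < m θ
      have := rel x
      rw [hx1, hx2] at this
      rw [div_lt_iff₀ s3] at hT1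
      nlinarith [mul_pos s2 hT0]
  · have hsub : C ∩ W2 = ∅ := by
      rw [Set.eq_empty_iff_forall_notMem]
      rintro x ⟨hx0, hx1, hx2⟩
      change m θ < dirForm θ x at hx0
      nlinarith [rel x, mul_lt_mul_of_pos_left hx1 s3, mul_lt_mul_of_pos_left hx2 s2,
        mul_lt_mul_of_pos_left hx0 s1]
    rw [hsub, measureReal_empty]
    have hop : IsOpen (C ∩ W1) :=
      (isOpen_lt continuous_const (continuous_dirForm θ)).inter (isOpen_wedge _ _ _ _)
    refine measureReal_pos_of_isOpen hop ?_
    obtain ⟨T, hT⟩ := exists_gt (max 0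
      ((sin (φ' - φ) * m θ + sin (φ - θ) * m φ' - sin (φ' - θ) * m φ) / sin (φ' - θ)))
    obtain ⟨hT0, hT1⟩ := max_lt_iff.1 hT
    obtain ⟨x, hx1, hx2⟩ := exists_dirForm_eq s1.ne' (m φ + T) (m φ' - T)
    refine ⟨x, ?_, ?_, ?_⟩
    · change m θ < dirForm θ x
      have := rel x
      rw [hx1, hx2] at this
      rw [div_lt_iff₀ s3] at hT1
      nlinarith [mul_pos s2 hT0]
    · linarith
    · linarith

end Median

end SixPartition

/-! ### Three concurrent lines that cut a measure into six equal parts -/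

section SixPartition

open MeasureTheory Filter Topology Real

variable {μ : Measure (ℝ × ℝ)} [IsFiniteMeasure μ] [μ.IsOpenPosMeasure] {m : ℝ → ℝ}

theorem exists_wedge_eq (hμ : NullLines μ) (hm : IsMedian μ m) (θ : ℝ) :
    ∃ β ∈ Set.Ioo 0 π, wedge μ m θ (θ + β) = μ.real Set.univ / 6 := by
  have hM : 0 < μ.real Set.univ := measureReal_pos_of_isOpen isOpen_univ Set.univ_nonempty
  have hc : Continuous fun β => wedge μ m θ (θ + β) :=
    (continuous_wedge hμ (hm.continuous hμ)).comp (by fun_prop : Continuous fun β => (θ, θ + β))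
  have := intermediate_value_Ioo pi_pos.le hc.continuousOn
  simp only [add_zero, wedge_self, wedge_add_pi_self hμ hm] at this
  exact this ⟨by linarith, by linarith⟩

theorem wedge_root_unique (hμ : NullLines μ) (hm : IsMedian μ m) {θ a b : ℝ}
    (ha : a ∈ Set.Ioo 0 π) (hb : b ∈ Set.Ioo 0 π)
    (h : wedge μ m θ (θ + a) = wedge μ m θ (θ + b)) : a = b := by
  rcases lt_trichotomy a b with hab | hab | hab
  · exact absurd h (wedge_lt_wedge hμ hm (by linarith [ha.1]) (by linarith)
      (by linarith [hb.2])).ne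
  · exact hab
  · exact absurd h (wedge_lt_wedge hμ hm (by linarith [hb.1]) (by linarith)
      (by linarith [ha.2])).ne'

/-- By strict monotonicity in the second angle, comparing the root with a fixed `a` amounts to
comparing the wedge of opening `a` with `c`, an open condition in `θ`. -/
theorem continuous_wedge_root (hμ : NullLines μ) (hm : IsMedian μ m) {β : ℝ → ℝ} {c : ℝ}
    (hβ : ∀ θ, β θ ∈ Set.Ioo 0 π) (hc : ∀ θ, wedge μ m θ (θ + β θ) = c) : Continuous β := by
  have hcont : ∀ a, Continuous fun θ => wedge μ m θ (θ + a) := fun a =>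
    (continuous_wedge hμ (hm.continuous hμ)).comp (by fun_prop : Continuous fun θ => (θ, θ + a))
  rw [continuous_iff_continuousAt]
  intro θ
  refine tendsto_order.2 ⟨fun a ha => ?_, fun a ha => ?_⟩
  · rcases le_or_gt a 0 with h0 | h0
    · exact Eventually.of_forall fun η => h0.trans_lt (hβ η).1
    · have h := wedge_lt_wedge hμ hm (by linarith) (by linarith : θ + a < θ + β θ)
        (by linarith [(hβ θ).2])
      rw [hc θ] at h
      filter_upwards [(hcont a).continuousAt.eventually_lt_const h] with η hη
      rw [← hc η] at hη
      by_contra! hle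
      rcases hle.eq_or_lt with e | hlt
      · rw [e] at hη; exact lt_irrefl _ hη
      · exact lt_asymm hη (wedge_lt_wedge hμ hm (by linarith [(hβ η).1]) (by linarith)
          (by linarith [(hβ θ).2]))
  · rcases le_or_gt π a with h0 | h0
    · exact Eventually.of_forall fun η => (hβ η).2.trans_le h0
    · have h := wedge_lt_wedge hμ hm (by linarith [(hβ θ).1]) (by linarith : θ + β θ < θ + a)
        (by linarith)
      rw [hc θ] at h
      filter_upwards [(hcont a).continuousAt.eventually_const_lt h] with η hη
      rw [← hc η] at hη
      by_contra! hle
      rcases hle.eq_or_lt with e | hlt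
      · rw [e] at hη; exact lt_irrefl _ hη
      · exact lt_asymm hη (wedge_lt_wedge hμ hm (by linarith [(hβ θ).1]) (by linarith)
          (by linarith [(hβ η).2]))

/-- Rotate a halving line by the angle that cuts off a sixth, twice in succession. A half turn of
the start reverses the orientation of all three lines and so changes the sign of their concurrency
determinant `D`, which therefore vanishes somewhere. -/
theorem exists_concurrent_medians (hμ : NullLines μ) (hm : IsMedian μ m) :
    ∃ θ φ ψ p, θ < φ ∧ φ < ψ ∧ ψ < θ + π ∧ dirForm θ p = m θ ∧ dirForm φ p = m φ ∧
      dirForm ψ p = m ψ ∧ wedge μ m θ φ = μ.real Set.univ / 6 ∧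
      wedge μ m φ ψ = μ.real Set.univ / 6 := by
  have hM : 0 < μ.real Set.univ := measureReal_pos_of_isOpen isOpen_univ Set.univ_nonempty
  choose β hβ hβw using exists_wedge_eq hμ hm
  have hβc : Continuous β := continuous_wedge_root hμ hm hβ hβw
  have hmc := hm.continuous hμ
  have hβp : ∀ θ, β (θ + π) = β θ := fun θ => by
    refine wedge_root_unique hμ hm (θ := θ + π) (hβ _) (hβ _) ?_
    rw [hβw, add_right_comm, wedge_add_pi_add_pi hμ hm, hβw]
  set F : ℝ → ℝ := fun θ => θ + β θ with hF
  have hFc : Continuous F := continuous_id.add hβc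
  have hFp : ∀ θ, F (θ + π) = F θ + π := fun θ => by simp only [hF, hβp]; ring
  set D : ℝ → ℝ := fun θ => m θ * sin (F (F θ) - F θ) - m (F θ) * sin (F (F θ) - θ)
    + m (F (F θ)) * sin (F θ - θ) with hD
  have hDc : Continuous D := by simp only [hD]; fun_prop
  have hDp : D (0 + π) = -D 0 := by
    simp only [hD, hFp, hm.add_pi hμ, add_sub_add_right_eq_sub]; ring
  obtain ⟨θ, hθ⟩ : ∃ θ, D θ = 0 := by
    rcases le_total (D 0) 0 with h | h
    · exact mem_range_of_exists_le_of_exists_ge hDc ⟨0, h⟩ ⟨0 + π, by rw [hDp]; linarith⟩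
    · exact mem_range_of_exists_le_of_exists_ge hDc ⟨0 + π, by rw [hDp]; linarith⟩ ⟨0, h⟩
  have h1 : θ < F θ := by simp only [hF]; linarith [(hβ θ).1]
  have h1' : F θ < θ + π := by simp only [hF]; linarith [(hβ θ).2]
  have h2 : F θ < F (F θ) := by
    have := (hβ (F θ)).1
    change F θ < F θ + β (F θ); linarith
  have h2' : F (F θ) < F θ + π := by
    have := (hβ (F θ)).2
    change F θ + β (F θ) < F θ + π; linarith
  -- The wedge from `F θ` to `θ + π` has mass 1/2 - 1/6 = 1/3 of the total, more than a sixth, so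
  -- the second rotation stops before `θ + π`.
  have h3 : F (F θ) < θ + π := by
    by_contra! hle
    have e1 : wedge μ m (F θ) (θ + π) = μ.real Set.univ / 3 := by
      have e2 := wedge_add_wedge_add_pi hμ hm (F θ) θ
      have e3 : wedge μ m (F θ) θ = μ.real Set.univ / 6 := by
        rw [← hβw θ, ← wedge_swap hμ hm θ (θ + β θ), wedge]
        simp only [and_comm, hF]
      linarith
    have e4 : wedge μ m (F θ) (F (F θ)) = μ.real Set.univ / 6 := hβw (F θ)
    rcases hle.eq_or_lt with e | hlt
    · rw [e] at e1; linarith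
    · linarith [wedge_lt_wedge hμ hm h1' hlt h2']
  have s1 : 0 < sin (F θ - θ) := sin_pos_of_pos_of_lt_pi (by linarith) (by linarith)
  obtain ⟨p, hp1, hp2⟩ := exists_dirForm_eq s1.ne' (m θ) (m (F θ))
  refine ⟨θ, F θ, F (F θ), p, h1, h2, h3, hp1, hp2, ?_, hβw θ, hβw (F θ)⟩
  have rel := dirForm_relation θ (F θ) (F (F θ)) p
  rw [hp1, hp2] at rel
  simp only [hD] at hθ
  apply mul_left_cancel₀ s1.ne'
  linarith

/-- Every finite measure with full support that does not charge lines is divided into six equal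
parts by three concurrent lines. -/
theorem exists_six_partition (hμ : NullLines μ) :
    ∃ θ φ ψ p, θ < φ ∧ φ < ψ ∧ ψ < θ + π ∧
      μ.real {x | 0 < dirForm θ (x - p) ∧ dirForm φ (x - p) < 0} = μ.real Set.univ / 6 ∧
      μ.real {x | dirForm θ (x - p) < 0 ∧ 0 < dirForm φ (x - p)} = μ.real Set.univ / 6 ∧
      μ.real {x | 0 < dirForm φ (x - p) ∧ dirForm ψ (x - p) < 0} = μ.real Set.univ / 6 ∧
      μ.real {x | dirForm φ (x - p) < 0 ∧ 0 < dirForm ψ (x - p)} = μ.real Set.univ / 6 ∧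
      μ.real {x | 0 < dirForm θ (x - p) ∧ 0 < dirForm ψ (x - p)} = μ.real Set.univ / 6 ∧
      μ.real {x | dirForm θ (x - p) < 0 ∧ dirForm ψ (x - p) < 0} = μ.real Set.univ / 6 := by
  choose m hm using exists_median hμ
  replace hm : IsMedian μ m := hm
  obtain ⟨θ, φ, ψ, p, h1, h2, h3, hp1, hp2, hp3, w1, w2⟩ := exists_concurrent_medians hμ hm
  refine ⟨θ, φ, ψ, p, h1, h2, h3, ?_⟩
  have rel := fun x => dirForm_relation θ φ ψ (x - p)
  simp only [dirForm_sub, hp1, hp2, hp3, sub_pos, sub_neg] at rel ⊢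
  have s1 : 0 < sin (φ - θ) := sin_pos_of_pos_of_lt_pi (by linarith) (by linarith)
  have s2 : 0 < sin (ψ - φ) := sin_pos_of_pos_of_lt_pi (by linarith) (by linarith)
  have s3 : 0 < sin (ψ - θ) := sin_pos_of_pos_of_lt_pi (by linarith) (by linarith)
  -- Concurrency makes the middle line split this wedge into the two sixths already found. The
  -- remaining sector then has mass 1/2 - 1/3.
  have w3 : wedge μ m θ ψ = μ.real Set.univ / 3 := by
    have h := hμ.split {x | m θ < dirForm θ x ∧ dirForm ψ x < m ψ} φ (m φ)
    have e1 : {x | m θ < dirForm θ x ∧ dirForm ψ x < m ψ} ∩ {x | dirForm φ x < m φ}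
        = {x | m θ < dirForm θ x ∧ dirForm φ x < m φ} := by
      ext x
      simp only [Set.mem_inter_iff, Set.mem_ofPred_eq]
      refine ⟨fun h => ⟨h.1.1, h.2⟩, fun h => ⟨⟨h.1, ?_⟩, h.2⟩⟩
      by_contra! hle
      nlinarith [rel x, mul_lt_mul_of_pos_left h.1 s2, mul_lt_mul_of_pos_left h.2 s3,
        mul_le_mul_of_nonneg_left hle s1.le]
    have e2 : {x | m θ < dirForm θ x ∧ dirForm ψ x < m ψ} ∩ {x | m φ < dirForm φ x}
        = {x | m φ < dirForm φ x ∧ dirForm ψ x < m ψ} := by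
      ext x
      simp only [Set.mem_inter_iff, Set.mem_ofPred_eq]
      refine ⟨fun h => ⟨h.2, h.1.2⟩, fun h => ⟨⟨?_, h.2⟩, h.1⟩⟩
      by_contra! hle
      nlinarith [rel x, mul_lt_mul_of_pos_left h.1 s3, mul_lt_mul_of_pos_left h.2 s1,
        mul_le_mul_of_nonneg_left hle s2.le]
    rw [e1, e2] at h
    change wedge μ m θ ψ = wedge μ m θ φ + wedge μ m φ ψ at h
    linarith
  have w4 := wedge_add_wedge_add_pi hμ hm θ ψ
  have w5 : wedge μ m θ (ψ + π) = μ.real Set.univ / 6 := by linarith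
  refine ⟨w1, by rw [wedge_swap hμ hm, w1], w2, by rw [wedge_swap hμ hm, w2], ?_, ?_⟩
  · rw [← wedge_add_pi_right hμ hm, w5]
  · rw [← w5, ← wedge_swap hμ hm θ (ψ + π)]
    simp only [dirForm_add_pi, hm.add_pi hμ, neg_lt_neg_iff]

end SixPartition

/-! ### Six sectors for finite point sets in general position -/

section DiscreteSixPartition

open MeasureTheory Filter Topology Real ProbabilityTheory

theorem nullLines_of_absolutelyContinuous {μ : Measure (ℝ × ℝ)} (h : μ ≪ volume) :
    NullLines μ := by
  intro θ t
  apply h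
  obtain ⟨q, hq, -⟩ := exists_dirForm_eq (θ := θ) (φ := θ + π / 2) (by simp) (t + 1) 0
  obtain ⟨p, hp, -⟩ := exists_dirForm_eq (θ := θ) (φ := θ + π / 2) (by simp) t 0
  let ℓ : (ℝ × ℝ) →ₗ[ℝ] ℝ :=
    { toFun := dirForm θ
      map_add' := fun x y => by simp only [dirForm, Prod.fst_add, Prod.snd_add]; ring
      map_smul' := fun c x => by
        simp only [dirForm, Prod.smul_fst, Prod.smul_snd, smul_eq_mul, RingHom.id_apply]; ring }
  let A : AffineSubspace ℝ (ℝ × ℝ) := AffineSubspace.mk' p (LinearMap.ker ℓ)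
  have hA : ∀ x, x ∈ A ↔ dirForm θ x = t := fun x => by
    rw [AffineSubspace.mem_mk', LinearMap.mem_ker]
    change dirForm θ (x - p) = 0 ↔ _
    rw [dirForm_sub, hp, sub_eq_zero]
  have hset : {x | dirForm θ x = t} = (A : Set (ℝ × ℝ)) := by
    ext x; exact (hA x).symm
  rw [hset]
  refine Measure.addHaar_affineSubspace volume A fun htop => ?_
  have : q ∈ A := htop ▸ AffineSubspace.mem_top ℝ (ℝ × ℝ) q
  rw [hA, hq] at this
  linarith

/-- A Gaussian shrunk towards `c`. It replaces a point mass while keeping the full support and the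
null lines that the continuous partition requires. -/
theorem exists_concentrated_measure (c : ℝ × ℝ) {σ δ : ℝ} (hσ : 0 < σ) (hδ : 0 < δ) :
    ∃ ν : Measure (ℝ × ℝ), IsProbabilityMeasure ν ∧ ν.IsOpenPosMeasure ∧ NullLines ν ∧
      ν.real (Metric.ball c σ)ᶜ ≤ δ := by
  let g := gaussianReal 0 1
  have h1 : g ≪ volume := gaussianReal_absolutelyContinuous 0 one_ne_zero
  have h2 : (volume : Measure ℝ) ≪ g := gaussianReal_absolutelyContinuous' 0 one_ne_zero
  have : g.IsOpenPosMeasure := h2.isOpenPosMeasure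
  let γ := g.prod g
  have hγ : γ ≪ volume := h1.prod h1
  have hlim : Tendsto (fun τ : ℝ => γ.real {y | σ ≤ ‖τ • y‖}) (𝓝[>] 0) (𝓝 (γ.real ∅)) := by
    refine tendsto_measureReal_of_ae .empty (fun τ => ?_) (Eventually.of_forall fun y => ?_)
    · exact (isClosed_le continuous_const (by fun_prop)).measurableSet
    · have : Tendsto (fun τ : ℝ => ‖τ • y‖) (𝓝[>] 0) (𝓝 0) := by
        have h : Continuous fun τ : ℝ => ‖τ • y‖ := by fun_prop
        have := h.tendsto 0
        simp only [zero_smul, norm_zero] at this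
        exact this.mono_left nhdsWithin_le_nhds
      filter_upwards [this.eventually_lt_const hσ] with τ hτ
      simpa using hτ
  rw [measureReal_empty] at hlim
  obtain ⟨τ, hτ, hτ0⟩ := ((hlim.eventually_lt_const hδ).and self_mem_nhdsWithin).exists
  replace hτ0 : 0 < τ := hτ0
  have hcont : Continuous fun y : ℝ × ℝ => c + τ • y := by fun_prop
  have hsurj : Function.Surjective fun y : ℝ × ℝ => c + τ • y := fun x =>
    ⟨τ⁻¹ • (x - c), by simp [smul_smul, hτ0.ne']⟩
  refine ⟨γ.map fun y => c + τ • y, Measure.isProbabilityMeasure_map hcont.aemeasurable,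
    hcont.isOpenPosMeasure_map hsurj, fun θ t => ?_, ?_⟩
  · have hmeas : MeasurableSet {x | dirForm θ x = t} :=
      (isClosed_eq (continuous_dirForm θ) continuous_const).measurableSet
    rw [Measure.map_apply hcont.measurable hmeas]
    convert nullLines_of_absolutelyContinuous hγ θ ((t - dirForm θ c) / τ) using 2
    ext y
    simp only [Set.mem_preimage, Set.mem_ofPred_eq, eq_div_iff hτ0.ne']
    simp only [dirForm, Prod.fst_add, Prod.snd_add, Prod.smul_fst, Prod.smul_snd, smul_eq_mul]
    constructor <;> intro h <;> linarith
  · rw [map_measureReal_apply hcont.measurable measurableSet_ball.compl]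
    refine (le_of_eq ?_).trans hτ.le
    congr 1
    ext y
    simp [dist_eq_norm]

/-- Twice the signed area of a triangle in the plane. -/
def triDet (a b c : ℝ × ℝ) : ℝ :=
  (b.1 - a.1) * (c.2 - a.2) - (b.2 - a.2) * (c.1 - a.1)

/-- No three of the points `f v` are collinear. -/
def GeneralPosition {V : Type*} (f : V → ℝ × ℝ) : Prop :=
  ∀ x y z, x ≠ y → x ≠ z → y ≠ z → triDet (f x) (f y) (f z) ≠ 0

/-- A triangle inside a thin strip has small area, uniformly in the direction of the strip. Hence
sufficiently thin strips contain at most two points of a finite set in general position. -/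
theorem abs_triDet_le {a b c : ℝ × ℝ} {θ t ε : ℝ} (ha : |dirForm θ a - t| ≤ ε)
    (hb : |dirForm θ b - t| ≤ ε) (hc : |dirForm θ c - t| ≤ ε) :
    |triDet a b c| ≤ 2 * ε * (|b.1 - a.1| + |b.2 - a.2| + |c.1 - a.1| + |c.2 - a.2|) := by
  set α := dirForm θ b - dirForm θ a with hα
  set β := dirForm θ c - dirForm θ a with hβ
  have e1 : |α| ≤ 2 * ε := by rw [abs_le] at *; constructor <;> linarith [ha.1, ha.2, hb.1, hb.2]
  have e2 : |β| ≤ 2 * ε := by rw [abs_le] at *; constructor <;> linarith [ha.1, ha.2, hc.1, hc.2]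
  have key : triDet a b c = cos θ * (α * (c.2 - a.2)) + -(cos θ * (β * (b.2 - a.2)))
      + sin θ * (β * (b.1 - a.1)) + -(sin θ * (α * (c.1 - a.1))) := by
    have := sin_sq_add_cos_sq θ
    have h : triDet a b c = triDet a b c * (sin θ ^ 2 + cos θ ^ 2) := by rw [this, mul_one]
    rw [h, hα, hβ]
    simp only [triDet, dirForm]
    ring
  have bd : ∀ u v w r : ℝ, |u| ≤ 1 → |v| ≤ r → |u * (v * w)| ≤ r * |w| := fun u v w r hu hv => by
    rw [abs_mul, abs_mul]
    calc |u| * (|v| * |w|) ≤ 1 * (r * |w|) := by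
          gcongr
      _ = r * |w| := one_mul _
  rw [key]
  refine (abs_add_le _ _).trans ?_
  have t1 := bd _ _ (c.2 - a.2) _ (abs_cos_le_one θ) e1
  have t2 := bd _ _ (b.2 - a.2) _ (abs_cos_le_one θ) e2
  have t3 := bd _ _ (b.1 - a.1) _ (abs_sin_le_one θ) e2
  have t4 := bd _ _ (c.1 - a.1) _ (abs_sin_le_one θ) e1
  have t5 := abs_add_le (cos θ * (α * (c.2 - a.2)) + -(cos θ * (β * (b.2 - a.2))))
    (sin θ * (β * (b.1 - a.1)))
  have t6 := abs_add_le (cos θ * (α * (c.2 - a.2))) (-(cos θ * (β * (b.2 - a.2))))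
  rw [abs_neg] at t6 ⊢
  linarith

theorem GeneralPosition.exists_radius {V : Type*} [Finite V] {f : V → ℝ × ℝ}
    (hf : GeneralPosition f) :
    ∃ σ > 0, ∀ θ t, {v | |dirForm θ (f v) - t| ≤ 2 * σ}.ncard ≤ 2 := by
  have key : ∀ x y z, ∀ᶠ σ : ℝ in 𝓝[>] 0, x ≠ y → x ≠ z → y ≠ z → ∀ θ t,
      ¬ (|dirForm θ (f x) - t| ≤ 2 * σ ∧ |dirForm θ (f y) - t| ≤ 2 * σ ∧
        |dirForm θ (f z) - t| ≤ 2 * σ) := by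
    intro x y z
    by_cases h : x ≠ y ∧ x ≠ z ∧ y ≠ z
    swap
    · exact Eventually.of_forall fun σ h1 h2 h3 => absurd ⟨h1, h2, h3⟩ h
    have hlim : Tendsto (fun σ : ℝ => 2 * (2 * σ) * (|(f y).1 - (f x).1| + |(f y).2 - (f x).2|
        + |(f z).1 - (f x).1| + |(f z).2 - (f x).2|)) (𝓝[>] 0) (𝓝 0) := by
      refine Tendsto.mono_left ?_ nhdsWithin_le_nhds
      refine Continuous.tendsto' (by fun_prop) _ _ (by ring)
    filter_upwards [hlim.eventually_lt_const (abs_pos.2 (hf x y z h.1 h.2.1 h.2.2))]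
      with σ hσ _ _ _ θ t hc
    exact absurd (abs_triDet_le hc.1 hc.2.1 hc.2.2) (not_le.2 hσ)
  have key2 : ∀ᶠ σ : ℝ in 𝓝[>] 0, ∀ x y z, x ≠ y → x ≠ z → y ≠ z → ∀ θ t,
      ¬ (|dirForm θ (f x) - t| ≤ 2 * σ ∧ |dirForm θ (f y) - t| ≤ 2 * σ ∧
        |dirForm θ (f z) - t| ≤ 2 * σ) := by
    simp only [eventually_all]
    intro x y z h1 h2 h3
    have := key x y z
    filter_upwards [this] with σ hσ using hσ h1 h2 h3
  obtain ⟨σ, hσ, hσ0⟩ := (key2.and self_mem_nhdsWithin).exists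
  refine ⟨σ, hσ0, fun θ t => ?_⟩
  by_contra! hlt
  obtain ⟨x, y, z, hx, hy, hz, hxy, hxz, hyz⟩ := (Set.two_lt_ncard_iff).1 hlt
  exact hσ x y z hxy hxz hyz θ t ⟨hx, hy, hz⟩

theorem abs_dirForm_sub_lt {x c : ℝ × ℝ} {σ : ℝ} (h : x ∈ Metric.ball c σ) (θ : ℝ) :
    |dirForm θ x - dirForm θ c| < 2 * σ := by
  rw [Metric.mem_ball, Prod.dist_eq, max_lt_iff, Real.dist_eq, Real.dist_eq] at h
  have e : dirForm θ x - dirForm θ c = (x.1 - c.1) * cos θ + (x.2 - c.2) * sin θ := by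
    simp only [dirForm]; ring
  rw [e]
  refine (abs_add_le _ _).trans_lt ?_
  rw [abs_mul, abs_mul]
  have h1 := mul_le_mul_of_nonneg_left (abs_cos_le_one θ) (abs_nonneg (x.1 - c.1))
  have h2 := mul_le_mul_of_nonneg_left (abs_sin_le_one θ) (abs_nonneg (x.2 - c.2))
  linarith [h.1, h.2]

/-- Points in general position are divided by three concurrent lines into six sectors that contain
about a sixth of the points each. -/
theorem GeneralPosition.exists_six_partition {V : Type*} [Fintype V] [Nonempty V]
    {f : V → ℝ × ℝ} (hf : GeneralPosition f) :
    ∃ θ φ ψ p, θ < φ ∧ φ < ψ ∧ ψ < θ + π ∧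
      ∀ α β, (α, β) ∈ ({(θ, φ + π), (θ + π, φ), (φ, ψ + π), (φ + π, ψ), (θ, ψ), (θ + π, ψ + π)} :
        Set (ℝ × ℝ)) → (Fintype.card V : ℝ) / 6 - 5 ≤
          {v | 0 < dirForm α (f v - p) ∧ 0 < dirForm β (f v - p)}.ncard := by
  classical
  obtain ⟨σ, hσ, hnear⟩ := hf.exists_radius
  set n := Fintype.card V with hn
  have hn0 : (0 : ℝ) < n := by exact_mod_cast Fintype.card_pos
  choose ν hν1 hν2 hν3 hν4 using fun v =>
    exists_concentrated_measure (f v) hσ (inv_pos.2 hn0)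
  let μ : Measure (ℝ × ℝ) := ∑ v, ν v
  have hμapp : ∀ s, μ.real s = ∑ v, (ν v).real s := fun s => by
    simp only [μ, Measure.real, Measure.finsetSum_apply]
    exact ENNReal.toReal_sum fun v _ => by finiteness
  have hμ : NullLines μ := fun θ t => by
    simp only [μ, Measure.finsetSum_apply]
    exact Finset.sum_eq_zero fun v _ => hν3 v θ t
  have : μ.IsOpenPosMeasure := ⟨fun U hU hne h0 => by
    simp only [μ, Measure.finsetSum_apply] at h0
    obtain ⟨v⟩ := ‹Nonempty V›
    exact hU.measure_ne_zero (ν v) hne (Finset.sum_eq_zero_iff.1 h0 v (Finset.mem_univ v))⟩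
  have huniv : μ.real Set.univ = n := by
    rw [hμapp]; simp [hn]
  obtain ⟨θ, φ, ψ, p, h1, h2, h3, hR⟩ := _root_.exists_six_partition hμ
  refine ⟨θ, φ, ψ, p, h1, h2, h3, fun α β hαβ => ?_⟩
  set R := {x : ℝ × ℝ | 0 < dirForm α (x - p) ∧ 0 < dirForm β (x - p)} with hRdef
  have hmeas : μ.real R = n / 6 := by
    rw [huniv] at hR
    simp only [hRdef]
    simp only [Set.mem_insert_iff, Set.mem_singleton_iff, Prod.mk.injEq] at hαβ
    rcases hαβ with ⟨rfl, rfl⟩ | ⟨rfl, rfl⟩ | ⟨rfl, rfl⟩ | ⟨rfl, rfl⟩ | ⟨rfl, rfl⟩ | ⟨rfl, rfl⟩ <;>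
      try simp only [dirForm_add_pi, Left.neg_pos_iff]
    exacts [hR.1, hR.2.1, hR.2.2.1, hR.2.2.2.1, hR.2.2.2.2.1, hR.2.2.2.2.2]
  set N : ℝ → Finset V := fun η => {v | |dirForm η (f v) - dirForm η p| ≤ 2 * σ} with hN
  have hNcard : ∀ η, (N η).card ≤ 2 := fun η => by
    have := hnear η (dirForm η p)
    rwa [Set.ncard_eq_toFinset_card', Set.toFinset_ofPred] at this
  -- The error 5 in the statement: at most two points near each of the two bounding lines, and a
  -- leakage of at most `1 / n` from each of the `n` balls.
  have hpt : ∀ v, (ν v).real R ≤ (if f v ∈ R then 1 else 0) + (if v ∈ N α then 1 else 0)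
      + (if v ∈ N β then 1 else 0) + (n : ℝ)⁻¹ := by
    intro v
    have hle : (ν v).real R ≤ 1 := measureReal_le_one
    have hi : (0 : ℝ) < (n : ℝ)⁻¹ := inv_pos.2 hn0
    by_cases c1 : f v ∈ R
    · simp only [c1, if_true]; split_ifs <;> linarith
    by_cases c2 : v ∈ N α
    · simp only [c2, if_true]; split_ifs <;> linarith
    by_cases c3 : v ∈ N β
    · simp only [c3, if_true]; (split_ifs; linarith)
    simp only [c1, c2, c3, if_false, zero_add]
    refine (measureReal_mono ?_).trans (hν4 v)
    intro x hx hxb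
    apply c1
    simp only [hN, Finset.mem_filter_univ, not_le] at c2 c3
    have d1 := abs_dirForm_sub_lt hxb α
    have d2 := abs_dirForm_sub_lt hxb β
    simp only [hRdef, Set.mem_ofPred_eq, dirForm_sub] at hx ⊢
    rw [abs_lt] at d1 d2
    rw [lt_abs] at c2 c3
    constructor
    · rcases c2 with c | c <;> linarith [hx.1, d1.1, d1.2]
    · rcases c3 with c | c <;> linarith [hx.2, d2.1, d2.2]
  have hsum : μ.real R ≤ _ := (hμapp R).trans_le (Finset.sum_le_sum fun v _ => hpt v)
  simp only [Finset.sum_add_distrib, Finset.sum_boole, Finset.filter_univ_mem, Finset.sum_const,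
    Finset.card_univ, nsmul_eq_mul] at hsum
  rw [← hn, mul_inv_cancel₀ hn0.ne', hmeas] at hsum
  have ca : ((N α).card : ℝ) ≤ 2 := by exact_mod_cast hNcard α
  have cb : ((N β).card : ℝ) ≤ 2 := by exact_mod_cast hNcard β
  rw [Set.ncard_eq_toFinset_card', Set.toFinset_ofPred]
  rw [Finset.natCast_card_filter]
  refine (by linarith : (n : ℝ) / 6 - 5 ≤ ∑ v, if f v ∈ R then 1 else 0).trans (le_of_eq ?_)
  exact Finset.sum_congr rfl fun v _ => if_congr Iff.rfl rfl rfl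

end DiscreteSixPartition

/-! ### Counting alternating triples in a signed linear order -/

section AlternatingTriples

open Finset

theorem card_mul_le_card_of_fibers {α β γ : Type*} {Q : Finset β} {Z : β → Finset γ}
    {T : Finset α} {φ : β → γ → α} {q : ℕ} (hZ : ∀ b ∈ Q, q ≤ #(Z b))
    (hmem : ∀ b ∈ Q, ∀ c ∈ Z b, φ b c ∈ T)
    (hinj : ∀ b, ∀ c ∈ Z b, ∀ b', ∀ c' ∈ Z b', φ b c = φ b' c' → b = b' ∧ c = c') :
    #Q * q ≤ #T := by
  calc #Q * q ≤ ∑ b ∈ Q, #(Z b) := by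
        simpa using card_nsmul_le_sum Q (fun b => #(Z b)) q hZ
    _ = #(Q.sigma Z) := (card_sigma _ _).symm
    _ ≤ #T := by
        refine card_le_card_of_injOn (fun t => φ t.1 t.2) (fun t ht => ?_) ?_
        · rw [mem_coe, mem_sigma] at ht
          exact hmem _ ht.1 _ ht.2
        · rintro ⟨b, c⟩ hb ⟨b', c'⟩ hb' h
          obtain ⟨rfl, rfl⟩ := hinj _ _ (mem_sigma.1 hb).2 _ _ (mem_sigma.1 hb').2 h
          rfl

variable {V : Type*} [Fintype V]

/-- The triples that are increasing with respect to `r` and have alternating nonzero signs. -/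
def altTriples (r : V → ℕ) (s : V → SignType) : Finset (V × V × V) :=
  {t | r t.1 < r t.2.1 ∧ r t.2.1 < r t.2.2 ∧ s t.2.1 = -s t.1 ∧ s t.2.2 = s t.1 ∧ s t.1 ≠ 0}

/-- The pairs of opposite nonzero signs inside the segment `i`, in increasing order. -/
def altPairs (r : V → ℕ) (s : V → SignType) (g : V → Fin 3) (i : Fin 3) : Finset (V × V) :=
  {t | g t.1 = i ∧ g t.2 = i ∧ r t.1 < r t.2 ∧ s t.2 = -s t.1 ∧ s t.1 ≠ 0}

variable {r : V → ℕ} {s : V → SignType} {g : V → Fin 3} {q : ℕ}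

/-- Any positive and negative element of the segment form exactly one increasing pair, with either
sign first, so all `q * q` choices count. -/
theorem sq_le_card_altPairs (hr : Function.Injective r)
    (hq : ∀ i, ∀ σ ≠ 0, q ≤ #{v | g v = i ∧ s v = σ}) (i : Fin 3) :
    q * q ≤ #(altPairs r s g i) := by
  calc q * q ≤ #{v | g v = i ∧ s v = 1} * #{v | g v = i ∧ s v = -1} :=
        Nat.mul_le_mul (hq i 1 (by decide)) (hq i (-1) (by decide))
    _ = #(({v | g v = i ∧ s v = 1} : Finset V) ×ˢ ({v | g v = i ∧ s v = -1} : Finset V)) :=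
        (card_product _ _).symm
    _ ≤ _ := by
        refine card_le_card_of_injOn (fun t => if r t.1 < r t.2 then t else t.swap) ?_ ?_
        · rintro ⟨x, y⟩ h
          simp only [coe_product, Set.mem_prod, mem_coe, mem_filter_univ] at h
          obtain ⟨⟨h1, h2⟩, h3, h4⟩ := h
          have hne : r x ≠ r y := fun e => by
            rw [hr e, h4] at h2; exact absurd h2 (by decide)
          simp only [mem_coe, altPairs, mem_filter_univ]
          split_ifs with hlt
          · simp [h1, h3, h2, h4, hlt]
          · simp [h1, h3, h2, h4]; omega
        · rintro ⟨x, y⟩ h ⟨x', y'⟩ h' e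
          simp only [coe_product, Set.mem_prod, mem_coe, mem_filter_univ] at h h'
          have d1 : x ≠ y' := fun e => by
            rw [e, h'.2.2] at h; exact absurd h.1.2 (by decide)
          simp only at e
          split_ifs at e <;> simp only [Prod.swap_prod_mk, Prod.mk.injEq] at e ⊢
          · exact e
          · exact absurd e.1 d1
          · exact absurd e.2 d1
          · exact e.symm

/-- If a signed linear order is divided into three segments each containing at least `q` elements of
both signs, then it has at least `8 * q ^ 3` alternating triples. -/
theorem le_card_altTriples (hr : Function.Injective r) (hg : ∀ x y, g x < g y → r x < r y)
    (hq : ∀ i, ∀ σ ≠ 0, q ≤ #{v | g v = i ∧ s v = σ}) : 8 * q ^ 3 ≤ #(altTriples r s) := by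
  set T := altTriples r s with hT
  set G : V × V × V → Fin 3 × Fin 3 × Fin 3 := fun t => (g t.1, g t.2.1, g t.2.2)
  -- An alternating pair in one segment forces the sign of a third element in another. The six
  -- patterns (i, i, j) and (i, j, j) thus give `q ^ 3` each; the pattern (0, 1, 2) allows either
  -- first sign and gives `2 * q ^ 3`.
  have h1 : ∀ i j, i < j → q * q * q ≤ #{t ∈ T | G t = (i, i, j)} := fun i j hij => by
    refine (Nat.mul_le_mul_right q (sq_le_card_altPairs hr hq i)).trans
      (card_mul_le_card_of_fibers (Z := fun t : V × V => {v | g v = j ∧ s v = s t.1})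
        (φ := fun t z => (t.1, t.2, z)) ?_ ?_ ?_)
    · rintro ⟨x, y⟩ h
      simp only [altPairs, mem_filter_univ] at h
      exact hq j _ h.2.2.2.2
    · rintro ⟨x, y⟩ h z hz
      simp only [altPairs, mem_filter_univ] at h hz
      have := hg y z (by rw [h.2.1, hz.1]; exact hij)
      simp [hT, altTriples, G, h, hz, this]
    · rintro ⟨x, y⟩ z - ⟨x', y'⟩ z' - h
      simp only [Prod.mk.injEq] at h ⊢
      tauto
  have h2 : ∀ i j, i < j → q * q * q ≤ #{t ∈ T | G t = (i, j, j)} := fun i j hij => by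
    refine (Nat.mul_le_mul_right q (sq_le_card_altPairs hr hq j)).trans
      (card_mul_le_card_of_fibers (Z := fun t : V × V => {v | g v = i ∧ s v = -s t.1})
        (φ := fun t z => (z, t.1, t.2)) ?_ ?_ ?_)
    · rintro ⟨x, y⟩ h
      simp only [altPairs, mem_filter_univ] at h
      exact hq i _ (by simpa using h.2.2.2.2)
    · rintro ⟨x, y⟩ h z hz
      simp only [altPairs, mem_filter_univ] at h hz
      have := hg z x (by rw [h.1, hz.1]; exact hij)
      simp [hT, altTriples, G, h, hz, this]
    · rintro ⟨x, y⟩ z - ⟨x', y'⟩ z' - h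
      simp only [Prod.mk.injEq] at h ⊢
      tauto
  have h3 : 2 * (q * q * q) ≤ #{t ∈ T | G t = (0, 1, 2)} := by
    have hA : #({1, -1} : Finset SignType) = 2 := by decide
    have hAne : ∀ σ ∈ ({1, -1} : Finset SignType), σ ≠ 0 := by decide
    have := card_mul_le_card_of_fibers (Q := ({1, -1} : Finset SignType)) (q := q * (q * q))
      (Z := fun σ : SignType => ({v | g v = 0 ∧ s v = σ} : Finset V) ×ˢ
        ({v | g v = 1 ∧ s v = -σ} : Finset V) ×ˢ ({v | g v = 2 ∧ s v = σ} : Finset V))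
      (T := {t ∈ T | G t = (0, 1, 2)}) (φ := fun σ t => t) ?_ ?_ ?_
    · rwa [hA, ← mul_assoc q] at this
    · intro σ hσ
      rw [card_product, card_product]
      exact Nat.mul_le_mul (hq _ _ (hAne σ hσ))
        (Nat.mul_le_mul (hq _ _ (by simpa using hAne σ hσ)) (hq _ _ (hAne σ hσ)))
    · rintro σ hσ ⟨x, y, z⟩ ht
      simp only [mem_product, mem_filter_univ] at ht
      have e1 := hg x y (by rw [ht.1.1, ht.2.1.1]; decide)
      have e2 := hg y z (by rw [ht.2.1.1, ht.2.2.1]; decide)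
      simp [hT, altTriples, G, ht, e1, e2, hAne σ hσ]
    · rintro σ ⟨x, y, z⟩ ht σ' ⟨x', y', z'⟩ ht' h
      simp only [mem_product, mem_filter_univ] at ht ht'
      simp only [Prod.mk.injEq] at h
      refine ⟨?_, by simpa using h⟩
      rw [← ht.1.2, ← ht'.1.2, h.1]
  have hsub : ({(0, 1, 2), (0, 0, 1), (0, 0, 2), (1, 1, 2), (0, 1, 1), (0, 2, 2), (1, 2, 2)} :
      Finset (Fin 3 × Fin 3 × Fin 3)) ⊆ univ := subset_univ _
  have hsum : #T = ∑ c, #{t ∈ T | G t = c} := card_eq_sum_card_fiberwise (by simp)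
  have := sum_le_sum_of_subset (f := fun c => #{t ∈ T | G t = c}) hsub
  rw [← hsum] at this
  have a1 := h1 0 1 (by decide)
  have a2 := h1 0 2 (by decide)
  have a3 := h1 1 2 (by decide)
  have a4 := h2 0 1 (by decide)
  have a5 := h2 0 2 (by decide)
  have a6 := h2 1 2 (by decide)
  rw [sum_insert (by decide), sum_insert (by decide), sum_insert (by decide),
    sum_insert (by decide), sum_insert (by decide), sum_insert (by decide), sum_singleton] at this
  have e : 8 * q ^ 3 = 8 * (q * q * q) := by ring
  omega

end AlternatingTriples

/-! ### Coarsening the order into blocks -/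

section AlternatingEdges

open Finset

variable {V : Type*}

/-- The triples whose blocks are distinct and whose signs, in the order of the blocks, are nonzero
and alternate. -/
def altEdges [Fintype V] [DecidableEq V] {R : ℕ} (χ : V → Fin R × SignType) : Finset (Finset V) :=
  {e | ∃ x y z, e = {x, y, z} ∧ (χ x).1 < (χ y).1 ∧ (χ y).1 < (χ z).1 ∧ (χ y).2 = -(χ x).2 ∧
    (χ z).2 = (χ x).2 ∧ (χ x).2 ≠ 0}

theorem card_of_mem_altEdges [Fintype V] [DecidableEq V] {R : ℕ}
    {χ : V → Fin R × SignType} {e : Finset V} (he : e ∈ altEdges χ) : #e = 3 := by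
  obtain ⟨x, y, z, rfl, h1, h2, -⟩ := (mem_filter_univ _).1 he
  refine card_eq_three.2 ⟨x, y, z, ?_, ?_, ?_, rfl⟩
  · rintro rfl; exact lt_irrefl _ h1
  · rintro rfl; exact lt_asymm h1 h2
  · rintro rfl; exact lt_irrefl _ h2

theorem eq_of_sorted_triple_eq [DecidableEq V] {r : V → ℕ} {x y z x' y' z' : V}
    (h1 : r x < r y) (h2 : r y < r z) (h1' : r x' < r y') (h2' : r y' < r z')
    (h : ({x, y, z} : Finset V) = {x', y', z'}) :
    x = x' ∧ y = y' ∧ z = z' := by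
  have k : ∀ v, v = x ∨ v = y ∨ v = z ↔ v = x' ∨ v = y' ∨ v = z' := fun v => by
    simpa using Finset.ext_iff.1 h v
  have hx : x = x' := by
    rcases (k x).1 (Or.inl rfl) with e | e | e
    · exact e
    all_goals
      subst e
      rcases (k x').2 (Or.inl rfl) with e | e | e <;> subst e <;> omega
  have hz : z = z' := by
    rcases (k z).1 (Or.inr (Or.inr rfl)) with e | e | e
    · subst e
      rcases (k z').2 (Or.inr (Or.inr rfl)) with e | e | e <;> subst e <;> omega
    · subst e
      rcases (k z').2 (Or.inr (Or.inr rfl)) with e | e | e <;> subst e <;> omega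
    · exact e
  refine ⟨hx, ?_, hz⟩
  rcases (k y).1 (Or.inr (Or.inl rfl)) with e | e | e
  · subst hx; subst e; omega
  · exact e
  · subst hz; subst e; omega

theorem card_block_le [Fintype V] {r : V → ℕ} (hr : Function.Injective r) {w : ℕ}
    (hw : 0 < w) (c : ℕ) :
    #{v | r v / w = c} ≤ w := by
  calc #{v | r v / w = c} ≤ #(Ico (c * w) (c * w + w)) := by
        refine card_le_card_of_injOn r (fun v hv => ?_) hr.injOn
        simp only [mem_coe, mem_filter_univ] at hv
        rw [mem_coe, mem_Ico]
        rw [Nat.div_eq_iff hw] at hv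
        omega
    _ = w := by simp

/-- A triple is lost only if its middle vertex shares a block with an outer one. For given outer
vertices this leaves at most `w` middle vertices in each of the two cases. -/
theorem card_altTriples_le [Fintype V] [DecidableEq V] {r : V → ℕ} {s : V → SignType}
    (hr : Function.Injective r) {w R : ℕ} (hw : 0 < w) (hR : ∀ v, r v / w < R) :
    #(altTriples r s) ≤ #(altEdges fun v => ((⟨r v / w, hR v⟩ : Fin R), s v)) +
      2 * (w * Fintype.card V ^ 2) := by
  set b : V → ℕ := fun v => r v / w with hb
  have hb1 : ∀ x y, r x < r y → b x ≠ b y → b x < b y := fun x y h h' =>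
    lt_of_le_of_ne (Nat.div_le_div_right h.le) h'
  set T := altTriples r s
  set B1 : Finset (V × V × V) := {t | b t.1 = b t.2.1}
  set B2 : Finset (V × V × V) := {t | b t.2.1 = b t.2.2}
  have c1 : #B1 ≤ w * Fintype.card V ^ 2 := by
    refine (card_le_mul_card_image (f := fun t : V × V × V => (t.1, t.2.2)) B1 w ?_).trans ?_
    · rintro ⟨x, z⟩ -
      refine le_trans ?_ (card_block_le hr hw (b x))
      refine card_le_card_of_injOn (fun t => t.2.1) ?_ ?_
      · rintro ⟨x', y', z'⟩ h
        simp only [B1, mem_coe, mem_filter, mem_univ, true_and, Prod.mk.injEq] at h ⊢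
        rw [← h.2.1]; exact h.1.symm
      · rintro ⟨x', y', z'⟩ h ⟨x'', y'', z''⟩ h' e
        simp only [mem_coe, mem_filter, Prod.mk.injEq] at h h' e ⊢
        exact ⟨h.2.1.trans h'.2.1.symm, e, h.2.2.trans h'.2.2.symm⟩
    · refine Nat.mul_le_mul_left w ((card_le_univ _).trans_eq ?_)
      rw [Fintype.card_prod, sq]
  have c2 : #B2 ≤ w * Fintype.card V ^ 2 := by
    refine (card_le_mul_card_image (f := fun t : V × V × V => (t.1, t.2.2)) B2 w ?_).trans ?_
    · rintro ⟨x, z⟩ -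
      refine le_trans ?_ (card_block_le hr hw (b z))
      refine card_le_card_of_injOn (fun t => t.2.1) ?_ ?_
      · rintro ⟨x', y', z'⟩ h
        simp only [B2, mem_coe, mem_filter, mem_univ, true_and, Prod.mk.injEq] at h ⊢
        rw [← h.2.2]; exact h.1
      · rintro ⟨x', y', z'⟩ h ⟨x'', y'', z''⟩ h' e
        simp only [mem_coe, mem_filter, Prod.mk.injEq] at h h' e ⊢
        exact ⟨h.2.1.trans h'.2.1.symm, e, h.2.2.trans h'.2.2.symm⟩
    · refine Nat.mul_le_mul_left w ((card_le_univ _).trans_eq ?_)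
      rw [Fintype.card_prod, sq]
  have c3 : #(T \ (B1 ∪ B2)) ≤ #(altEdges fun v => ((⟨r v / w, hR v⟩ : Fin R), s v)) := by
    refine card_le_card_of_injOn (fun t => {t.1, t.2.1, t.2.2}) ?_ ?_
    · rintro ⟨x, y, z⟩ h
      simp only [T, B1, B2, altTriples, coe_sdiff, Set.mem_sdiff, mem_coe, mem_filter_univ,
        mem_union,
        not_or] at h
      obtain ⟨⟨h1, h2, h3⟩, h4, h5⟩ := h
      simp only [mem_coe, altEdges, mem_filter_univ]
      exact ⟨x, y, z, rfl, hb1 x y h1 h4, hb1 y z h2 h5, h3⟩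
    · rintro ⟨x, y, z⟩ h ⟨x', y', z'⟩ h' e
      simp only [T, altTriples, coe_sdiff, Set.mem_sdiff, mem_coe, mem_filter_univ] at h h'
      simpa using eq_of_sorted_triple_eq h.1.1 h.1.2.1 h'.1.1 h'.1.2.1 e
  have c4 : #T ≤ #(T \ (B1 ∪ B2)) + #(B1 ∪ B2) := by
    rw [add_comm]; exact card_le_card_sdiff_add_card.trans_eq (add_comm _ _)
  have c5 := card_union_le B1 B2
  omega

theorem exists_rank [Fintype V] (κ : V → ℝ) :
    ∃ r : V → ℕ, Function.Injective r ∧ (∀ v, r v < Fintype.card V) ∧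
      ∀ x y, r x ≤ r y → κ x ≤ κ y := by
  let e := Fintype.equivFin V
  let σ := Tuple.sort (κ ∘ e.symm)
  refine ⟨fun v => σ.symm (e v), fun x y h => ?_, fun v => (σ.symm (e v)).2, fun x y h => ?_⟩
  · exact e.injective (σ.symm.injective (Fin.ext h))
  · have := Tuple.monotone_sort (κ ∘ e.symm) (show σ.symm (e x) ≤ σ.symm (e y) from h)
    simpa [σ] using this

end AlternatingEdges

/-! ### Alternating signs put the point inside the triangle -/

section Hull

/-- With slopes k = b / a and weights divided by |a|, both equations say that the middle slope is an
average of the outer two: the alternating signs let the middle term cancel the others. -/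
theorem exists_alternating_weights {a₁ a₂ a₃ b₁ b₂ b₃ : ℝ} (h12 : a₁ * a₂ < 0) (h13 : 0 < a₁ * a₃)
    (hk : b₁ / a₁ ≤ b₂ / a₂) (hk' : b₂ / a₂ ≤ b₃ / a₃) :
    ∃ w₁ w₂ w₃ : ℝ, 0 ≤ w₁ ∧ 0 ≤ w₂ ∧ 0 ≤ w₃ ∧ 0 < w₁ + w₂ + w₃ ∧
      w₁ * a₁ + w₂ * a₂ + w₃ * a₃ = 0 ∧ w₁ * b₁ + w₂ * b₂ + w₃ * b₃ = 0 := by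
  wlog hpos : 0 < a₁ generalizing a₁ a₂ a₃ b₁ b₂ b₃
  · have hne : a₁ ≠ 0 := by rintro rfl; simp at h12
    obtain ⟨w₁, w₂, w₃, h1, h2, h3, h4, h5, h6⟩ := this (a₁ := -a₁) (a₂ := -a₂) (a₃ := -a₃)
      (b₁ := -b₁) (b₂ := -b₂) (b₃ := -b₃) (by linarith) (by linarith) (by simpa using hk)
      (by simpa using hk') (neg_pos.2 (lt_of_le_of_ne (not_lt.1 hpos) hne))
    exact ⟨w₁, w₂, w₃, h1, h2, h3, h4, by linarith, by linarith⟩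
  have ha2 : a₂ < 0 := by nlinarith
  have ha3 : 0 < a₃ := by nlinarith
  obtain ⟨k₁, hk₁⟩ : ∃ k, k = b₁ / a₁ := ⟨_, rfl⟩
  obtain ⟨k₂, hk₂⟩ : ∃ k, k = b₂ / a₂ := ⟨_, rfl⟩
  obtain ⟨k₃, hk₃⟩ : ∃ k, k = b₃ / a₃ := ⟨_, rfl⟩
  rw [← hk₁, ← hk₂] at hk
  rw [← hk₂, ← hk₃] at hk'
  rw [eq_div_iff hpos.ne'] at hk₁
  rw [eq_div_iff ha2.ne] at hk₂
  rw [eq_div_iff ha3.ne'] at hk₃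
  subst hk₁ hk₂ hk₃
  have i1 : 0 < a₁⁻¹ := inv_pos.2 hpos
  have i2 : 0 < (-a₂)⁻¹ := inv_pos.2 (neg_pos.2 ha2)
  have i3 : 0 < a₃⁻¹ := inv_pos.2 ha3
  have m1 : a₁⁻¹ * a₁ = 1 := inv_mul_cancel₀ hpos.ne'
  have m2 : (-a₂)⁻¹ * a₂ = -1 := by
    rw [inv_neg, neg_mul, inv_mul_cancel₀ ha2.ne]
  have m3 : a₃⁻¹ * a₃ = 1 := inv_mul_cancel₀ ha3.ne'
  -- If the slopes coincide, the general weights would all vanish; the first two vectors are then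
  -- already opposite.
  rcases (hk.trans hk').eq_or_lt with e | hlt
  · have e2 : k₂ = k₁ := le_antisymm (by linarith) hk
    refine ⟨a₁⁻¹, (-a₂)⁻¹, 0, i1.le, i2.le, le_rfl, by linarith, by linarith, ?_⟩
    rw [e2]; linear_combination k₁ * m1 + k₁ * m2
  · refine ⟨(k₃ - k₂) * a₁⁻¹, (k₃ - k₁) * (-a₂)⁻¹, (k₂ - k₁) * a₃⁻¹,
      mul_nonneg (by linarith) i1.le, mul_nonneg (by linarith) i2.le,
      mul_nonneg (by linarith) i3.le, ?_, ?_, ?_⟩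
    · have := mul_nonneg (by linarith : 0 ≤ k₃ - k₂) i1.le
      have := mul_pos (by linarith : 0 < k₃ - k₁) i2
      have := mul_nonneg (by linarith : 0 ≤ k₂ - k₁) i3.le
      linarith
    · linear_combination (k₃ - k₂) * m1 + (k₃ - k₁) * m2 + (k₂ - k₁) * m3
    · linear_combination (k₃ - k₂) * k₁ * m1 + (k₃ - k₁) * k₂ * m2 + (k₂ - k₁) * k₃ * m3

/-- The coordinates of a point of the Euclidean plane. -/
def planePair (x : EuclideanSpace ℝ (Fin 2)) : ℝ × ℝ := (x 0, x 1)

theorem mem_convexHull_triple {x y z : EuclideanSpace ℝ (Fin 2)} {p : EuclideanSpace ℝ (Fin 2)}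
    {w₁ w₂ w₃ : ℝ} (h1 : 0 ≤ w₁) (h2 : 0 ≤ w₂) (h3 : 0 ≤ w₃) (hpos : 0 < w₁ + w₂ + w₃)
    (h : ∀ i, w₁ * (x i - p i) + w₂ * (y i - p i) + w₃ * (z i - p i) = 0) :
    p ∈ convexHull ℝ {x, y, z} := by
  have key := Finset.centerMass_mem_convexHull (R := ℝ) (s := {x, y, z})
    (Finset.univ : Finset (Fin 3))
    (w := ![w₁, w₂, w₃]) (z := ![x, y, z])
    (by intro i _; fin_cases i <;> simpa) (by simpa [Fin.sum_univ_three] using hpos)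
    (by intro i _; fin_cases i <;> simp)
  convert key
  ext i
  simp only [Finset.centerMass, Fin.sum_univ_three, Matrix.cons_val_zero, Matrix.cons_val_one,
    Matrix.cons_val, PiLp.smul_apply, PiLp.add_apply, smul_eq_mul]
  rw [eq_inv_mul_iff_mul_eq₀ hpos.ne']
  linear_combination -(h i)

theorem dirForm_eq_zero {θ : ℝ} {x : ℝ × ℝ} (h : dirForm θ x = 0)
    (h' : dirForm (θ + Real.pi / 2) x = 0) : x.1 = 0 ∧ x.2 = 0 := by
  simp only [dirForm, Real.cos_add_pi_div_two, Real.sin_add_pi_div_two] at h h'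
  have := Real.sin_sq_add_cos_sq θ
  constructor
  · linear_combination Real.cos θ * h - Real.sin θ * h' - x.1 * this
  · linear_combination Real.sin θ * h + Real.cos θ * h' - x.2 * this

theorem mem_convexHull_of_alternating {x y z p : EuclideanSpace ℝ (Fin 2)} {θ : ℝ} {q : ℝ × ℝ}
    (hp : planePair p = q)
    (h12 : dirForm θ (planePair x - q) * dirForm θ (planePair y - q) < 0)
    (h13 : 0 < dirForm θ (planePair x - q) * dirForm θ (planePair z - q))
    (hk : dirForm (θ + Real.pi / 2) (planePair x - q) / dirForm θ (planePair x - q) ≤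
      dirForm (θ + Real.pi / 2) (planePair y - q) / dirForm θ (planePair y - q))
    (hk' : dirForm (θ + Real.pi / 2) (planePair y - q) / dirForm θ (planePair y - q) ≤
      dirForm (θ + Real.pi / 2) (planePair z - q) / dirForm θ (planePair z - q)) :
    p ∈ convexHull ℝ {x, y, z} := by
  obtain ⟨w₁, w₂, w₃, h1, h2, h3, h4, h5, h6⟩ := exists_alternating_weights h12 h13 hk hk'
  have lin : ∀ η, w₁ * dirForm η (planePair x - q) + w₂ * dirForm η (planePair y - q)
      + w₃ * dirForm η (planePair z - q) = dirForm η (w₁ • (planePair x - q)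
        + w₂ • (planePair y - q) + w₃ • (planePair z - q)) := fun η => by
    simp only [dirForm, Prod.fst_add, Prod.snd_add, Prod.smul_fst, Prod.smul_snd, smul_eq_mul]
    ring
  rw [lin] at h5 h6
  have := dirForm_eq_zero h5 h6
  simp only [Prod.fst_add, Prod.snd_add, Prod.smul_fst, Prod.smul_snd, smul_eq_mul, ← hp,
    planePair, Prod.fst_sub, Prod.snd_sub] at this
  refine mem_convexHull_triple h1 h2 h3 h4 fun i => ?_
  fin_cases i
  · exact this.1
  · exact this.2

end Hull

/-! ### From the six sectors to a block colouring -/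

section SectorColoring

open Finset Real

theorem dirForm_eq_combination (θ φ : ℝ) (x : ℝ × ℝ) :
    dirForm φ x = cos (φ - θ) * dirForm θ x + sin (φ - θ) * dirForm (θ + π / 2) x := by
  have h := dirForm_relation θ φ (θ + π / 2) x
  rw [show θ + π / 2 - φ = π / 2 - (φ - θ) by ring, sin_pi_div_two_sub,
    show θ + π / 2 - θ = π / 2 by ring, sin_pi_div_two, one_mul] at h
  exact h.symm

/-- The side of the line of `φ` is the side of the line of `θ` times the comparison of the slope
with a threshold. A sector thus becomes an interval of slopes together with a sign. -/
theorem dirForm_eq_mul_slope {θ φ : ℝ} {x : ℝ × ℝ} (hs : sin (φ - θ) ≠ 0) (hx : dirForm θ x ≠ 0) :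
    dirForm φ x = dirForm θ x * (sin (φ - θ) *
      (dirForm (θ + π / 2) x / dirForm θ x - -(cos (φ - θ) / sin (φ - θ)))) := by
  rw [dirForm_eq_combination θ φ]
  field_simp
  ring

theorem GeneralPosition.exists_altEdges_coloring {V : Type*} [Fintype V] [DecidableEq V]
    [Nonempty V] {f : V → EuclideanSpace ℝ (Fin 2)}
    (hf : GeneralPosition fun v => planePair (f v)) {w R : ℕ} (hw : 0 < w)
    (hn : Fintype.card V = R * w) :
    ∃ (χ : V → Fin R × SignType) (p : EuclideanSpace ℝ (Fin 2)),
      (∀ e ∈ altEdges χ, p ∈ convexHull ℝ (f '' e)) ∧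
      8 * ((Fintype.card V : ℝ) / 6 - 5) ^ 3 - 2 * (w * (Fintype.card V : ℝ) ^ 2) ≤
        #(altEdges χ) := by
  obtain ⟨θ, φ, ψ, q, h1, h2, h3, hsec⟩ := hf.exists_six_partition
  have s1 : 0 < sin (φ - θ) := sin_pos_of_pos_of_lt_pi (by linarith) (by linarith)
  have s2 : 0 < sin (ψ - φ) := sin_pos_of_pos_of_lt_pi (by linarith) (by linarith)
  have s3 : 0 < sin (ψ - θ) := sin_pos_of_pos_of_lt_pi (by linarith) (by linarith)
  set n := Fintype.card V with hndef
  set y : V → ℝ × ℝ := fun v => planePair (f v) - q with hy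
  set κ : V → ℝ := fun v => dirForm (θ + π / 2) (y v) / dirForm θ (y v) with hκ
  obtain ⟨κ₁, hκ₁⟩ : ∃ k, k = -(cos (φ - θ) / sin (φ - θ)) := ⟨_, rfl⟩
  obtain ⟨κ₂, hκ₂⟩ : ∃ k, k = -(cos (ψ - θ) / sin (ψ - θ)) := ⟨_, rfl⟩
  have hκ12 : κ₁ ≤ κ₂ := by
    rw [hκ₁, hκ₂, neg_le_neg_iff, div_le_div_iff₀ s3 s1]
    rw [show ψ - φ = (ψ - θ) - (φ - θ) by ring, sin_sub] at s2
    linarith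
  have hφ : ∀ v, dirForm θ (y v) ≠ 0 →
      dirForm φ (y v) = dirForm θ (y v) * (sin (φ - θ) * (κ v - κ₁)) := fun v hv => by
    rw [hκ₁]; exact dirForm_eq_mul_slope s1.ne' hv
  have hψ : ∀ v, dirForm θ (y v) ≠ 0 →
      dirForm ψ (y v) = dirForm θ (y v) * (sin (ψ - θ) * (κ v - κ₂)) := fun v hv => by
    rw [hκ₂]; exact dirForm_eq_mul_slope s3.ne' hv
  set s : V → SignType := fun v => SignType.sign (dirForm θ (y v)) with hs
  set g : V → Fin 3 := fun v => if κ v < κ₁ then 0 else if κ v < κ₂ then 1 else 2 with hg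
  obtain ⟨r, hr, hrn, hrκ⟩ := exists_rank κ
  have hgr : ∀ x y, g x < g y → r x < r y := by
    intro x y hxy
    by_contra! hle
    have := hrκ y x hle
    simp only [hg] at hxy
    split_ifs at hxy <;> first | (exact absurd hxy (by decide)) | linarith
  -- Each combination of a slope segment and a sign contains one of the six sectors.
  have hq : ∀ i, ∀ σ ≠ 0, ⌈(n : ℝ) / 6 - 5⌉₊ ≤ #{v | g v = i ∧ s v = σ} := by
    have red : ∀ α β i σ, (α, β) ∈ ({(θ, φ + π), (θ + π, φ), (φ, ψ + π), (φ + π, ψ), (θ, ψ),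
        (θ + π, ψ + π)} : Set (ℝ × ℝ)) →
        (∀ v, 0 < dirForm α (y v) → 0 < dirForm β (y v) → g v = i ∧ s v = σ) →
        ⌈(n : ℝ) / 6 - 5⌉₊ ≤ #{v | g v = i ∧ s v = σ} := by
      intro α β i σ hmem himp
      rw [Nat.ceil_le]
      refine (hsec α β hmem).trans (Nat.cast_le.2 ?_)
      rw [← Set.ncard_coe_finset]
      refine Set.ncard_le_ncard (fun v hv => ?_) (Set.toFinite _)
      rw [mem_coe, mem_filter_univ]
      exact himp v hv.1 hv.2
    have rel := fun v => dirForm_relation θ φ ψ (y v)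
    have gs0 : ∀ v, κ v < κ₁ → g v = 0 := fun v h => by simp only [hg, h, if_true]
    have gs1 : ∀ v, κ₁ < κ v → κ v < κ₂ → g v = 1 := fun v h h' => by
      simp only [hg, h.not_gt, h', if_true, if_false]
    have gs2 : ∀ v, κ₂ < κ v → g v = 2 := fun v h => by
      simp only [hg, h.not_gt, (hκ12.trans_lt h).not_gt, if_false]
    have e0 : ∀ {a b c : ℝ}, 0 < a → 0 < b → a * (b * c) < 0 → c < 0 := fun ha hb h =>
      neg_of_mul_neg_right (neg_of_mul_neg_right h ha.le) hb.le
    have e1 : ∀ {a b c : ℝ}, 0 < a → 0 < b → 0 < a * (b * c) → 0 < c := fun ha hb h =>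
      pos_of_mul_pos_right (pos_of_mul_pos_right h ha.le) hb.le
    have e2 : ∀ {a b c : ℝ}, a < 0 → 0 < b → 0 < a * (b * c) → c < 0 := fun ha hb h =>
      e0 (neg_pos.2 ha) hb (by linarith)
    have e3 : ∀ {a b c : ℝ}, a < 0 → 0 < b → a * (b * c) < 0 → 0 < c := fun ha hb h =>
      e1 (neg_pos.2 ha) hb (by linarith)
    intro i σ hσ
    have hσ' : σ = 1 ∨ σ = -1 := by revert hσ; revert σ; decide
    fin_cases i <;> rcases hσ' with rfl | rfl
    · refine red θ (φ + π) _ _ (by simp) fun v hA hB => ?_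
      rw [dirForm_add_pi, Left.neg_pos_iff, hφ v hA.ne'] at hB
      exact ⟨gs0 v (sub_neg.1 (e0 hA s1 hB)), sign_pos hA⟩
    · refine red (θ + π) φ _ _ (by simp) fun v hA hB => ?_
      rw [dirForm_add_pi, Left.neg_pos_iff] at hA
      rw [hφ v hA.ne] at hB
      exact ⟨gs0 v (sub_neg.1 (e2 hA s1 hB)), sign_neg hA⟩
    · refine red φ (ψ + π) _ _ (by simp) fun v hA hB => ?_
      rw [dirForm_add_pi, Left.neg_pos_iff] at hB
      have hC : 0 < dirForm θ (y v) := by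
        nlinarith [rel v, mul_pos s3 hA, mul_neg_of_pos_of_neg s1 hB]
      rw [hφ v hC.ne'] at hA
      rw [hψ v hC.ne'] at hB
      exact ⟨gs1 v (sub_pos.1 (e1 hC s1 hA)) (sub_neg.1 (e0 hC s3 hB)), sign_pos hC⟩
    · refine red (φ + π) ψ _ _ (by simp) fun v hA hB => ?_
      rw [dirForm_add_pi, Left.neg_pos_iff] at hA
      have hC : dirForm θ (y v) < 0 := by
        nlinarith [rel v, mul_pos s1 hB, mul_neg_of_pos_of_neg s3 hA]
      rw [hφ v hC.ne] at hA
      rw [hψ v hC.ne] at hB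
      exact ⟨gs1 v (sub_pos.1 (e3 hC s1 hA)) (sub_neg.1 (e2 hC s3 hB)), sign_neg hC⟩
    · refine red θ ψ _ _ (by simp) fun v hA hB => ?_
      rw [hψ v hA.ne'] at hB
      exact ⟨gs2 v (sub_pos.1 (e1 hA s3 hB)), sign_pos hA⟩
    · refine red (θ + π) (ψ + π) _ _ (by simp) fun v hA hB => ?_
      rw [dirForm_add_pi, Left.neg_pos_iff] at hA hB
      rw [hψ v hA.ne] at hB
      exact ⟨gs2 v (sub_pos.1 (e3 hA s3 hB)), sign_neg hA⟩
  have hR : ∀ v, r v / w < R := fun v => by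
    rw [Nat.div_lt_iff_lt_mul hw, ← hn]; exact hrn v
  refine ⟨fun v => (⟨r v / w, hR v⟩, s v), !₂[q.1, q.2], fun e he => ?_, ?_⟩
  · obtain ⟨a, b, c, rfl, hab, hbc, hsb, hsc, hsa⟩ := (mem_filter_univ _).1 he
    have hle : ∀ a b, (⟨r a / w, hR a⟩ : Fin R) < ⟨r b / w, hR b⟩ → κ a ≤ κ b := fun a b h => by
      refine hrκ a b (le_of_lt ?_)
      exact lt_of_not_ge fun h' => absurd h (not_lt.2 (Nat.div_le_div_right h'))
    rw [coe_insert, coe_insert, coe_singleton, Set.image_insert_eq, Set.image_insert_eq,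
      Set.image_singleton]
    simp only [hs] at hsa hsb hsc
    refine mem_convexHull_of_alternating (θ := θ) (q := q) (by simp [planePair]) ?_ ?_
      (hle a b hab) (hle b c hbc)
    · rw [← sign_eq_neg_one_iff, sign_mul, hsb]
      revert hsa
      generalize SignType.sign (dirForm θ (y a)) = σ
      revert σ; decide
    · rw [← sign_eq_one_iff, sign_mul, hsc]
      revert hsa
      generalize SignType.sign (dirForm θ (y a)) = σ
      revert σ; decide
  · have c1 := le_card_altTriples hr hgr hq
    have c2 := card_altTriples_le (s := s) hr hw hR
    have c3 : (8 * ⌈(n : ℝ) / 6 - 5⌉₊ ^ 3 : ℝ) ≤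
        #(altEdges fun v => ((⟨r v / w, hR v⟩ : Fin R), s v)) + 2 * (w * (n : ℝ) ^ 2) := by
      exact_mod_cast c1.trans c2
    have c4 : ((n : ℝ) / 6 - 5) ^ 3 ≤ (⌈(n : ℝ) / 6 - 5⌉₊ : ℝ) ^ 3 :=
      (Odd.strictMono_pow (by decide : Odd 3)).monotone (Nat.le_ceil _)
    linarith

end SectorColoring

/-! ### Removing the general position assumption -/

section Perturbation

open Filter Topology

theorem eventually_quadratic_ne_zero {a : ℝ} (ha : a ≠ 0) (b c : ℝ) :
    ∀ᶠ τ : ℝ in 𝓝[>] 0, a * τ ^ 2 + b * τ + c ≠ 0 := by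
  by_cases hc : c = 0
  · by_cases hb : b = 0
    · filter_upwards [self_mem_nhdsWithin] with τ hτ
      have hτ : τ ≠ 0 := ne_of_gt hτ
      simp [hb, hc, ha, hτ]
    · have h : Tendsto (fun τ : ℝ => a * τ + b) (𝓝[>] 0) (𝓝 b) :=
        (Continuous.tendsto' (by fun_prop) _ _ (by ring)).mono_left nhdsWithin_le_nhds
      filter_upwards [self_mem_nhdsWithin, h.eventually_ne hb] with τ hτ h'
      have hτ : τ ≠ 0 := ne_of_gt hτ
      rw [hc, show a * τ ^ 2 + b * τ + 0 = τ * (a * τ + b) by ring]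
      exact mul_ne_zero hτ h'
  · have h : Tendsto (fun τ : ℝ => a * τ ^ 2 + b * τ + c) (𝓝[>] 0) (𝓝 c) :=
      (Continuous.tendsto' (by fun_prop) _ _ (by ring)).mono_left nhdsWithin_le_nhds
    exact h.eventually_ne hc

variable {V : Type*} [Fintype V]

theorem exists_generalPosition_near (f : V → EuclideanSpace ℝ (Fin 2)) {δ : ℝ} (hδ : 0 < δ) :
    ∃ g : V → EuclideanSpace ℝ (Fin 2), (GeneralPosition fun v => planePair (g v)) ∧
      ∀ v, dist (g v) (f v) < δ := by
  let i : V → ℝ := fun v => (Fintype.equivFin V v : ℕ)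
  have hi : Function.Injective i := fun x y h =>
    (Fintype.equivFin V).injective (Fin.ext (Nat.cast_injective h))
  -- Shifting along a parabola makes each `triDet` quadratic in `τ`, with a Vandermonde determinant
  -- as its nonzero leading coefficient.
  let g : ℝ → V → EuclideanSpace ℝ (Fin 2) := fun τ v => f v + τ • !₂[i v, i v ^ 2]
  have h1 : ∀ᶠ τ : ℝ in 𝓝[>] 0, ∀ v, dist (g τ v) (f v) < δ := by
    rw [eventually_all]
    intro v
    have h : Tendsto (fun τ : ℝ => dist (g τ v) (f v)) (𝓝[>] 0) (𝓝 0) :=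
      (Continuous.tendsto' (by fun_prop) _ _ (by simp [g])).mono_left nhdsWithin_le_nhds
    exact h.eventually_lt_const hδ
  have h2 : ∀ᶠ τ : ℝ in 𝓝[>] 0, GeneralPosition fun v => planePair (g τ v) := by
    simp only [GeneralPosition, eventually_all]
    intro x y z hxy hxz hyz
    have hv : (i y - i x) * (i z - i x) * (i z - i y) ≠ 0 :=
      mul_ne_zero (mul_ne_zero (sub_ne_zero.2 (hi.ne hxy.symm)) (sub_ne_zero.2 (hi.ne hxz.symm)))
        (sub_ne_zero.2 (hi.ne hyz.symm))
    filter_upwards [eventually_quadratic_ne_zero hv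
      ((f y 0 - f x 0) * (i z ^ 2 - i x ^ 2) + (i y - i x) * (f z 1 - f x 1)
        - (f y 1 - f x 1) * (i z - i x) - (i y ^ 2 - i x ^ 2) * (f z 0 - f x 0))
      (triDet (planePair (f x)) (planePair (f y)) (planePair (f z)))] with τ hτ h0
    apply hτ
    rw [← h0]
    simp only [triDet, planePair, g, PiLp.add_apply, PiLp.smul_apply, smul_eq_mul,
      Matrix.cons_val_zero, Matrix.cons_val_one]
    ring
  obtain ⟨τ, h⟩ := (h1.and h2).exists
  exact ⟨g τ, h.2, h.1⟩

theorem exists_mem_of_forall_cthickening {ι X : Type*} [MetricSpace X] [ProperSpace X]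
    {S : Finset ι} (hS : S.Nonempty) {K : ι → Set X} (hK : ∀ i ∈ S, IsCompact (K i))
    (h : ∀ δ : ℝ, 0 < δ → ∃ p, ∀ i ∈ S, p ∈ Metric.cthickening δ (K i)) :
    ∃ p, ∀ i ∈ S, p ∈ K i := by
  let C : ℕ → Set X := fun j => ⋂ i ∈ S, Metric.cthickening (1 / ((j : ℝ) + 1)) (K i)
  have hclosed : ∀ j, IsClosed (C j) := fun j =>
    isClosed_biInter fun i _ => Metric.isClosed_cthickening
  obtain ⟨i₀, hi₀⟩ := hS
  obtain ⟨p, hp⟩ := IsCompact.nonempty_iInter_of_sequence_nonempty_isCompact_isClosed C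
    (fun j => Set.iInter₂_mono fun i _ =>
      Metric.cthickening_mono (by push_cast; gcongr; linarith) _)
    (fun j => by
      obtain ⟨p, hp⟩ := h (1 / ((j : ℝ) + 1)) (by positivity)
      exact ⟨p, Set.mem_iInter₂.2 hp⟩)
    ((hK i₀ hi₀).cthickening.of_isClosed_subset (hclosed 0) (Set.biInter_subset_of_mem hi₀))
    hclosed
  refine ⟨p, fun i hi => ?_⟩
  rw [← (hK i hi).isClosed.closure_eq, Metric.closure_eq_iInter_cthickening]
  refine Set.mem_iInter₂.2 fun δ hδ => ?_
  obtain ⟨j, hj⟩ := exists_nat_one_div_lt hδ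
  exact Metric.cthickening_mono hj.le _ (Set.mem_iInter₂.1 (Set.mem_iInter.1 hp j) i hi)

/-- A covering bound that holds for all points in general position holds for all points. -/
theorem exists_cover_of_generalPosition {𝓔 : Finset (Finset V)} {m : ℕ}
    (h : ∀ g : V → EuclideanSpace ℝ (Fin 2), (GeneralPosition fun v => planePair (g v)) →
      ∃ p, ∃ S ⊆ 𝓔, m ≤ S.card ∧ ∀ e ∈ S, p ∈ convexHull ℝ (g '' e))
    (f : V → EuclideanSpace ℝ (Fin 2)) :
    ∃ p, ∃ S ⊆ 𝓔, m ≤ S.card ∧ ∀ e ∈ S, p ∈ convexHull ℝ (f '' e) := by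
  have hcpt : ∀ e : Finset V, IsCompact (convexHull ℝ (f '' e)) := fun e =>
    ((Finset.finite_toSet e).image f).isCompact_convexHull ℝ
  have key : ∀ δ : ℝ, 0 < δ → ∃ S ∈ 𝓔.powerset, m ≤ S.card ∧
      ∃ p, ∀ e ∈ S, p ∈ Metric.cthickening δ (convexHull ℝ (f '' e)) := by
    intro δ hδ
    obtain ⟨g, hg, hgf⟩ := exists_generalPosition_near f hδ
    obtain ⟨p, S, hS, hm, hp⟩ := h g hg
    refine ⟨S, Finset.mem_powerset.2 hS, hm, p, fun e he => ?_⟩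
    refine convexHull_min ?_ ((convex_convexHull ℝ _).cthickening δ) (hp e he)
    rintro _ ⟨v, hv, rfl⟩
    exact Metric.mem_cthickening_of_dist_le _ (f v) _ _
      (subset_convexHull ℝ _ ⟨v, hv, rfl⟩) (hgf v).le
  by_contra hcon
  push Not at hcon
  -- If a fixed `S` worked for arbitrarily small `δ`, compactness would give a point common to its
  -- hulls. As there are finitely many `S`, one `δ` fails for all of them, against `key`.
  have hbad : ∀ S ∈ 𝓔.powerset, ∀ᶠ δ : ℝ in 𝓝[>] 0, ¬ (m ≤ S.card ∧
      ∃ p, ∀ e ∈ S, p ∈ Metric.cthickening δ (convexHull ℝ (f '' e))) := by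
    intro S hS
    by_contra hfreq
    rw [← Filter.Frequently] at hfreq
    have hmS : m ≤ S.card := (hfreq.exists.choose_spec).1
    rcases S.eq_empty_or_nonempty with rfl | hne
    · obtain ⟨e, he, -⟩ := hcon 0 ∅ (by simp) hmS
      simp at he
    · obtain ⟨p, hp⟩ := exists_mem_of_forall_cthickening hne (fun e _ => hcpt e) fun δ hδ => by
        obtain ⟨η, hη, hη'⟩ := (hfreq.and_eventually
          (mem_nhdsWithin_of_mem_nhds (Iio_mem_nhds hδ))).exists
        obtain ⟨p, hp⟩ := hη.2
        exact ⟨p, fun e he => Metric.cthickening_mono (le_of_lt hη') _ (hp e he)⟩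
      obtain ⟨e, he, hpe⟩ := hcon p S (Finset.mem_powerset.1 hS) hmS
      exact hpe (hp e he)
  obtain ⟨δ, hδ, hδ0⟩ :=
    (((Finset.eventually_all (𝓔.powerset)).2 hbad).and self_mem_nhdsWithin).exists
  obtain ⟨S, hS, hS'⟩ := key δ hδ0
  exact hδ S hS hS'

end Perturbation

/-! ### A Chernoff bound for random subsets -/

section Sampling

open Finset Real

/-- The moment generating function of one sampled element, from exp u ≤ 1 + u + u^2 for |u| ≤ 1. -/
theorem one_sub_add_mul_exp_le {p t lam : ℝ} (hp : 0 ≤ p) (ht : |t| ≤ 1) (hl : 0 ≤ lam)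
    (hl1 : lam ≤ 1) : 1 - p + p * exp (lam * t) ≤ exp (p * (lam * t) + p * lam ^ 2) := by
  have h1 : |lam * t| ≤ 1 := by
    rw [abs_mul, abs_of_nonneg hl]; exact mul_le_one₀ hl1 (abs_nonneg _) ht
  have h2 := (abs_le.1 (abs_exp_sub_one_sub_id_le h1)).2
  have h3 : (lam * t) ^ 2 ≤ lam ^ 2 := by
    rw [mul_pow]
    have : t ^ 2 ≤ 1 := by rw [← sq_abs]; exact pow_le_one₀ (abs_nonneg _) ht
    nlinarith [sq_nonneg lam]
  have h4 := add_one_le_exp (p * (lam * t) + p * lam ^ 2)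
  nlinarith [mul_le_mul_of_nonneg_left (h2.trans h3) hp]

/-- A random subset of density `p` does not exceed the expected weight by much, simultaneously for
a family of weights that is not too large. -/
theorem exists_subset_sum_le {ι X : Type*} [DecidableEq X] (s : Finset X) (G : Finset ι)
    (g : ι → X → ℝ) (hg : ∀ i ∈ G, ∀ x ∈ s, |g i x| ≤ 1) {p η : ℝ} (hp : 0 ≤ p) (hp1 : p ≤ 1)
    (hη : 0 ≤ η) (hη1 : η ≤ 1) (hG : #G * exp (-(p * #s * η ^ 2 / 4)) < 1) :
    ∃ t ⊆ s, ∀ i ∈ G, ∑ x ∈ t, g i x ≤ p * ∑ x ∈ s, g i x + η * (p * #s) := by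
  by_contra! hcon
  -- This value minimises `lam ^ 2 - lam * η`, whence the exponent `-η ^ 2 / 4`.
  set lam := η / 2 with hlam
  have hl : 0 ≤ lam := by positivity
  have hl1 : lam ≤ 1 := by rw [hlam]; linarith
  set b : ι → ℝ := fun i => p * ∑ x ∈ s, g i x + η * (p * #s) with hb
  -- The probability of `t` when every element is kept independently with probability `p`.
  set W : Finset X → ℝ := fun t => (∏ _x ∈ t, p) * ∏ _x ∈ s \ t, (1 - p) with hW
  have hW0 : ∀ t, 0 ≤ W t := fun t =>
    mul_nonneg (prod_nonneg fun _ _ => hp) (prod_nonneg fun _ _ => sub_nonneg.2 hp1)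
  have hW1 : ∑ t ∈ s.powerset, W t = 1 := by
    rw [← prod_add (fun _ => p) (fun _ => 1 - p) s]; simp
  have hmgf : ∀ i ∈ G, ∑ t ∈ s.powerset, W t * exp (lam * (∑ x ∈ t, g i x - b i)) ≤
      exp (-(p * #s * η ^ 2 / 4)) := by
    intro i hi
    have e1 : ∀ t ∈ s.powerset, W t * exp (lam * (∑ x ∈ t, g i x - b i)) =
        exp (-(lam * b i)) * ((∏ x ∈ t, p * exp (lam * g i x)) * ∏ _x ∈ s \ t, (1 - p)) := by
      intro t _
      rw [mul_sub, sub_eq_add_neg, exp_add, mul_sum, exp_sum, prod_mul_distrib]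
      simp only [hW]; ring
    rw [sum_congr rfl e1, ← mul_sum,
      ← prod_add (fun x => p * exp (lam * g i x)) (fun _ => 1 - p) s]
    have e2 : ∏ x ∈ s, (p * exp (lam * g i x) + (1 - p)) ≤
        ∏ x ∈ s, exp (p * (lam * g i x) + p * lam ^ 2) := by
      refine prod_le_prod (fun x _ => ?_) fun x hx => ?_
      · have := mul_nonneg hp (exp_pos (lam * g i x)).le; linarith
      · rw [add_comm]; exact one_sub_add_mul_exp_le hp (hg i hi x hx) hl hl1
    rw [← exp_sum, sum_add_distrib, ← mul_sum, ← mul_sum, sum_const, nsmul_eq_mul] at e2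
    refine (mul_le_mul_of_nonneg_left e2 (exp_pos _).le).trans (le_of_eq ?_)
    rw [← exp_add]
    congr 1
    simp only [hb, hlam]
    ring
  have h1 : ∀ t ∈ s.powerset, W t ≤
      ∑ i ∈ G, W t * exp (lam * (∑ x ∈ t, g i x - b i)) := by
    intro t ht
    obtain ⟨i, hi, hlt⟩ := hcon t (mem_powerset.1 ht)
    refine le_trans ?_ (single_le_sum (f := fun i => W t * exp (lam * (∑ x ∈ t, g i x - b i)))
      (fun j _ => mul_nonneg (hW0 t) (exp_pos _).le) hi)
    exact le_mul_of_one_le_right (hW0 t) (one_le_exp (mul_nonneg hl (sub_nonneg.2 hlt.le)))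
  have h2 := sum_le_sum h1
  rw [hW1, sum_comm] at h2
  have h3 := sum_le_card_nsmul G _ _ hmgf
  rw [nsmul_eq_mul] at h3
  linarith

end Sampling

/-! ### Capping the degrees and completing to a regular hypergraph -/

section Regularize

open Finset

theorem card_filter_snd_equiv {A B C : Type*} [Fintype A] [Fintype B] [DecidableEq C]
    (e : A ≃ B × C) (c : C) : #{a | (e a).2 = c} = Fintype.card B := by
  rw [← Fintype.card_subtype]
  refine Fintype.card_congr ⟨fun a => (e a.1).1, fun b => ⟨e.symm (b, c), by simp⟩, ?_, ?_⟩
  · rintro ⟨a, rfl⟩; simp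
  · intro b; simp

/-- There is a bipartite graph with prescribed degrees on one side and constant degree on
the other. -/
theorem exists_biregular {n k L : ℕ} (r : Fin n → ℕ) (hr : ∀ v, r v ≤ L)
    (hsum : ∑ v, r v = k * L) :
    ∃ R : Finset (Fin n × Fin L), (∀ v, #{a ∈ R | a.1 = v} = r v) ∧
      ∀ j, #{a ∈ R | a.2 = j} = k := by
  -- List the half-edges vertex by vertex and deal them out cyclically modulo `L`. Those of one
  -- vertex are at most `L` consecutive numbers, so they have distinct residues.
  let e : ((v : Fin n) × Fin (r v)) ≃ Fin (k * L) := finSigmaFinEquiv.trans (finCongr hsum)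
  let c : ((v : Fin n) × Fin (r v)) → Fin L := fun a => (finProdFinEquiv.symm (e a)).2
  let F : ((v : Fin n) × Fin (r v)) → Fin n × Fin L := fun a => (a.1, c a)
  have hF : Function.Injective F := by
    rintro ⟨v, i⟩ ⟨v', i'⟩ h
    simp only [F, Prod.mk.injEq] at h
    obtain ⟨rfl, h⟩ := h
    have h1 := congrArg Fin.val h
    simp only [c, finProdFinEquiv_symm_apply, Fin.coe_modNat, e, Equiv.trans_apply,
      finCongr_apply, Fin.val_cast, finSigmaFinEquiv_apply] at h1
    have h2 : (i : ℕ) ≡ i' [MOD L] := Nat.ModEq.add_left_cancel' _ h1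
    have h3 := h2.eq_of_lt_of_lt (i.2.trans_le (hr v)) (i'.2.trans_le (hr v))
    rw [Fin.ext h3]
  refine ⟨univ.map ⟨F, hF⟩, fun v => ?_, fun j => ?_⟩
  · rw [filter_map, card_map]
    calc #{a | ((fun a : Fin n × Fin L => a.1 = v) ∘ (⟨F, hF⟩ : _ ↪ _)) a}
        = #((univ : Finset (Fin (r v))).map ⟨fun i => (⟨v, i⟩ : (v : Fin n) × Fin (r v)),
            fun i i' h => by simpa using h⟩) := by
          congr 1
          ext ⟨w, i⟩
          simp only [F, Function.comp, mem_filter_univ, Function.Embedding.coeFn_mk, mem_map,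
            mem_univ, true_and]
          constructor
          · rintro rfl; exact ⟨i, rfl⟩
          · rintro ⟨i', h⟩; exact (congrArg Sigma.fst h).symm
      _ = r v := by simp
  · rw [filter_map, card_map]
    exact (card_filter_snd_equiv (e.trans finProdFinEquiv.symm) j).trans (Fintype.card_fin k)

variable {n : ℕ}

/-- A uniform hypergraph of maximum degree at most `k` whose number of edges is `k * t` can be made
`k`-regular by adding `2 * L` new vertices. -/
theorem exists_regular_extension {k t L : ℕ} (hk : k ≤ L) (hn : n = 3 * t + L)
    {𝓔 : Finset (Finset (Fin n))} (h3 : ∀ e ∈ 𝓔, #e = 3) (hdeg : ∀ v, #{e ∈ 𝓔 | v ∈ e} ≤ k)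
    (hcard : #𝓔 = k * t) :
    ∃ 𝓕 : Finset (Finset (Fin n ⊕ Fin L × Bool)), (∀ e ∈ 𝓕, #e = 3) ∧
      (∀ v, #{e ∈ 𝓕 | v ∈ e} = k) ∧ #𝓕 = k * (t + L) ∧
      ∀ e ∈ 𝓔, e.map Function.Embedding.inl ∈ 𝓕 := by
  have hsumdeg : ∑ v, #{e ∈ 𝓔 | v ∈ e} = 3 * (k * t) := by
    have h := sum_card_bipartiteAbove_eq_sum_card_bipartiteBelow (s := univ) (t := 𝓔)
      (fun v e => v ∈ e)
    simp only [bipartiteAbove, bipartiteBelow, filter_univ_mem] at h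
    rw [h, sum_congr rfl h3, sum_const, smul_eq_mul, hcard, mul_comm]
  obtain ⟨R, hR1, hR2⟩ := exists_biregular (k := k) (L := L) (fun v => k - #{e ∈ 𝓔 | v ∈ e})
    (fun v => (Nat.sub_le _ _).trans hk) (by
      have : ∑ v, (k - #{e ∈ 𝓔 | v ∈ e}) + ∑ v, #{e ∈ 𝓔 | v ∈ e} = k * n := by
        rw [← sum_add_distrib, sum_congr rfl fun v _ => Nat.sub_add_cancel (hdeg v)]
        simp [mul_comm]
      rw [hsumdeg] at this
      have e : k * n = k * L + 3 * (k * t) := by rw [hn]; ring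
      omega)
  let ι : Finset (Fin n) ↪ Finset (Fin n ⊕ Fin L × Bool) :=
    ⟨fun e => e.map Function.Embedding.inl, fun _ _ h => map_injective _ h⟩
  have hι : ∀ e, ι e = e.map Function.Embedding.inl := fun _ => rfl
  -- New vertices come in `L` pairs, and each new edge joins an old vertex to a pair. The missing
  -- degrees sum to kn - 3kt = kL, exactly what gives every new vertex degree `k`.
  let τ : Fin n × Fin L → Finset (Fin n ⊕ Fin L × Bool) := fun a =>
    {Sum.inl a.1, Sum.inr (a.2, false), Sum.inr (a.2, true)}
  have hτmem : ∀ a v, Sum.inl v ∈ τ a ↔ a.1 = v := fun a v => by simp [τ, eq_comm]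
  have hτmem' : ∀ a j b, Sum.inr (j, b) ∈ τ a ↔ a.2 = j := fun a j b => by
    cases b <;> simp [τ, eq_comm]
  have hτ : Function.Injective τ := fun a a' h => by
    refine Prod.ext ?_ ?_
    · exact ((hτmem a a'.1).1 (h ▸ (hτmem a' a'.1).2 rfl))
    · exact ((hτmem' a a'.2 true).1 (h ▸ (hτmem' a' a'.2 true).2 rfl))
  have hdisj : Disjoint (𝓔.map ι) (R.map ⟨τ, hτ⟩) := by
    rw [disjoint_left]
    intro e h1 h2
    obtain ⟨e₁, -, rfl⟩ := mem_map.1 h1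
    obtain ⟨a, -, ha⟩ := mem_map.1 h2
    have : Sum.inr (a.2, true) ∈ e₁.map Function.Embedding.inl :=
      (show τ a = e₁.map Function.Embedding.inl from ha) ▸ (hτmem' a a.2 true).2 rfl
    simp at this
  have hcardR : #R = k * L := by
    rw [card_eq_sum_card_fiberwise (f := Prod.snd) (t := univ) (by simp), sum_congr rfl
      fun j _ => hR2 j]
    simp [mul_comm]
  refine ⟨(𝓔.map ι) ∪ (R.map ⟨τ, hτ⟩), fun e he => ?_, fun v => ?_, ?_, fun e he => ?_⟩
  · rcases mem_union.1 he with h | h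
    · obtain ⟨e₁, h1, rfl⟩ := mem_map.1 h
      simpa [hι] using h3 _ h1
    · obtain ⟨a, -, rfl⟩ := mem_map.1 h
      exact card_eq_three.2 ⟨_, _, _, by simp, by simp, by simp, rfl⟩
  · rw [filter_union, card_union_of_disjoint (disjoint_filter_filter hdisj), filter_map, card_map,
      filter_map, card_map]
    rcases v with v | ⟨j, b⟩
    · have e1 : #{e ∈ 𝓔 | ((fun e => Sum.inl v ∈ e) ∘ ι) e} = #{e ∈ 𝓔 | v ∈ e} := by
        simp [hι]
      have e2 : #{a ∈ R | ((fun e => Sum.inl v ∈ e) ∘ (⟨τ, hτ⟩ : _ ↪ _)) a} =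
          #{a ∈ R | a.1 = v} := by
        simp only [Function.comp_def, Function.Embedding.coeFn_mk, hτmem]
      rw [e1, e2, hR1]
      exact Nat.add_sub_cancel' (hdeg v)
    · have e1 : #{e ∈ 𝓔 | ((fun e => Sum.inr (j, b) ∈ e) ∘ ι) e} = 0 := by
        simp [hι]
      have e2 : #{a ∈ R | ((fun e => Sum.inr (j, b) ∈ e) ∘ (⟨τ, hτ⟩ : _ ↪ _)) a} =
          #{a ∈ R | a.2 = j} := by
        simp only [Function.comp_def, Function.Embedding.coeFn_mk, hτmem']
      rw [e1, e2, hR2, zero_add]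
  · rw [card_union_of_disjoint hdisj, card_map, card_map, hcard, hcardR, mul_add]
  · exact mem_union_left _ (mem_map_of_mem ι he)

/-- Deleting the excess edges at each vertex bounds the degrees. -/
theorem exists_subset_degree_le {V : Type*} [Fintype V] [DecidableEq V] (𝓔 : Finset (Finset V))
    (k : ℕ) : ∃ 𝓔' ⊆ 𝓔, (∀ v, #{e ∈ 𝓔' | v ∈ e} ≤ k) ∧
      #𝓔 ≤ #𝓔' + ∑ v, (#{e ∈ 𝓔 | v ∈ e} - k) := by
  choose D hD hDc using fun v => exists_subset_card_eq
    (Nat.sub_le (#{e ∈ 𝓔 | v ∈ e}) k)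
  refine ⟨𝓔 \ univ.biUnion D, sdiff_subset, fun v => ?_, ?_⟩
  · have h1 : {e ∈ 𝓔 \ univ.biUnion D | v ∈ e} ⊆ {e ∈ 𝓔 | v ∈ e} \ D v := by
      intro e he
      simp only [mem_filter, mem_sdiff, mem_biUnion, mem_univ, true_and, not_exists] at he ⊢
      exact ⟨⟨he.1.1, he.2⟩, he.1.2 v⟩
    have h2 := card_le_card h1
    rw [card_sdiff_of_subset (hD v), hDc] at h2
    omega
  · have h1 : #(univ.biUnion D) ≤ ∑ v, (#{e ∈ 𝓔 | v ∈ e} - k) :=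
      card_biUnion_le.trans_eq (sum_congr rfl fun v _ => hDc v)
    have h2 := card_le_card_sdiff_add_card (s := 𝓔) (t := univ.biUnion D)
    omega

end Regularize

/-! ### Sparse pseudorandom triples -/

section RandomHypergraph

open Finset Real

theorem card_powersetCard_filter_mem {V : Type*} [Fintype V] [DecidableEq V] (v : V) (k : ℕ) :
    #{e ∈ powersetCard (k + 1) (univ : Finset V) | v ∈ e} = (Fintype.card V - 1).choose k := by
  rw [← card_univ, ← card_erase_of_mem (mem_univ v), ← card_powersetCard]
  refine card_bij' (fun e _ => e.erase v) (fun e _ => insert v e) ?_ ?_ ?_ ?_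
  · intro e he
    rw [mem_filter, mem_powersetCard] at he
    rw [mem_powersetCard, card_erase_of_mem he.2, he.1.2]
    exact ⟨erase_subset_erase v (subset_univ e), rfl⟩
  · intro e he
    rw [mem_powersetCard] at he
    have hv : v ∉ e := fun h => notMem_erase v _ (he.1 h)
    rw [mem_filter, mem_powersetCard, card_insert_of_notMem hv, he.2]
    exact ⟨⟨subset_univ _, rfl⟩, mem_insert_self _ _⟩
  · intro e he
    exact insert_erase (mem_filter.1 he).2
  · intro e he
    rw [mem_powersetCard] at he
    exact erase_insert fun h => notMem_erase v _ (he.1 h)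

theorem sum_card_inter_eq {V : Type*} [DecidableEq V] (𝓔 : Finset (Finset V)) (A : Finset V) :
    ∑ e ∈ 𝓔, #(e ∩ A) = ∑ v ∈ A, #{e ∈ 𝓔 | v ∈ e} := by
  have h := sum_card_bipartiteAbove_eq_sum_card_bipartiteBelow (s := A) (t := 𝓔)
    (fun v e => v ∈ e)
  simp only [bipartiteAbove, bipartiteBelow] at h
  rw [h]
  refine sum_congr rfl fun e _ => ?_
  rw [filter_mem_eq_inter, inter_comm]

/-- A random sparse 3-uniform hypergraph contains the expected number of edges of each family
`altEdges χ`, and has the expected number of incidences with each set of vertices. -/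
theorem exists_pseudorandom_triples {n R κ : ℕ} {η : ℝ} (hη : 0 ≤ η) (hη1 : η ≤ 1)
    (hκ : log (3 * R + 4) + 2 ≤ κ * η ^ 2 / 4) (hn : 0 < n) (hκn : κ * n ≤ n.choose 3) :
    ∃ 𝓔 ⊆ powersetCard 3 (univ : Finset (Fin n)),
      (∀ χ : Fin n → Fin R × SignType, (κ * n : ℝ) / n.choose 3 * #(altEdges χ) - η * (κ * n) ≤
        #(𝓔 ∩ altEdges χ)) ∧
      (∀ A : Finset (Fin n), (∑ v ∈ A, #{e ∈ 𝓔 | v ∈ e} : ℕ) ≤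
        3 * (κ * #A : ℝ) + 3 * (η * (κ * n))) ∧
      κ * n - η * (κ * n) ≤ #𝓔 := by
  have hlog : 0 ≤ log (3 * (R : ℝ) + 4) := log_nonneg (by
    have : (0 : ℝ) ≤ R := Nat.cast_nonneg R
    linarith)
  have hκ0 : 0 < κ := by
    rcases Nat.eq_zero_or_pos κ with rfl | h
    · simp at hκ; linarith
    · exact h
  have hn' : (0 : ℝ) < n := by exact_mod_cast hn
  have hκ' : (0 : ℝ) < κ := by exact_mod_cast hκ0
  have hN : (0 : ℝ) < n.choose 3 := by
    exact_mod_cast (Nat.mul_pos hκ0 hn).trans_le hκn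
  set X := powersetCard 3 (univ : Finset (Fin n)) with hX
  have hXc : #X = n.choose 3 := by rw [hX, card_powersetCard, card_univ, Fintype.card_fin]
  set p : ℝ := (κ * n : ℝ) / n.choose 3 with hp
  have hpX : p * #X = κ * n := by rw [hXc, hp, div_mul_cancel₀ _ hN.ne']
  have hp0 : 0 ≤ p := by positivity
  have hp1 : p ≤ 1 := by rw [hp, div_le_one hN]; exact_mod_cast hκn
  -- The sampling lemma bounds sums from above, so the tests for `altEdges χ` and for the number of
  -- edges carry a minus sign. Incidences are divided by 3 to stay within [-1, 1].
  let g : (Fin n → Fin R × SignType) ⊕ Option (Finset (Fin n)) → Finset (Fin n) → ℝ := fun i e =>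
    Sum.elim (fun χ => -(if e ∈ altEdges χ then 1 else 0))
      (fun A => A.elim (-1) fun A => (#(e ∩ A) : ℝ) / 3) i
  have hg : ∀ i ∈ univ, ∀ e ∈ X, |g i e| ≤ 1 := by
    rintro (χ | _ | A) - e he
    · simp only [g, Sum.elim_inl, abs_neg]; split_ifs <;> simp
    · simp [g]
    · have h1 : #(e ∩ A) ≤ 3 := (card_le_card inter_subset_left).trans_eq (mem_powersetCard.1 he).2
      have h2 : (#(e ∩ A) : ℝ) ≤ 3 := by exact_mod_cast h1
      simp only [g, Sum.elim_inr, Option.elim_some]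
      rw [abs_of_nonneg (by positivity)]
      linarith
  -- The number of tests is exponential in `n` with base depending on `R` only, so it is beaten by
  -- the factor exp(-κnη²/4).
  have hcount : #(univ : Finset ((Fin n → Fin R × SignType) ⊕ Option (Finset (Fin n)))) *
      exp (-(p * #X * η ^ 2 / 4)) < 1 := by
    have hS : Fintype.card SignType = 3 := rfl
    have e1 : (#(univ : Finset ((Fin n → Fin R × SignType) ⊕ Option (Finset (Fin n)))) : ℝ) ≤
        3 * (3 * R + 4) ^ n := by
      rw [card_univ, Fintype.card_sum, Fintype.card_option, Fintype.card_fun, Fintype.card_finset,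
        Fintype.card_prod, Fintype.card_fin, Fintype.card_fin, hS]
      push_cast
      have hR0 : (0 : ℝ) ≤ R := Nat.cast_nonneg R
      have a1 : ((R : ℝ) * 3) ^ n ≤ (3 * R + 4) ^ n :=
        pow_le_pow_left₀ (by positivity) (by linarith) n
      have a2 : (2 : ℝ) ^ n ≤ (3 * R + 4) ^ n := pow_le_pow_left₀ (by norm_num) (by linarith) n
      have a3 : (1 : ℝ) ≤ (3 * R + 4) ^ n := one_le_pow₀ (by linarith)
      linarith
    have e2 : (3 * (R : ℝ) + 4) ^ n = exp (n * log (3 * R + 4)) := by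
      rw [exp_nat_mul, exp_log (by positivity)]
    rw [hpX]
    calc _ ≤ 3 * exp (n * log (3 * R + 4)) * exp (-(κ * n * η ^ 2 / 4)) := by
          rw [← e2]; exact mul_le_mul_of_nonneg_right e1 (exp_pos _).le
      _ = 3 * exp (n * (log (3 * R + 4) - κ * η ^ 2 / 4)) := by
          rw [mul_assoc, ← exp_add]; congr 2; ring
      _ ≤ 3 * exp (-2) := by
          have h1n : (1 : ℝ) ≤ n := by exact_mod_cast hn
          gcongr
          nlinarith
      _ < 1 := by
          rw [exp_neg, ← div_eq_mul_inv, div_lt_one (exp_pos _)]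
          linarith [add_one_lt_exp (show (2 : ℝ) ≠ 0 by norm_num)]
  obtain ⟨𝓔, h𝓔, hE⟩ := exists_subset_sum_le X univ g hg hp0 hp1 hη hη1 hcount
  rw [hpX] at hE
  refine ⟨𝓔, h𝓔, fun χ => ?_, fun A => ?_, ?_⟩
  · have h := hE (Sum.inl χ) (mem_univ _)
    simp only [g, Sum.elim_inl, sum_neg_distrib, sum_boole, filter_mem_eq_inter] at h
    have e : X ∩ altEdges χ = altEdges χ := inter_eq_right.2 fun e he =>
      mem_powersetCard.2 ⟨subset_univ _, card_of_mem_altEdges he⟩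
    rw [e] at h
    linarith
  · have h := hE (Sum.inr (some A)) (mem_univ _)
    simp only [g, Sum.elim_inr, Option.elim_some, ← sum_div, ← Nat.cast_sum,
      sum_card_inter_eq] at h
    have e : ∑ v ∈ A, #{e ∈ X | v ∈ e} = #A * (n - 1).choose 2 := by
      rw [sum_congr rfl fun v _ => card_powersetCard_filter_mem v 2]
      simp
    have e' : (n : ℝ) * (n - 1).choose 2 = n.choose 3 * 3 := by
      have := Nat.add_one_mul_choose_eq (n - 1) 2
      rw [Nat.sub_add_cancel hn] at this
      exact_mod_cast this
    have e'' : p * (((#A * (n - 1).choose 2 : ℕ) : ℝ) / 3) = κ * #A := by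
      rw [hp, Nat.cast_mul]
      field_simp
      linear_combination (#A : ℝ) * e'
    rw [e, e''] at h
    linarith
  · have h := hE (Sum.inr none) (mem_univ _)
    simp only [g, Sum.elim_inr, Option.elim_none, sum_const, nsmul_eq_mul] at h
    nlinarith

end RandomHypergraph

/-! ### Regular hypergraphs with overlap close to 2/9 -/

section RegularOverlap

open Finset Real

/-- For every placement of the vertices, some point lies in at least `m` of the triangles spanned
by the edges. -/
def CoverAtLeast {V : Type*} (𝓔 : Finset (Finset V)) (m : ℕ) : Prop :=
  ∀ f : V → EuclideanSpace ℝ (Fin 2), ∃ p, ∃ S ⊆ 𝓔, m ≤ #S ∧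
    ∀ e ∈ S, p ∈ convexHull ℝ (f '' e)

/-- The leading terms agree, as 8/6^3 = (2/9)/6. The allowance ε n^3/6 is shared equally by the
blocks, through 24/ε ≤ R, and by the error 5, through 40/ε ≤ n. -/
theorem le_card_altEdges_bound {n : ℕ} {R w ε : ℝ} (hε : 0 < ε) (hε1 : ε ≤ 2 / 9) (hR : 24 / ε ≤ R)
    (hn : n = R * w) (hn' : 40 / ε ≤ n) :
    (2 / 9 - ε) * n.choose 3 ≤ 8 * ((n : ℝ) / 6 - 5) ^ 3 - 2 * (w * (n : ℝ) ^ 2) := by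
  have hc : (n.choose 3 : ℝ) ≤ (n : ℝ) ^ 3 / 6 := by
    simpa [Nat.factorial] using Nat.choose_le_pow_div (α := ℝ) 3 n
  obtain ⟨x, hx⟩ : ∃ x : ℝ, x = n := ⟨_, rfl⟩
  rw [← hx] at hn hn' hc ⊢
  have h1 : 40 ≤ x * ε := by rwa [div_le_iff₀ hε] at hn'
  have h2 : 24 ≤ R * ε := by rwa [div_le_iff₀ hε] at hR
  have hx10 : 10 ≤ x := by nlinarith
  have hR0 : 0 < R := (by positivity : 0 < 24 / ε).trans_le hR
  have hw0 : 0 ≤ w := by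
    by_contra! h
    nlinarith [mul_neg_of_pos_of_neg hR0 h]
  have hw : 24 * w ≤ ε * x := by rw [hn]; nlinarith
  have h3 : (2 / 9 - ε) * (n.choose 3 : ℝ) ≤ (2 / 9 - ε) * (x ^ 3 / 6) :=
    mul_le_mul_of_nonneg_left hc (by linarith)
  have h4 : w * x ^ 2 ≤ ε * x * x ^ 2 / 24 := by nlinarith [sq_nonneg x]
  have h5 : 40 * x ^ 2 ≤ x * ε * x ^ 2 := mul_le_mul_of_nonneg_right h1 (sq_nonneg x)
  nlinarith

theorem sum_degree_eq {n : ℕ} {𝓔 : Finset (Finset (Fin n))} (h3 : ∀ e ∈ 𝓔, #e = 3) :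
    ∑ v, #{e ∈ 𝓔 | v ∈ e} = 3 * #𝓔 := by
  rw [← sum_card_inter_eq, sum_congr rfl fun e he => by rw [inter_univ, h3 e he]]
  simp [mul_comm]

/-- A hypergraph whose degrees are at most `k` on average over all sets of vertices has a large
subhypergraph of maximum degree at most `k` and with a number of edges divisible by `k`. -/
theorem exists_truncation {n k : ℕ} {δ : ℝ} (hk0 : 0 < k) (hkn : k ≤ n)
    {𝓔 : Finset (Finset (Fin n))} (h3 : ∀ e ∈ 𝓔, #e = 3)
    (hb : ∀ A : Finset (Fin n), (∑ v ∈ A, #{e ∈ 𝓔 | v ∈ e} : ℕ) ≤ (k * #A : ℝ) + δ) :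
    ∃ (t L : ℕ) (𝓔' : Finset (Finset (Fin n))), 𝓔' ⊆ 𝓔 ∧ k ≤ L ∧ n = 3 * t + L ∧
      (∀ v, #{e ∈ 𝓔' | v ∈ e} ≤ k) ∧ #𝓔' = k * t ∧ (#𝓔 : ℝ) ≤ #𝓔' + δ + (k + k ^ 2) := by
  obtain ⟨𝓔₁, h𝓔₁, hdeg₁, hcard₁⟩ := exists_subset_degree_le 𝓔 k
  have hexc : ((∑ v, (#{e ∈ 𝓔 | v ∈ e} - k) : ℕ) : ℝ) ≤ δ := by
    -- Applied to the set of vertices of excessive degree, `hb` bounds the whole excess by `δ`.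
    set A : Finset (Fin n) := {v | k < #{e ∈ 𝓔 | v ∈ e}} with hA
    have e1 : ∑ v, (#{e ∈ 𝓔 | v ∈ e} - k) = ∑ v ∈ A, (#{e ∈ 𝓔 | v ∈ e} - k) := by
      refine (sum_subset (subset_univ A) fun v _ hv => ?_).symm
      rw [hA, mem_filter_univ, not_lt] at hv
      exact Nat.sub_eq_zero_of_le hv
    have e2 : ∑ v ∈ A, (#{e ∈ 𝓔 | v ∈ e} - k) + #A * k = ∑ v ∈ A, #{e ∈ 𝓔 | v ∈ e} := by
      rw [← smul_eq_mul, ← sum_const, ← sum_add_distrib]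
      refine sum_congr rfl fun v hv => Nat.sub_add_cancel ?_
      exact ((mem_filter_univ v).1 hv).le
    have e3 := hb A
    rw [← e2, ← e1, Nat.cast_add, Nat.cast_mul, mul_comm] at e3
    linarith
  have h3card : 3 * #𝓔₁ ≤ k * n := by
    rw [← sum_degree_eq fun e he => h3 e (h𝓔₁ he)]
    refine (sum_le_card_nsmul _ _ k fun v _ => hdeg₁ v).trans_eq ?_
    simp [mul_comm]
  obtain ⟨a, ha⟩ : ∃ a, a = #𝓔₁ / k := ⟨_, rfl⟩
  have hak : k * a ≤ #𝓔₁ := ha ▸ Nat.mul_div_le _ _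
  have hak' : #𝓔₁ < k * a + k := ha ▸ Nat.lt_mul_div_succ _ hk0
  have h3a : 3 * a ≤ n := by
    refine Nat.le_of_mul_le_mul_left (c := k) ?_ hk0
    linarith
  -- Giving up `k` from the quotient ensures `k ≤ n - 3 * t`. If `a < k` then `t = 0`, and `hkn`
  -- suffices.
  obtain ⟨t, ht⟩ : ∃ t, t = a - k := ⟨_, rfl⟩
  have htle : k * t ≤ #𝓔₁ := (Nat.mul_le_mul_left k (by omega)).trans hak
  obtain ⟨𝓔₂, h𝓔₂, hcard₂⟩ := exists_subset_card_eq htle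
  refine ⟨t, n - 3 * t, 𝓔₂, h𝓔₂.trans h𝓔₁, by omega, by omega, fun v => ?_, hcard₂, ?_⟩
  · exact (card_le_card (filter_subset_filter _ h𝓔₂)).trans (hdeg₁ v)
  · have h1 : #𝓔 ≤ k * t + k + k ^ 2 + ∑ v, (#{e ∈ 𝓔 | v ∈ e} - k) := by
      have := Nat.mul_le_mul_left k (show a ≤ t + k by omega)
      have e : k * (t + k) = k * t + k ^ 2 := by ring
      omega
    have h2 : (#𝓔 : ℝ) ≤ k * t + k + k ^ 2 + (∑ v, (#{e ∈ 𝓔 | v ∈ e} - k) : ℕ) := by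
      exact_mod_cast h1
    have h3 : (#𝓔₂ : ℝ) = k * t := by rw [hcard₂, Nat.cast_mul]
    linarith

theorem mul_le_choose_three {κ n : ℕ} (h : 3 * κ + 4 ≤ n) : κ * n ≤ n.choose 3 := by
  obtain ⟨j, rfl⟩ : ∃ j, n = j + 3 := ⟨n - 3, by omega⟩
  have a1 := Nat.add_one_mul_choose_eq (j + 2) 2
  have a2 := Nat.add_one_mul_choose_eq (j + 1) 1
  rw [Nat.choose_one_right] at a2
  change (j + 3) * _ = (j + 3).choose 3 * 3 at a1
  change (j + 2) * _ = (j + 2).choose 2 * 2 at a2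
  have h1 : 2 * (3 * κ) ≤ (j + 2) * (j + 1) := Nat.mul_le_mul (by omega) (by omega)
  have h2 := Nat.mul_le_mul_left (j + 3) (show 3 * κ ≤ (j + 2).choose 2 by omega)
  rw [a1] at h2
  linarith

/-- Here `M` is κn, `D` and `kt` count the edges before and after truncation, `c` and `d` those of
them in `altEdges χ`, and `K` is the rounding loss. The regular extension has `3 * M - 2 * kt`
edges, close to `M` because `kt` is. -/
theorem overlap_numeric {ε M kt D c d K : ℝ} (hε : 0 < ε) (hε1 : ε ≤ 2 / 9) (hM : 0 ≤ M)
    (hK0 : 0 ≤ K) (hK : 3 * K ≤ ε / 4 * M) (hD : M - ε / 32 * M ≤ D)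
    (hD' : D ≤ kt + 3 * (ε / 32 * M) + K) (hc : M * (2 / 9 - ε / 4) - ε / 32 * M ≤ c)
    (hd : c + kt ≤ d + D) : (2 / 9 - ε) * (3 * M - 2 * kt) ≤ d := by
  have b7 : 3 * M - 2 * kt ≤ M * (1 + ε / 4) + 2 * K := by linarith
  have b8 := mul_le_mul_of_nonneg_left b7 (by linarith : 0 ≤ 2 / 9 - ε)
  have hx : 0 ≤ ε * M := mul_nonneg hε.le hM
  have hy : 0 ≤ ε * (ε * M) := mul_nonneg hε.le hx
  have hz : 0 ≤ ε * K := mul_nonneg hε.le hK0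
  nlinarith

/-- Sparse pseudorandom hypergraphs of bounded degree have large planar overlap. -/
theorem exists_bounded_degree_overlap {ε : ℝ} (hε : 0 < ε) (hε1 : ε ≤ 2 / 9) :
    ∃ k : ℕ, 0 < k ∧ ∀ N : ℕ, ∃ n ≥ N, ∃ (t L m : ℕ) (𝓔 : Finset (Finset (Fin n))),
      k ≤ L ∧ n = 3 * t + L ∧ (∀ e ∈ 𝓔, #e = 3) ∧ (∀ v, #{e ∈ 𝓔 | v ∈ e} ≤ k) ∧
      #𝓔 = k * t ∧ CoverAtLeast 𝓔 m ∧ (2 / 9 - ε) * (k * (t + L) : ℕ) ≤ m := by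
  have hη0 : 0 < ε / 32 := by positivity
  obtain ⟨R, hR⟩ := exists_nat_ge (24 / (ε / 4))
  have hR0 : (0 : ℝ) < R := (by positivity : 0 < 24 / (ε / 4)).trans_le hR
  -- Both `R` and `κ` depend on `ε` alone; `n` grows only through the block length `w`.
  obtain ⟨κ, hκ⟩ := exists_nat_ge ((log (3 * R + 4) + 2) / ((ε / 32) ^ 2 / 4))
  rw [div_le_iff₀ (by positivity)] at hκ
  have hκ0 : 0 < κ := by
    rcases Nat.eq_zero_or_pos κ with rfl | h
    · have : 0 ≤ log (3 * (R : ℝ) + 4) := log_nonneg (by linarith)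
      simp at hκ; linarith
    · exact h
  have hκ' : (1 : ℝ) ≤ κ := by exact_mod_cast hκ0
  obtain ⟨k, hk⟩ : ∃ k, k = 3 * κ := ⟨_, rfl⟩
  have hk' : (k : ℝ) = 3 * κ := by rw [hk]; push_cast; ring
  refine ⟨k, by omega, fun N => ?_⟩
  obtain ⟨w, hw⟩ := exists_nat_ge (max (N + k + 4 : ℝ)
    (max (40 / (ε / 4)) (3 * (k + k ^ 2) / (ε / 4))))
  have hw1 := (le_max_left _ _).trans hw
  have hw2 := ((le_max_left _ _).trans (le_max_right _ _)).trans hw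
  have hw3 := ((le_max_right _ _).trans (le_max_right _ _)).trans hw
  have hw1' : N + k + 4 ≤ w := by exact_mod_cast hw1
  clear hw
  obtain ⟨n, hn⟩ : ∃ n, n = R * w := ⟨_, rfl⟩
  have hR1 : 1 ≤ R := by exact_mod_cast hR0
  have hwn : w ≤ n := hn ▸ Nat.le_mul_of_pos_left w hR1
  have hwn' : (w : ℝ) ≤ n := by exact_mod_cast hwn
  have hn0 : 0 < n := by omega
  have hκn : κ * n ≤ n.choose 3 := mul_le_choose_three (by omega)
  obtain ⟨𝓔, h𝓔, ha, hb, hc⟩ := exists_pseudorandom_triples (n := n) (R := R) (κ := κ)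
    hη0.le (by linarith) (by linarith) hn0 hκn
  have hthree : ∀ e ∈ 𝓔, #e = 3 := fun e he => (mem_powersetCard.1 (h𝓔 he)).2
  obtain ⟨t, L, 𝓔', h𝓔', hL, hnt, hdeg, hcard, hloss⟩ := exists_truncation
    (δ := 3 * (ε / 32 * (κ * n))) (k := k) (by omega) (by omega) hthree fun A => by
      rw [hk', mul_assoc]; exact hb A
  refine ⟨n, by omega, t, L, ⌈(2 / 9 - ε) * (k * (t + L) : ℕ)⌉₊, 𝓔', hL, hnt,
    fun e he => hthree e (h𝓔' he), hdeg, hcard, fun f => ?_, Nat.le_ceil _⟩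
  refine exists_cover_of_generalPosition (fun g hg => ?_) f
  have hne : Nonempty (Fin n) := ⟨⟨0, hn0⟩⟩
  obtain ⟨χ, p, hp, hχ⟩ := hg.exists_altEdges_coloring (w := w) (R := R) (by omega)
    (by rw [Fintype.card_fin, hn])
  rw [Fintype.card_fin] at hχ
  refine ⟨p, 𝓔' ∩ altEdges χ, inter_subset_left, ?_, fun e he => hp e (mem_inter.1 he).2⟩
  rw [Nat.ceil_le]
  have b1 := le_card_altEdges_bound (n := n) (R := R) (w := w) (by positivity : 0 < ε / 4)
    (by linarith) hR (by rw [hn]; push_cast; ring) (hw2.trans hwn')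
  have hN : (0 : ℝ) < n.choose 3 := by
    exact_mod_cast (Nat.mul_pos hκ0 hn0).trans_le hκn
  have b2 : (κ * n : ℝ) * (2 / 9 - ε / 4) ≤ (κ * n : ℝ) / n.choose 3 * #(altEdges χ) := by
    rw [div_mul_eq_mul_div, le_div_iff₀ hN, mul_assoc]
    exact mul_le_mul_of_nonneg_left (b1.trans hχ) (by positivity)
  have b4 : (#(𝓔 ∩ altEdges χ) : ℝ) + #𝓔' ≤ #(𝓔' ∩ altEdges χ) + #𝓔 := by
    have e1 : 𝓔 ∩ altEdges χ ⊆ (𝓔' ∩ altEdges χ) ∪ (𝓔 \ 𝓔') := by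
      intro e he
      rw [mem_inter] at he
      by_cases h : e ∈ 𝓔'
      · exact mem_union_left _ (mem_inter.2 ⟨h, he.2⟩)
      · exact mem_union_right _ (mem_sdiff.2 ⟨he.1, h⟩)
    have e2 := (card_le_card e1).trans (card_union_le _ _)
    have e3 := card_sdiff_add_card_eq_card h𝓔'
    have : #(𝓔 ∩ altEdges χ) + #𝓔' ≤ #(𝓔' ∩ altEdges χ) + #𝓔 := by omega
    exact_mod_cast this
  have b6 : ((k * (t + L) : ℕ) : ℝ) = 3 * (κ * n) - 2 * #𝓔' := by
    rw [hcard, hnt]; push_cast; rw [hk']; ring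
  rw [b6]
  have hM : (n : ℝ) ≤ κ * n := le_mul_of_one_le_left (Nat.cast_nonneg n) hκ'
  refine overlap_numeric hε hε1 (by positivity) (by positivity : (0 : ℝ) ≤ k + k ^ 2) ?_ hc hloss
    (by linarith [ha χ]) b4
  rw [div_le_iff₀ (by positivity)] at hw3
  nlinarith

theorem exists_regular_overlap {ε : ℝ} (hε : 0 < ε) (hε1 : ε ≤ 2 / 9) :
    ∃ k : ℕ, 0 < k ∧ ∀ N : ℕ, ∃ ν ≥ N, ∃ (m : ℕ) (𝓕 : Finset (Finset (Fin ν))),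
      (∀ e ∈ 𝓕, #e = 3) ∧ (∀ v, #{e ∈ 𝓕 | v ∈ e} = k) ∧ CoverAtLeast 𝓕 m ∧
      (2 / 9 - ε) * #𝓕 ≤ m := by
  obtain ⟨k, hk, h⟩ := exists_bounded_degree_overlap hε hε1
  refine ⟨k, hk, fun N => ?_⟩
  obtain ⟨n, hn, t, L, m, 𝓔, hL, hntL, h3, hdeg, hcard, hcov, hm⟩ := h N
  obtain ⟨𝓕, hF3, hFdeg, hFcard, hF⟩ := exists_regular_extension hL hntL h3 hdeg hcard
  let W := Fin n ⊕ Fin L × Bool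
  let φ : W ≃ Fin (Fintype.card W) := Fintype.equivFin W
  let Φ : Finset W ↪ Finset (Fin (Fintype.card W)) :=
    ⟨fun e => e.map φ.toEmbedding, fun _ _ h => map_injective _ h⟩
  have hΦ : ∀ e, Φ e = e.map φ.toEmbedding := fun _ => rfl
  refine ⟨Fintype.card W, ?_, m, 𝓕.map Φ, ?_, ?_, ?_, ?_⟩
  · rw [Fintype.card_sum, Fintype.card_fin]; omega
  · intro e he
    obtain ⟨e, he', rfl⟩ := mem_map.1 he
    rw [hΦ, card_map, hF3 e he']
  · intro v
    rw [filter_map, card_map, ← hFdeg (φ.symm v)]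
    congr 1
    refine filter_congr fun e _ => ?_
    simp [hΦ]
  · intro f
    -- Only the original edges are used for covering; the added vertices may lie anywhere.
    obtain ⟨p, S, hS, hmS, hp⟩ := hcov fun v => f (φ (Sum.inl v))
    let Ψ : Finset (Fin n) ↪ Finset (Fin (Fintype.card W)) :=
      ⟨fun e => Φ (e.map Function.Embedding.inl), fun _ _ h =>
        map_injective _ (Φ.injective h)⟩
    refine ⟨p, S.map Ψ, fun e he => ?_, by rwa [card_map], fun e he => ?_⟩
    · obtain ⟨e, he', rfl⟩ := mem_map.1 he
      exact mem_map_of_mem Φ (hF e (hS he'))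
    · obtain ⟨e, he', rfl⟩ := mem_map.1 he
      have e1 : f '' (Ψ e : Set (Fin (Fintype.card W))) =
          (fun v => f (φ (Sum.inl v))) '' e := by
        change f '' (((e.map Function.Embedding.inl).map φ.toEmbedding : Finset _) : Set _) = _
        rw [coe_map, coe_map, Set.image_image, Set.image_image]
        rfl
      rw [e1]
      exact hp e he'
  · rw [card_map, hFcard]; exact hm

end RegularOverlap

/-! ### Second moment bound for random colourings -/

section RandomColoring

open Finset

variable {V C : Type*} [DecidableEq V]

/-- Functions of a random colouring that depend on disjoint sets of vertices are independent. -/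
theorem card_mul_sum_mul_eq [Fintype V] [Fintype C] (e : Finset V) {h h' : (V → C) → ℝ}
    (hh : ∀ c d, (∀ v ∈ e, c v = d v) → h c = h d)
    (hh' : ∀ c d, (∀ v ∉ e, c v = d v) → h' c = h' d) :
    (Fintype.card (V → C) : ℝ) * ∑ c, h c * h' c = (∑ c, h c) * ∑ c, h' c := by
  -- Exchanging two colourings outside `e` is a bijection on pairs. It turns the sum of `h c * h' d`
  -- into that of `h c * h' c`.
  let σ : (V → C) × (V → C) → (V → C) × (V → C) := fun x =>
    (e.piecewise x.1 x.2, e.piecewise x.2 x.1)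
  have hσ : Function.Involutive σ := by
    rintro ⟨c, d⟩
    refine Prod.ext ?_ ?_ <;> funext v <;> by_cases hv : v ∈ e <;> simp [σ, hv]
  rw [sum_mul_sum, ← sum_product', univ_product_univ, ← Equiv.sum_comp (hσ.toPerm σ)]
  have e1 : ∀ x : (V → C) × (V → C), h (hσ.toPerm σ x).1 * h' (hσ.toPerm σ x).2 =
      h x.1 * h' x.1 := by
    rintro ⟨c, d⟩
    change h (e.piecewise c d) * h' (e.piecewise d c) = h c * h' c
    rw [hh (e.piecewise c d) c fun v hv => by simp [hv],
      hh' (e.piecewise d c) c fun v hv => by simp [hv]]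
  rw [sum_congr rfl fun x _ => e1 x, ← univ_product_univ,
    sum_product' univ univ fun c _ => h c * h' c]
  simp [mul_sum]

variable {Q : Type*} {𝓔 : Finset (Finset V)} {k : ℕ}

theorem card_meeting_pairs_le (h3 : ∀ e ∈ 𝓔, #e = 3) (hk : ∀ v, #{e ∈ 𝓔 | v ∈ e} ≤ k) :
    #{x ∈ 𝓔 ×ˢ 𝓔 | ¬ Disjoint x.1 x.2} ≤ 3 * k * #𝓔 := by
  have h1 : ∀ e ∈ 𝓔, #{e' ∈ 𝓔 | ¬ Disjoint e e'} ≤ 3 * k := fun e he => by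
    calc #{e' ∈ 𝓔 | ¬ Disjoint e e'} ≤ #(e.biUnion fun v => {e' ∈ 𝓔 | v ∈ e'}) := by
          refine card_le_card fun e' he' => ?_
          rw [mem_filter, not_disjoint_iff] at he'
          obtain ⟨h, v, hv, hv'⟩ := he'
          exact mem_biUnion.2 ⟨v, hv, mem_filter.2 ⟨h, hv'⟩⟩
      _ ≤ #e * k := card_biUnion_le_card_mul _ _ _ fun v _ => hk v
      _ = 3 * k := by rw [h3 e he]
  calc #{x ∈ 𝓔 ×ˢ 𝓔 | ¬ Disjoint x.1 x.2}
      = ∑ e ∈ 𝓔, #{e' ∈ 𝓔 | ¬ Disjoint e e'} := by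
        rw [card_filter, sum_product]
        simp only [card_filter]
    _ ≤ 3 * k * #𝓔 := by
        rw [mul_comm, ← smul_eq_mul]; exact sum_le_card_nsmul _ _ _ h1

/-- A variance bound: by independence disjoint edges contribute nothing, and bounded degree leaves
at most `3 * k * #𝓔` pairs that meet. -/
theorem sum_sq_le [Fintype V] [Fintype C] [Nonempty C] (h3 : ∀ e ∈ 𝓔, #e = 3)
    (hk : ∀ v, #{e ∈ 𝓔 | v ∈ e} ≤ k) {a : Finset V → (V → C) → ℝ} (ha : ∀ e ∈ 𝓔, ∀ c, |a e c| ≤ 1)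
    (hdep : ∀ e ∈ 𝓔, ∀ c d, (∀ v ∈ e, c v = d v) → a e c = a e d)
    (hzero : ∀ e ∈ 𝓔, ∑ c, a e c = 0) :
    ∑ c, (∑ e ∈ 𝓔, a e c) ^ 2 ≤ Fintype.card (V → C) * (3 * k * #𝓔 : ℕ) := by
  have hcard : (0 : ℝ) < Fintype.card (V → C) := by exact_mod_cast Fintype.card_pos
  have h1 : ∀ x ∈ 𝓔 ×ˢ 𝓔, ∑ c, a x.1 c * a x.2 c ≤
      if ¬ Disjoint x.1 x.2 then (Fintype.card (V → C) : ℝ) else 0 := by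
    rintro ⟨e, e'⟩ hx
    rw [mem_product] at hx
    by_cases hd : Disjoint e e'
    · rw [if_neg (not_not.2 hd)]
      have := card_mul_sum_mul_eq e (hdep e hx.1) fun c d hcd => hdep e' hx.2 c d fun v hv =>
        hcd v (disjoint_right.1 hd hv)
      rw [hzero e hx.1, zero_mul] at this
      exact ((mul_eq_zero.1 this).resolve_left hcard.ne').le
    · rw [if_pos hd]
      have hle : ∀ c ∈ (univ : Finset (V → C)), a e c * a e' c ≤ 1 := fun c _ => by
        refine (le_abs_self _).trans ?_
        rw [abs_mul]
        exact mul_le_one₀ (ha e hx.1 c) (abs_nonneg _) (ha e' hx.2 c)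
      simpa only [card_univ, nsmul_eq_mul, mul_one] using sum_le_card_nsmul _ _ _ hle
  calc ∑ c, (∑ e ∈ 𝓔, a e c) ^ 2 = ∑ x ∈ 𝓔 ×ˢ 𝓔, ∑ c, a x.1 c * a x.2 c := by
        rw [sum_comm]
        refine sum_congr rfl fun c _ => ?_
        rw [sq, sum_mul_sum, ← sum_product']
    _ ≤ ∑ x ∈ 𝓔 ×ˢ 𝓔, if ¬ Disjoint x.1 x.2 then (Fintype.card (V → C) : ℝ) else 0 :=
        sum_le_sum h1
    _ = #{x ∈ 𝓔 ×ˢ 𝓔 | ¬ Disjoint x.1 x.2} * (Fintype.card (V → C) : ℝ) := by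
        rw [← sum_filter, sum_const, nsmul_eq_mul]
    _ ≤ _ := by
        rw [mul_comm]
        exact mul_le_mul_of_nonneg_left (Nat.cast_le.2 (card_meeting_pairs_le h3 hk)) hcard.le

/-- Some colouring is simultaneously close to the expectation for all events `q ∈ Q` on edges. -/
theorem exists_coloring_close [Fintype V] [Fintype C] [Nonempty C] [Fintype Q]
    (h3 : ∀ e ∈ 𝓔, #e = 3) (hk : ∀ v, #{e ∈ 𝓔 | v ∈ e} ≤ k) (I : Q → Finset V → (V → C) → Prop)
    [∀ q e c, Decidable (I q e c)]
    (hdep : ∀ q, ∀ e ∈ 𝓔, ∀ c d, (∀ v ∈ e, c v = d v) → I q e c → I q e d) {P : ℝ}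
    (hP : ∀ q, ∀ e ∈ 𝓔, (#{c | I q e c} : ℝ) ≤ P * Fintype.card (V → C)) {δ : ℝ} (hδ : 0 ≤ δ)
    (hlarge : (Fintype.card Q * (3 * k * #𝓔 : ℕ) : ℝ) < (δ * #𝓔) ^ 2) :
    ∃ c : V → C, ∀ q, (#{e ∈ 𝓔 | I q e c} : ℝ) < (P + δ) * #𝓔 := by
  have hcard : (0 : ℝ) < Fintype.card (V → C) := by exact_mod_cast Fintype.card_pos
  set M : ℝ := ((Fintype.card (V → C) : ℕ) : ℝ) with hM
  set ρ : Q → Finset V → ℝ := fun q e => #{c | I q e c} / M with hρ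
  have hρ0 : ∀ q e, 0 ≤ ρ q e := fun q e => by positivity
  have hρ1 : ∀ q e, ρ q e ≤ 1 := fun q e => by
    rw [hρ, div_le_one hcard, hM]; exact_mod_cast card_le_univ _
  set a : Q → Finset V → (V → C) → ℝ := fun q e c => (if I q e c then 1 else 0) - ρ q e with ha
  have hsq : ∀ q, ∑ c, (∑ e ∈ 𝓔, a q e c) ^ 2 ≤ M * (3 * k * #𝓔 : ℕ) := fun q => by
    refine sum_sq_le h3 hk (fun e _ c => ?_) (fun e he c d hcd => ?_) fun e _ => ?_
    · simp only [ha]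
      rw [abs_le]
      have := hρ0 q e
      have := hρ1 q e
      split_ifs <;> constructor <;> linarith
    · simp only [ha]
      congr 1
      exact if_congr ⟨hdep q e he c d hcd, hdep q e he d c fun v hv => (hcd v hv).symm⟩ rfl rfl
    · simp only [ha, sum_sub_distrib, sum_boole, sum_const, card_univ, nsmul_eq_mul, ← hM, hρ]
      rw [mul_div_cancel₀ _ hcard.ne', sub_self]
  have htot : ∑ c, ∑ q, (∑ e ∈ 𝓔, a q e c) ^ 2 ≤
      ∑ _c : V → C, (Fintype.card Q * (3 * k * #𝓔 : ℕ) : ℝ) := by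
    rw [sum_comm, sum_const, card_univ, nsmul_eq_mul]
    refine (sum_le_card_nsmul _ _ _ fun q _ => hsq q).trans_eq ?_
    rw [card_univ, nsmul_eq_mul, ← hM]; ring
  -- Summing the squared deviations over `Q` before averaging makes a single colouring serve every
  -- event.
  obtain ⟨c, -, hc⟩ := exists_le_of_sum_le univ_nonempty htot
  refine ⟨c, fun q => ?_⟩
  have h1 : (∑ e ∈ 𝓔, a q e c) ^ 2 < (δ * #𝓔) ^ 2 :=
    ((single_le_sum (f := fun q => (∑ e ∈ 𝓔, a q e c) ^ 2) (fun q _ => sq_nonneg _)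
      (mem_univ q)).trans hc).trans_lt hlarge
  have h2 := lt_of_pow_lt_pow_left₀ 2 (by positivity) h1
  simp only [ha, sum_sub_distrib, sum_boole] at h2
  have h4 : ∑ e ∈ 𝓔, ρ q e ≤ #𝓔 • P := sum_le_card_nsmul _ _ _ fun e he => by
    rw [hρ, div_le_iff₀ hcard]; exact hP q e he
  rw [nsmul_eq_mul] at h4
  linarith

end RandomColoring

/-! ### Counting the colour triples of the stretched diagonal -/

section StretchedDiagonal

open Finset

/-- The triples of colours whose triangles may contain a point of horizontal index `s` and
vertical index `t`. -/
def DiagonalTriple (s t i j k : ℕ) : Prop :=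
  i < j ∧ j < k ∧ (k = t ∨ k = t + 1 ∨ i = s ∨ (i < s ∧ s ≤ j ∧ j ≤ t + 1 ∧ t + 1 < k))

theorem mul_mul_le_cube (a b c : ℕ) : 27 * (a * b * c) ≤ (a + b + c) ^ 3 := by
  have h : (27 * (a * b * c) : ℝ) ≤ (a + b + c) ^ 3 := by
    have ha : (0 : ℝ) ≤ a := Nat.cast_nonneg a
    have hb : (0 : ℝ) ≤ b := Nat.cast_nonneg b
    have hc : (0 : ℝ) ≤ c := Nat.cast_nonneg c
    nlinarith [mul_nonneg ha (sq_nonneg (b - c : ℝ)), mul_nonneg hb (sq_nonneg (a - c : ℝ)),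
      mul_nonneg hc (sq_nonneg (a - b : ℝ)), mul_nonneg ha (sq_nonneg (a - b : ℝ)),
      mul_nonneg ha (sq_nonneg (a - c : ℝ)), mul_nonneg hb (sq_nonneg (b - a : ℝ)),
      mul_nonneg hb (sq_nonneg (b - c : ℝ)), mul_nonneg hc (sq_nonneg (c - a : ℝ)),
      mul_nonneg hc (sq_nonneg (c - b : ℝ))]
  exact_mod_cast h

-- The generic case is a box with sides s, t + 2 - s and m - (t + 2), which sum to m, so the
-- inequality of arithmetic and geometric means applies. The three conditions k = t, k = t + 1 and i
-- = s contribute at most `m ^ 2` each.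
open Classical in
theorem card_diagonalTriple_le (m s t : ℕ) :
    27 * #{a : Fin m × Fin m × Fin m | DiagonalTriple s t a.1 a.2.1 a.2.2} ≤
      81 * m ^ 2 + m ^ 3 := by
  have hone : ∀ x : ℕ, #{i : Fin m | (i : ℕ) = x} ≤ 1 := fun x =>
    card_le_one.2 fun i hi j hj => Fin.ext
      (((mem_filter_univ i).1 hi).trans ((mem_filter_univ j).1 hj).symm)
  have hIco : ∀ a b : ℕ, #{i : Fin m | a ≤ (i : ℕ) ∧ (i : ℕ) < b} ≤ b - a := fun a b => by
    rw [← Nat.card_Ico]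
    exact card_le_card_of_injOn (fun i => (i : ℕ)) (fun i hi => by simpa using hi)
      fun i _ j _ h => Fin.ext h
  set U : Finset (Fin m) := univ
  set T0 : ℕ → Finset (Fin m × Fin m × Fin m) := fun x =>
    U ×ˢ U ×ˢ ({i | (i : ℕ) = x} : Finset (Fin m))
  set T1 : Finset (Fin m × Fin m × Fin m) := ({i | (i : ℕ) = s} : Finset (Fin m)) ×ˢ U ×ˢ U
  set T2 : Finset (Fin m × Fin m × Fin m) := ({i | 0 ≤ (i : ℕ) ∧ (i : ℕ) < s} : Finset (Fin m)) ×ˢ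
    ({i | s ≤ (i : ℕ) ∧ (i : ℕ) < t + 2} : Finset (Fin m)) ×ˢ
    ({i | t + 2 ≤ (i : ℕ) ∧ (i : ℕ) < m} : Finset (Fin m))
  have hU : #U = m := by simp [U]
  have c0 : ∀ x, #(T0 x) ≤ m ^ 2 := fun x => by
    simp only [T0, card_product, hU]
    calc _ ≤ m * (m * 1) := by gcongr; exact hone x
      _ = m ^ 2 := by ring
  have c1 : #T1 ≤ m ^ 2 := by
    simp only [T1, card_product, hU]
    calc _ ≤ 1 * (m * m) := by gcongr; exact hone s
      _ = m ^ 2 := by ring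
  have c2 : 27 * #T2 ≤ m ^ 3 := by
    simp only [T2, card_product]
    calc _ ≤ 27 * ((s - 0) * ((t + 2 - s) * (m - (t + 2)))) := by
          gcongr <;> exact hIco _ _
      _ = 27 * (s * (t + 2 - s) * (m - (t + 2))) := by rw [Nat.sub_zero, mul_assoc]
      _ ≤ m ^ 3 := by
          by_cases h : s ≤ t + 2 ∧ t + 2 ≤ m
          · refine (mul_mul_le_cube _ _ _).trans_eq ?_
            congr 1; omega
          · rcases not_and_or.1 h with h | h
            · rw [Nat.sub_eq_zero_of_le (by omega : t + 2 ≤ s)]; simp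
            · rw [Nat.sub_eq_zero_of_le (by omega : m ≤ t + 2)]; simp
  have hsub : ({a : Fin m × Fin m × Fin m | DiagonalTriple s t a.1 a.2.1 a.2.2} : Finset _) ⊆
      (T0 t ∪ T0 (t + 1)) ∪ (T1 ∪ T2) := by
    rintro ⟨i, j, k⟩ h
    replace h := (mem_filter_univ _).1 h
    simp only [T0, T1, T2, U, mem_union, mem_product, mem_univ, mem_filter_univ, true_and, and_true]
    obtain ⟨-, -, h | h | h | h⟩ := h
    · exact Or.inl (Or.inl h)
    · exact Or.inl (Or.inr h)
    · exact Or.inr (Or.inl h)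
    · exact Or.inr (Or.inr ⟨⟨Nat.zero_le _, h.1⟩, ⟨h.2.1, Nat.lt_succ_of_le h.2.2.1⟩, h.2.2.2, k.2⟩)
  have e1 := card_le_card hsub
  have e2 := card_union_le (T0 t ∪ T0 (t + 1)) (T1 ∪ T2)
  have e3 := card_union_le (T0 t) (T0 (t + 1))
  have e4 := card_union_le T1 T2
  have e5 := c0 t
  have e6 := c0 (t + 1)
  omega

/-- The colours of three distinct vertices are jointly uniform. The injection exchanges an arbitrary
triple with the colours at `x`, `y`, `z`. -/
theorem card_cube_mul_card_filter_le {V C : Type*} [Fintype V] [DecidableEq V] [Fintype C]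
    {x y z : V} (hxy : x ≠ y) (hxz : x ≠ z) (hyz : y ≠ z) (S : Finset (C × C × C))
    [DecidablePred fun c : V → C => (c x, c y, c z) ∈ S] :
    Fintype.card C ^ 3 * #{c : V → C | (c x, c y, c z) ∈ S} ≤ #S * Fintype.card (V → C) := by
  have h1 : Fintype.card C ^ 3 = #(univ : Finset (C × C × C)) := by
    rw [card_univ, Fintype.card_prod, Fintype.card_prod]; ring
  rw [h1, ← card_univ (α := V → C), ← card_product, ← card_product]
  refine card_le_card_of_injOn (fun a => ((a.2 x, a.2 y, a.2 z), fun v => if v = x then a.1.1 else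
    if v = y then a.1.2.1 else if v = z then a.1.2.2 else a.2 v)) ?_ ?_
  · rintro ⟨b, c⟩ h
    rw [mem_coe, mem_product, mem_filter] at h
    rw [mem_coe, mem_product]
    exact ⟨h.2.2, mem_univ _⟩
  · rintro ⟨⟨b1, b2, b3⟩, c⟩ - ⟨⟨b1', b2', b3'⟩, c'⟩ - h
    simp only [Prod.mk.injEq] at h
    obtain ⟨⟨e1, e2, e3⟩, e4⟩ := h
    have f1 := congrFun e4 x
    have f2 := congrFun e4 y
    have f3 := congrFun e4 z
    simp only [if_true, hxy.symm, hxz.symm, hyz.symm, if_false] at f1 f2 f3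
    refine Prod.ext (Prod.ext f1 (Prod.ext f2 f3)) (funext fun v => ?_)
    by_cases h1 : v = x
    · rw [h1]; exact e1
    by_cases h2 : v = y
    · rw [h2]; exact e2
    by_cases h3 : v = z
    · rw [h3]; exact e3
    simpa [h1, h2, h3] using congrFun e4 v

/-- The edge `e` is not rainbow, or its triangle may contain a point of index `(s, t)`. -/
def DiagonalEdge {V : Type*} [DecidableEq V] {m : ℕ} (s t : ℕ) (e : Finset V) (c : V → Fin m) :
    Prop :=
  (∃ x ∈ e, ∃ y ∈ e, x ≠ y ∧ c x = c y) ∨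
    ∃ x ∈ e, ∃ y ∈ e, ∃ z ∈ e, DiagonalTriple s t (c x) (c y) (c z)

theorem DiagonalEdge.congr {V : Type*} [DecidableEq V] {m s t : ℕ} {e : Finset V} {c d : V → Fin m}
    (h : ∀ v ∈ e, c v = d v) (hc : DiagonalEdge s t e c) : DiagonalEdge s t e d := by
  rcases hc with ⟨x, hx, y, hy, hxy, hc⟩ | ⟨x, hx, y, hy, z, hz, hc⟩
  · exact Or.inl ⟨x, hx, y, hy, hxy, by rw [← h x hx, ← h y hy, hc]⟩
  · exact Or.inr ⟨x, hx, y, hy, z, hz, by rwa [← h x hx, ← h y hy, ← h z hz]⟩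

-- The six orders of the vertices give 6/27 = 2/9. The error is 6 · 3 for the degenerate triples
-- plus 3 for the coincidences of two colours, each of order 1/m.
open Classical in
theorem card_diagonalEdge_le {V : Type*} [Fintype V] [DecidableEq V] {m : ℕ} (hm : 0 < m)
    (s t : ℕ) {e : Finset V} (he : #e = 3) :
    (#{c : V → Fin m | DiagonalEdge s t e c} : ℝ) ≤
      (2 / 9 + 21 / m) * Fintype.card (V → Fin m) := by
  set M := Fintype.card (V → Fin m) with hM
  set S : Finset (Fin m × Fin m × Fin m) := {a | DiagonalTriple s t a.1 a.2.1 a.2.2} with hS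
  set D : Finset (Fin m × Fin m × Fin m) := {a | a.1 = a.2.1} with hD
  have hDc : #D ≤ m ^ 2 := by
    calc #D ≤ #(univ : Finset (Fin m × Fin m)) := by
          refine card_le_card_of_injOn (fun a => a.2) (fun _ _ => mem_univ _) ?_
          rintro ⟨i, j⟩ h ⟨i', j'⟩ h' heq
          simp only [hD, mem_coe, mem_filter_univ] at h h' heq
          subst heq
          rw [h, h']
      _ = m ^ 2 := by simp [sq]
  set F : Finset (Fin m × Fin m × Fin m) → V → V → V → Finset (V → Fin m) := fun B x y z =>
    {c | (c x, c y, c z) ∈ B} with hF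
  obtain ⟨x, y, z, hxy, hxz, hyz, rfl⟩ := card_eq_three.1 he
  have hFle : ∀ B x y z, x ≠ y → x ≠ z → y ≠ z → m ^ 3 * #(F B x y z) ≤ #B * M :=
    fun B x y z h1 h2 h3 => by
      have := card_cube_mul_card_filter_le (C := Fin m) h1 h2 h3 B
      rwa [Fintype.card_fin] at this
  have hsub : ({c | DiagonalEdge s t {x, y, z} c} : Finset (V → Fin m)) ⊆
      ((F D x y z ∪ F D x z y) ∪ F D y z x) ∪
      ((F S x y z ∪ F S x z y) ∪ ((F S y x z ∪ F S y z x) ∪ (F S z x y ∪ F S z y x))) := by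
    intro c hc
    rw [mem_filter_univ] at hc
    simp only [hF, hD, hS, mem_union, mem_filter_univ]
    rcases hc with ⟨a, ha, b, hb, hab, h⟩ | ⟨a, ha, b, hb, d, hd, h⟩
    · left
      simp only [mem_insert, mem_singleton] at ha hb
      rcases ha with rfl | rfl | rfl <;> rcases hb with rfl | rfl | rfl <;>
        first | (exact absurd rfl hab) | simp [h]
    · right
      have n1 : a ≠ b := by rintro rfl; exact lt_irrefl _ h.1
      have n2 : b ≠ d := by rintro rfl; exact lt_irrefl _ h.2.1
      have n3 : a ≠ d := by rintro rfl; exact lt_asymm h.1 h.2.1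
      simp only [mem_insert, mem_singleton] at ha hb hd
      rcases ha with rfl | rfl | rfl <;> rcases hb with rfl | rfl | rfl <;>
        rcases hd with rfl | rfl | rfl <;>
        first | (exact absurd rfl n1) | (exact absurd rfl n2) | (exact absurd rfl n3) | simp [h]
  have hcard : #{c : V → Fin m | DiagonalEdge s t {x, y, z} c} ≤
      ((#(F D x y z) + #(F D x z y)) + #(F D y z x)) +
      ((#(F S x y z) + #(F S x z y)) + ((#(F S y x z) + #(F S y z x)) +
        (#(F S z x y) + #(F S z y x)))) := by
    refine (card_le_card hsub).trans ((card_union_le _ _).trans ?_)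
    gcongr
    · exact (card_union_le _ _).trans (Nat.add_le_add_right (card_union_le _ _) _)
    · refine (card_union_le _ _).trans (Nat.add_le_add (card_union_le _ _) ?_)
      exact (card_union_le _ _).trans (Nat.add_le_add (card_union_le _ _) (card_union_le _ _))
  have hSc := card_diagonalTriple_le m s t
  have key : 27 * (m ^ 3 * #{c : V → Fin m | DiagonalEdge s t {x, y, z} c}) ≤
      (567 * m ^ 2 + 6 * m ^ 3) * M := by
    have k0 := Nat.mul_le_mul_left (m ^ 3) hcard
    have k1 := hFle D x y z hxy hxz hyz
    have k2 := hFle D x z y hxz hxy hyz.symm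
    have k3 := hFle D y z x hyz hxy.symm hxz.symm
    have k4 := hFle S x y z hxy hxz hyz
    have k5 := hFle S x z y hxz hxy hyz.symm
    have k6 := hFle S y x z hxy.symm hyz hxz
    have k7 := hFle S y z x hyz hxy.symm hxz.symm
    have k8 := hFle S z x y hxz.symm hyz.symm hxy
    have k9 := hFle S z y x hyz.symm hxz.symm hxy.symm
    have k10 := Nat.mul_le_mul_right M hDc
    have k11 := Nat.mul_le_mul_right M hSc
    simp only [mul_add] at k0
    rw [← hS] at k11
    linarith
  have hm' : (0 : ℝ) < m := by exact_mod_cast hm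
  have key' : 27 * ((m : ℝ) ^ 3 * #{c : V → Fin m | DiagonalEdge s t {x, y, z} c}) ≤
      (567 * m ^ 2 + 6 * m ^ 3) * M := by exact_mod_cast key
  have e : (2 / 9 + 21 / m) * (M : ℝ) = (567 * m ^ 2 + 6 * m ^ 3) * M / (27 * m ^ 3) := by
    field_simp
    ring
  rw [e, le_div_iff₀ (by positivity)]
  linarith

end StretchedDiagonal

/-! ### Geometry of the stretched diagonal and the upper bound -/

section DiagonalPlacement

open Finset

theorem weighted_average_le {w₁ w₂ w₃ u v w b : ℝ} (h₁ : 0 ≤ w₁) (h₂ : 0 ≤ w₂) (h₃ : 0 ≤ w₃)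
    (hw : w₁ + w₂ + w₃ = 1) (hu : u ≤ b) (hv : v ≤ b) (hz : w ≤ b) :
    w₁ * u + w₂ * v + w₃ * w ≤ b := by
  have eb : w₁ * b + w₂ * b + w₃ * b = b := by rw [← add_mul, ← add_mul, hw, one_mul]
  linarith [mul_le_mul_of_nonneg_left hu h₁, mul_le_mul_of_nonneg_left hv h₂,
    mul_le_mul_of_nonneg_left hz h₃]

theorem le_weighted_average {w₁ w₂ w₃ u v w b : ℝ} (h₁ : 0 ≤ w₁) (h₂ : 0 ≤ w₂) (h₃ : 0 ≤ w₃)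
    (hw : w₁ + w₂ + w₃ = 1) (hu : b ≤ u) (hv : b ≤ v) (hz : b ≤ w) :
    b ≤ w₁ * u + w₂ * v + w₃ * w := by
  have eb : w₁ * b + w₂ * b + w₃ * b = b := by rw [← add_mul, ← add_mul, hw, one_mul]
  linarith [mul_le_mul_of_nonneg_left hu h₁, mul_le_mul_of_nonneg_left hv h₂,
    mul_le_mul_of_nonneg_left hz h₃]

/-- Heights grow so fast that colours of index at least t + 2 can carry only weight below 1/(2m).
This moves the point horizontally by less than 1/2, too little to reach s from a smaller colour. -/
theorem diagonalTriple_of_weights {m s t i j k : ℕ} (hij : i < j) (hjk : j < k) (hkm : k < m)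
    {X₁ X₂ X₃ w₁ w₂ w₃ px py : ℝ} (hX₁ : (i : ℝ) ≤ X₁) (hX₁' : X₁ ≤ i + 1 / 2) (hX₂ : (j : ℝ) ≤ X₂)
    (hX₂' : X₂ ≤ j + 1 / 2) (hX₃ : (k : ℝ) ≤ X₃) (hX₃' : X₃ ≤ k + 1 / 2) (h₁ : 0 ≤ w₁)
    (h₂ : 0 ≤ w₂) (h₃ : 0 ≤ w₃) (hw : w₁ + w₂ + w₃ = 1)
    (hpx : px = w₁ * X₁ + w₂ * X₂ + w₃ * X₃)
    (hpy : py = w₁ * (2 * m) ^ i + w₂ * (2 * m) ^ j + w₃ * (2 * m) ^ k)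
    (hs : (s : ℝ) ≤ px) (hs' : px < s + 1) (ht : (2 * (m : ℝ)) ^ t ≤ py)
    (ht' : py < (2 * (m : ℝ)) ^ (t + 1)) : DiagonalTriple s t i j k := by
  have hm : (1 : ℝ) ≤ m := by exact_mod_cast (Nat.zero_le k).trans_lt hkm
  have hkm' : (k : ℝ) + 1 ≤ m := by exact_mod_cast hkm
  have hij' : (i : ℝ) + 1 ≤ j := by exact_mod_cast hij
  have hjk' : (j : ℝ) + 1 ≤ k := by exact_mod_cast hjk
  have hi0 : (0 : ℝ) ≤ i := Nat.cast_nonneg i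
  set K : ℝ := 2 * m with hK
  have hK1 : 1 < K := by linarith
  have hKpos : ∀ a : ℕ, 0 < K ^ a := fun a => by positivity
  have hKmono : ∀ {a b : ℕ}, a ≤ b → K ^ a ≤ K ^ b := fun h => pow_le_pow_right₀ hK1.le h
  have hpxi : (i : ℝ) ≤ px := by
    rw [hpx]
    exact le_weighted_average h₁ h₂ h₃ hw hX₁ (by linarith) (by linarith)
  have his : i ≤ s := by
    have : (i : ℝ) < s + 1 := hpxi.trans_lt hs'
    exact Nat.lt_succ_iff.1 (by exact_mod_cast this)
  have hpyk : py ≤ K ^ k := by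
    rw [hpy]
    exact weighted_average_le h₁ h₂ h₃ hw (hKmono (hij.trans hjk).le) (hKmono hjk.le) le_rfl
  have htk : t ≤ k := (pow_le_pow_iff_right₀ hK1).1 (ht.trans hpyk)
  refine ⟨hij, hjk, ?_⟩
  by_contra hcon
  push Not at hcon
  obtain ⟨c1, c2, c3, c4⟩ := hcon
  have hs1 : i < s := lt_of_le_of_ne his c3
  have hs1' : (i : ℝ) + 1 ≤ s := by exact_mod_cast hs1
  have hk2 : t + 2 ≤ k := by omega
  -- Weight at least 1/(2m) at height at least `K ^ (t + 2)` already lifts the point to `K ^ (t +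
  -- 1)`, since K = 2m.
  have big : ∀ {a : ℕ} {lam : ℝ}, t + 2 ≤ a → 1 / 2 ≤ lam * m → lam * K ^ a ≤ py → False := by
    intro a lam ha hl hle
    have e1 : K ^ (t + 2) ≤ K ^ a := hKmono ha
    have e2 : K ^ (t + 1) ≤ lam * K ^ (t + 2) := by
      have e3 : lam * K ^ (t + 2) = (2 * (lam * m)) * K ^ (t + 1) := by
        rw [pow_succ _ (t + 1), hK]; ring
      rw [e3]
      exact le_mul_of_one_le_left (hKpos _).le (by linarith)
    have hl0 : 0 ≤ lam := by
      by_contra! h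
      linarith [mul_neg_of_neg_of_pos h (hm.trans_lt' one_pos)]
    linarith [mul_le_mul_of_nonneg_left e1 hl0]
  have hsj : s ≤ j := by
    by_contra! h
    have h' : (j : ℝ) + 1 ≤ s := by exact_mod_cast h
    refine big (lam := w₃) hk2 ?_ ?_
    · have e : px ≤ (j + 1 / 2) + w₃ * m := by
        have := weighted_average_le (u := X₁) (w := X₃ - m) (b := j + 1 / 2) h₁ h₂ h₃ hw
          (by linarith) hX₂' (by linarith)
        rw [hpx]
        linarith
      linarith
    · rw [hpy]
      have := mul_nonneg h₁ (hKpos i).le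
      have := mul_nonneg h₂ (hKpos j).le
      linarith
  have hjt : j ≤ t + 1 := by
    by_contra! h
    refine big (a := j) (lam := w₂ + w₃) (by omega) ?_ ?_
    · have e : px ≤ (i + 1 / 2) + (w₂ + w₃) * m := by
        have := weighted_average_le (v := X₂ - m) (w := X₃ - m) h₁ h₂ h₃ hw hX₁'
          (by linarith) (by linarith)
        rw [hpx]
        linarith
      linarith
    · rw [hpy]
      have := mul_nonneg h₁ (hKpos i).le
      have := mul_le_mul_of_nonneg_left (hKmono hjk.le) h₃
      linarith
  have := c4 hs1 hsj hjt
  omega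

theorem exists_weights_of_mem_convexHull_triple {E : Type*} [AddCommGroup E] [Module ℝ E]
    {x y z p : E} (h : p ∈ convexHull ℝ {x, y, z}) :
    ∃ w₁ w₂ w₃ : ℝ, 0 ≤ w₁ ∧ 0 ≤ w₂ ∧ 0 ≤ w₃ ∧ w₁ + w₂ + w₃ = 1 ∧
      p = w₁ • x + w₂ • y + w₃ • z := by
  rw [convexHull_insert (by simp), convexHull_pair, mem_convexJoin] at h
  obtain ⟨_, rfl, q, ⟨a, b, ha, hb, hab, rfl⟩, ⟨c, d, hc, hd, hcd, rfl⟩⟩ := h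
  refine ⟨c, d * a, d * b, hc, mul_nonneg hd ha, mul_nonneg hd hb, ?_, ?_⟩
  · rw [add_assoc, ← mul_add, hab, mul_one, hcd]
  · rw [smul_add, smul_smul, smul_smul, add_assoc]

/-- The vertices of colour `i` are placed near the point `(i, (2 * m) ^ i)`. -/
noncomputable def diagonalPlacement {n m : ℕ} (c : Fin n → Fin m) (v : Fin n) :
    EuclideanSpace ℝ (Fin 2) :=
  !₂[((c v : ℕ) : ℝ) + (v : ℕ) / (2 * n), (2 * (m : ℝ)) ^ (c v : ℕ)]

variable {n m : ℕ} {c : Fin n → Fin m}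

/-- The offset separates vertices of equal colour. Staying below 1/2, it leaves a horizontal gap of
more than 1/2 between consecutive colours. -/
theorem diagonalPlacement_offset (v : Fin n) :
    0 ≤ ((v : ℕ) : ℝ) / (2 * n) ∧ ((v : ℕ) : ℝ) / (2 * n) < 1 / 2 := by
  have hv : ((v : ℕ) : ℝ) < n := by exact_mod_cast v.2
  have hn : (0 : ℝ) < n := (Nat.cast_nonneg _).trans_lt hv
  refine ⟨by positivity, ?_⟩
  rw [div_lt_iff₀ (by positivity)]
  linarith

theorem diagonalPlacement_injective (c : Fin n → Fin m) :
    Function.Injective (diagonalPlacement c) := by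
  intro v w h
  have h0 : ((c v : ℕ) : ℝ) + (v : ℕ) / (2 * n) = ((c w : ℕ) : ℝ) + (w : ℕ) / (2 * n) := by
    simpa [diagonalPlacement] using congrArg (fun x => x 0) h
  obtain ⟨a1, a2⟩ := diagonalPlacement_offset v
  obtain ⟨b1, b2⟩ := diagonalPlacement_offset w
  have h1 : (c v : ℕ) = c w := by
    have e1 : ((c v : ℕ) : ℝ) < (c w : ℕ) + 1 := by linarith
    have e2 : ((c w : ℕ) : ℝ) < (c v : ℕ) + 1 := by linarith
    have e1' : (c v : ℕ) < c w + 1 := by exact_mod_cast e1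
    have e2' : (c w : ℕ) < c v + 1 := by exact_mod_cast e2
    omega
  rw [h1] at h0
  have hn : (0 : ℝ) < n := by exact_mod_cast v.pos
  have h2 := add_left_cancel h0
  rw [div_left_inj' (by positivity)] at h2
  exact Fin.ext (by exact_mod_cast h2)

/-- A point covered by the triangle of an edge determines indices `s` and `t`, and the edge is then
one of the `DiagonalEdge s t`. -/
theorem exists_diagonal_index (c : Fin n → Fin m) (p : EuclideanSpace ℝ (Fin 2)) :
    ∃ s t : Fin (m + 1), ∀ e : Finset (Fin n), #e = 3 →
      p ∈ convexHull ℝ (diagonalPlacement c '' e) → DiagonalEdge s t e c := by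
  have coords : ∀ x y z, p ∈ convexHull ℝ (diagonalPlacement c '' ({x, y, z} : Finset (Fin n))) →
      ∃ w₁ w₂ w₃ : ℝ, 0 ≤ w₁ ∧ 0 ≤ w₂ ∧ 0 ≤ w₃ ∧ w₁ + w₂ + w₃ = 1 ∧
      p 0 = w₁ * ((c x : ℕ) + (x : ℕ) / (2 * n)) + w₂ * ((c y : ℕ) + (y : ℕ) / (2 * n)) +
        w₃ * ((c z : ℕ) + (z : ℕ) / (2 * n)) ∧
      p 1 = w₁ * (2 * m) ^ (c x : ℕ) + w₂ * (2 * m) ^ (c y : ℕ) + w₃ * (2 * m) ^ (c z : ℕ) := by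
    intro x y z h
    rw [coe_insert, coe_insert, coe_singleton, Set.image_insert_eq, Set.image_insert_eq,
      Set.image_singleton] at h
    obtain ⟨w₁, w₂, w₃, h1, h2, h3, h4, h5⟩ := exists_weights_of_mem_convexHull_triple h
    refine ⟨w₁, w₂, w₃, h1, h2, h3, h4, ?_, ?_⟩ <;>
      · rw [h5]; simp [diagonalPlacement]
  -- A covering triangle bounds the coordinates of `p` and so keeps both indices at most `m`. If
  -- there is none, any indices do.
  by_cases hcov : ∃ e : Finset (Fin n), #e = 3 ∧ p ∈ convexHull ℝ (diagonalPlacement c '' e)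
  swap
  · refine ⟨0, 0, fun e he hp => absurd ⟨e, he, hp⟩ hcov⟩
  obtain ⟨e, he, hp⟩ := hcov
  obtain ⟨x, y, z, -, -, -, rfl⟩ := card_eq_three.1 he
  obtain ⟨w₁, w₂, w₃, h1, h2, h3, h4, hp0, hp1⟩ := coords x y z hp
  have hm : (1 : ℝ) ≤ m := by exact_mod_cast (c x).pos
  have hK1 : (1 : ℝ) < 2 * m := by linarith
  have hcm : ∀ v, ((c v : ℕ) : ℝ) + 1 ≤ m := fun v => by exact_mod_cast (c v).2
  have hcoord : ∀ v : Fin n, 0 ≤ ((c v : ℕ) : ℝ) + (v : ℕ) / (2 * n) ∧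
      ((c v : ℕ) : ℝ) + (v : ℕ) / (2 * n) ≤ m := fun v => by
    have h1 := diagonalPlacement_offset v
    have h2 : (0 : ℝ) ≤ (c v : ℕ) := Nat.cast_nonneg _
    exact ⟨by linarith [h1.1], by linarith [h1.2, hcm v]⟩
  have hpow : ∀ v, 1 ≤ (2 * (m : ℝ)) ^ (c v : ℕ) ∧ (2 * (m : ℝ)) ^ (c v : ℕ) ≤ (2 * m) ^ m :=
    fun v => ⟨one_le_pow₀ hK1.le, pow_le_pow_right₀ hK1.le (c v).2.le⟩
  have convex_bound : ∀ {a b u v w : ℝ}, a ≤ u ∧ u ≤ b → a ≤ v ∧ v ≤ b → a ≤ w ∧ w ≤ b →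
      a ≤ w₁ * u + w₂ * v + w₃ * w ∧ w₁ * u + w₂ * v + w₃ * w ≤ b := by
    intro a b u v w hu hv hw
    exact ⟨le_weighted_average h1 h2 h3 h4 hu.1 hv.1 hw.1,
      weighted_average_le h1 h2 h3 h4 hu.2 hv.2 hw.2⟩
  obtain ⟨px0, pxm⟩ := hp0 ▸ convex_bound (hcoord x) (hcoord y) (hcoord z)
  obtain ⟨py1, pym⟩ := hp1 ▸ convex_bound (hpow x) (hpow y) (hpow z)
  obtain ⟨t, ht, ht'⟩ := exists_nat_pow_near py1 hK1
  have htm : t < m + 1 := Nat.lt_succ_of_le ((pow_le_pow_iff_right₀ hK1).1 (ht.trans pym))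
  have hsm : ⌊p 0⌋₊ < m + 1 := Nat.lt_succ_of_le (Nat.floor_le_of_le pxm)
  refine ⟨⟨⌊p 0⌋₊, hsm⟩, ⟨t, htm⟩, fun e' he' hp' => ?_⟩
  have main : ∀ x y z, c x < c y → c y < c z →
      p ∈ convexHull ℝ (diagonalPlacement c '' ({x, y, z} : Finset (Fin n))) →
      DiagonalTriple ⌊p 0⌋₊ t (c x) (c y) (c z) := by
    intro x y z hxy hyz h
    obtain ⟨w₁, w₂, w₃, h1, h2, h3, h4, h5, h6⟩ := coords x y z h
    have ox := diagonalPlacement_offset x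
    have oy := diagonalPlacement_offset y
    have oz := diagonalPlacement_offset z
    exact diagonalTriple_of_weights hxy hyz (c z).2 (by linarith) (by linarith) (by linarith)
      (by linarith) (by linarith) (by linarith) h1 h2 h3 h4 h5 h6 (Nat.floor_le px0)
      (Nat.lt_floor_add_one _) ht ht'
  by_cases hrainbow : ∃ x ∈ e', ∃ y ∈ e', x ≠ y ∧ c x = c y
  · exact Or.inl hrainbow
  push Not at hrainbow
  refine Or.inr ?_
  obtain ⟨x, y, z, hxy, hxz, hyz, rfl⟩ := card_eq_three.1 he'
  have n1 := hrainbow x (by simp) y (by simp) hxy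
  have n2 := hrainbow x (by simp) z (by simp) hxz
  have n3 := hrainbow y (by simp) z (by simp) hyz
  have perm : ∀ a b d, ({x, y, z} : Finset (Fin n)) = {a, b, d} → c a < c b → c b < c d →
      ∃ x' ∈ ({x, y, z} : Finset (Fin n)), ∃ y' ∈ ({x, y, z} : Finset (Fin n)),
      ∃ z' ∈ ({x, y, z} : Finset (Fin n)), DiagonalTriple ⌊p 0⌋₊ t (c x') (c y') (c z') := by
    intro a b d heq hab hbd
    rw [heq] at hp' ⊢
    exact ⟨a, by simp, b, by simp, d, by simp, main a b d hab hbd hp'⟩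
  rcases lt_or_gt_of_ne n1 with l1 | l1 <;> rcases lt_or_gt_of_ne n2 with l2 | l2 <;>
    rcases lt_or_gt_of_ne n3 with l3 | l3
  · exact perm x y z rfl l1 l3
  · exact perm x z y (by ext; simp only [mem_insert, mem_singleton]; tauto) l2 l3
  · exact absurd (l1.trans l3) l2.not_gt
  · exact perm z x y (by ext; simp only [mem_insert, mem_singleton]; tauto) l2 l1
  · exact perm y x z (by ext; simp only [mem_insert, mem_singleton]; tauto) l1 l2
  · exact absurd (l3.trans l1) l2.not_gt
  · exact perm y z x (by ext; simp only [mem_insert, mem_singleton]; tauto) l3 l2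
  · exact perm z y x (by ext; simp only [mem_insert, mem_singleton]; tauto) l3 l1

/-- Regular hypergraphs with many vertices have placements in which no point is covered by
substantially more than `2 / 9` of the edges. -/
theorem exists_placement_cover_lt {c : ℝ} (hc : 2 / 9 < c) {k : ℕ} (hk : 0 < k) :
    ∃ N : ℕ, ∀ n ≥ N, ∀ 𝓔 : Finset (Finset (Fin n)), (∀ e ∈ 𝓔, #e = 3) →
      (∀ v, #{e ∈ 𝓔 | v ∈ e} = k) → ∃ f : Fin n → EuclideanSpace ℝ (Fin 2),
        Function.Injective f ∧ ∀ p, ∀ S ⊆ 𝓔, (∀ e ∈ S, p ∈ convexHull ℝ (f '' e)) →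
          (#S : ℝ) < c * #𝓔 := by
  classical
  obtain ⟨δ, hδ⟩ : ∃ δ, δ = (c - 2 / 9) / 2 := ⟨_, rfl⟩
  have hδ0 : 0 < δ := by rw [hδ]; linarith
  obtain ⟨m, hm⟩ := exists_nat_gt (21 / δ)
  have hm0 : (0 : ℝ) < m := (by positivity : 0 < 21 / δ).trans hm
  have hm0' : 0 < m := by exact_mod_cast hm0
  have hP : 2 / 9 + 21 / m + δ ≤ c := by
    have : 21 / (m : ℝ) ≤ δ := by
      rw [div_le_iff₀ hm0]
      rw [div_lt_iff₀ hδ0] at hm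
      linarith
    linarith
  -- Since `#𝓔` is kn/3, the second moment condition (m+1)² · 3k · #𝓔 < (δ · #𝓔)² reads n >
  -- 9(m+1)²/δ².
  obtain ⟨N, hN⟩ := exists_nat_gt (9 * (m + 1) ^ 2 / δ ^ 2 : ℝ)
  refine ⟨N, fun n hn 𝓔 h3 hdeg => ?_⟩
  have hn' : 9 * ((m : ℝ) + 1) ^ 2 / δ ^ 2 < n := hN.trans_le (by exact_mod_cast hn)
  rw [div_lt_iff₀ (by positivity)] at hn'
  have hcard : k * n = 3 * #𝓔 := by
    rw [← sum_degree_eq h3, sum_congr rfl fun v _ => hdeg v]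
    simp [mul_comm]
  have hn0 : (0 : ℝ) < n := by
    by_contra! h
    nlinarith [sq_nonneg δ, sq_nonneg ((m : ℝ) + 1)]
  have hcard' : (k : ℝ) * n = 3 * #𝓔 := by exact_mod_cast hcard
  have hk' : (0 : ℝ) < k := by exact_mod_cast hk
  have hE0 : (0 : ℝ) < #𝓔 := by nlinarith [mul_pos hk' hn0]
  have hfin : Nonempty (Fin m) := ⟨⟨0, hm0'⟩⟩
  obtain ⟨col, hcol⟩ := exists_coloring_close (Q := Fin (m + 1) × Fin (m + 1)) (C := Fin m)
    (P := 2 / 9 + 21 / m) (δ := δ) h3 (fun v => (hdeg v).le)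
    (fun q e c => DiagonalEdge q.1 q.2 e c) (fun q e _ c d h => DiagonalEdge.congr h)
    (fun q e he => by exact_mod_cast card_diagonalEdge_le hm0' q.1 q.2 (h3 e he)) hδ0.le (by
      rw [Fintype.card_prod, Fintype.card_fin]
      push_cast
      have e1 : (9 * ((m : ℝ) + 1) ^ 2) * k < 3 * #𝓔 * δ ^ 2 := by
        rw [← hcard']; nlinarith
      nlinarith)
  refine ⟨diagonalPlacement col, diagonalPlacement_injective col, fun p S hS hp => ?_⟩
  obtain ⟨s, t, hst⟩ := exists_diagonal_index col p
  have h1 : #S ≤ #{e ∈ 𝓔 | DiagonalEdge s t e col} := card_le_card fun e he =>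
    mem_filter.2 ⟨hS he, hst e (h3 e (hS he)) (hp e he)⟩
  calc (#S : ℝ) ≤ #{e ∈ 𝓔 | DiagonalEdge s t e col} := by exact_mod_cast h1
    _ < (2 / 9 + 21 / m + δ) * #𝓔 := hcol (s, t)
    _ ≤ c * #𝓔 := mul_le_mul_of_nonneg_right hP hE0.le

end DiagonalPlacement

/-! ### Translation between finite edge families and `Hypergraph` -/

section Conversion

open Finset

/-- The hypergraph on a finite type with the given finite sets as edges. -/
def Hypergraph.ofFinset {V : Type*} (𝓔 : Finset (Finset V)) : Hypergraph V where
  vertexSet := Set.univ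
  edgeSet := {e | ∃ e' ∈ 𝓔, (e' : Set V) = e}
  subset_vertexSet_of_mem_edgeSet' := fun _ _ => Set.subset_univ _

theorem ncard_coe_finset_filter {V : Type*} (𝓔 : Finset (Finset V)) (P : Set V → Prop)
    [DecidablePred fun e : Finset V => P e] :
    {e : Set V | (∃ e' ∈ 𝓔, (e' : Set V) = e) ∧ P e}.ncard =
      #(𝓔.filter fun e : Finset V => P e) := by
  have h : {e : Set V | (∃ e' ∈ 𝓔, (e' : Set V) = e) ∧ P e} =
      (fun e : Finset V => (e : Set V)) '' (𝓔.filter fun e : Finset V => P e) := by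
    ext e
    simp only [Set.mem_ofPred_eq, Set.mem_image, mem_coe, mem_filter]
    constructor
    · rintro ⟨⟨e', he', rfl⟩, hP⟩; exact ⟨e', ⟨he', hP⟩, rfl⟩
    · rintro ⟨e', ⟨he', hP⟩, rfl⟩; exact ⟨⟨e', he', rfl⟩, hP⟩
  rw [h, Set.ncard_image_of_injective _ coe_injective, Set.ncard_coe_finset]

theorem Hypergraph.ncard_edgeSet_ofFinset {V : Type*} (𝓔 : Finset (Finset V)) :
    (Hypergraph.ofFinset 𝓔).edgeSet.ncard = #𝓔 := by
  classical
  have := ncard_coe_finset_filter 𝓔 (fun _ => True)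
  simpa [Hypergraph.ofFinset] using this

theorem Hypergraph.exists_eq_ofFinset {V : Type*} [Fintype V] {H : Hypergraph V}
    (hH : H.vertexSet = Set.univ) : ∃ 𝓔, H = Hypergraph.ofFinset 𝓔 := by
  classical
  refine ⟨({e | (e : Set V) ∈ H.edgeSet} : Finset (Finset V)), Hypergraph.ext hH ?_⟩
  ext e
  simp only [Hypergraph.ofFinset, mem_filter_univ, Set.mem_ofPred_eq]
  constructor
  · intro h
    exact ⟨e.toFinset, by rwa [Set.coe_toFinset], Set.coe_toFinset e⟩
  · rintro ⟨e', h, rfl⟩; exact h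

theorem Hypergraph.degree_ofFinset {V : Type*} [DecidableEq V] (𝓔 : Finset (Finset V)) (v : V) :
    (Hypergraph.ofFinset 𝓔).degree v = #{e ∈ 𝓔 | v ∈ e} := by
  have := ncard_coe_finset_filter 𝓔 (fun e => v ∈ e)
  simpa [Hypergraph.degree, Hypergraph.ofFinset] using this

theorem Hypergraph.isUniform_ofFinset {V : Type*} {𝓔 : Finset (Finset V)} {r : ℕ} :
    (Hypergraph.ofFinset 𝓔).IsUniform r ↔ ∀ e ∈ 𝓔, #e = r := by
  constructor
  · intro h e he
    rw [← Set.ncard_coe_finset]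
    exact h _ ⟨e, he, rfl⟩
  · rintro h _ ⟨e, he, rfl⟩
    rw [Set.ncard_coe_finset]; exact h e he

open Classical in
theorem Hypergraph.coverCount_ofFinset {V : Type*} (𝓔 : Finset (Finset V))
    (f : V → EuclideanSpace ℝ (Fin 2)) (p : EuclideanSpace ℝ (Fin 2)) :
    (Hypergraph.ofFinset 𝓔).coverCount f p =
      #(𝓔.filter fun e : Finset V => p ∈ convexHull ℝ (f '' e)) :=
  ncard_coe_finset_filter 𝓔 fun e => p ∈ convexHull ℝ (f '' e)

theorem CoverAtLeast.hasPlanarOverlap {V : Type*} {𝓔 : Finset (Finset V)} {m : ℕ} {c : ℝ}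
    (h : CoverAtLeast 𝓔 m) (hc : c * #𝓔 ≤ m) : (Hypergraph.ofFinset 𝓔).HasPlanarOverlap c := by
  classical
  intro f _
  obtain ⟨p, S, hS, hm, hp⟩ := h f
  refine ⟨p, ?_⟩
  rw [Hypergraph.ncard_edgeSet_ofFinset, Hypergraph.coverCount_ofFinset]
  refine hc.trans (Nat.cast_le.2 (hm.trans (card_le_card fun e he => ?_)))
  exact mem_filter.2 ⟨hS he, hp e he⟩

end Conversion

theorem theorem1p2 :
    (∀ ε : ℝ, 0 < ε → ∃ k : ℕ, 0 < k ∧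
      ∃ (ν : ℕ → ℕ) (H : ∀ i : ℕ, Hypergraph (Fin (ν i))), StrictMono ν ∧
        ∀ i : ℕ, V(H i) = Set.univ ∧ (H i).IsUniform 3 ∧ (H i).IsRegular k ∧
          (H i).HasPlanarOverlap (2 / 9 - ε)) ∧
    (∀ c : ℝ, 2 / 9 < c → ∀ k : ℕ, 0 < k →
      ∃ N : ℕ, ∀ n : ℕ, N ≤ n → ∀ H : Hypergraph (Fin n),
        V(H) = Set.univ → H.IsUniform 3 → H.IsRegular k → ¬ H.HasPlanarOverlap c) := by
  constructor
  · intro ε hε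
    -- Capping `ε` at 2/9 keeps the overlap constant nonnegative; for larger `ε` the claim is
    -- weaker.
    obtain ⟨k, hk, h⟩ := exists_regular_overlap (lt_min hε (by norm_num : (0 : ℝ) < 2 / 9))
      (min_le_right _ _)
    obtain ⟨ν, hν, h⟩ := Filter.extraction_of_frequently_atTop (Filter.frequently_atTop.2 h)
    choose m 𝓕 h3 hdeg hcov hm using h
    refine ⟨k, hk, ν, fun i => Hypergraph.ofFinset (𝓕 i), hν, fun i => ⟨rfl,
      Hypergraph.isUniform_ofFinset.2 (h3 i), fun v _ => ?_, (hcov i).hasPlanarOverlap ?_⟩⟩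
    · rw [Hypergraph.degree_ofFinset, hdeg]
    · refine le_trans (mul_le_mul_of_nonneg_right ?_ (Nat.cast_nonneg _)) (hm i)
      linarith [min_le_left ε (2 / 9)]
  · intro c hc k hk
    obtain ⟨N, hN⟩ := exists_placement_cover_lt hc hk
    refine ⟨N, fun n hn H hV hU hR hO => ?_⟩
    obtain ⟨𝓔, rfl⟩ := Hypergraph.exists_eq_ofFinset hV
    obtain ⟨f, hf, hlt⟩ := hN n hn 𝓔 (Hypergraph.isUniform_ofFinset.1 hU) fun v => by
      rw [← Hypergraph.degree_ofFinset]; exact hR v (Set.mem_univ v)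
    obtain ⟨p, hp⟩ := hO f hf.injOn
    classical
    rw [Hypergraph.ncard_edgeSet_ofFinset, Hypergraph.coverCount_ofFinset] at hp
    exact absurd hp (not_le.2 (hlt p _ (Finset.filter_subset _ _) fun e he =>
      (Finset.mem_filter.1 he).2))
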